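/- Let $d,M\ge 1$, let $H=H(x,p)$ be a $C^3$ Hamiltonian on $\mathbb R^d\times\mathbb R^d$ and let $u_0^{[1]},\dots,u_0^{[M]}:\mathbb R^d\to\mathbb R^d$ be initial data (for instance $u_0^{[k]}=\nabla S_0^{[k]}$). For each $k$ let $\phi^{[k]}(t,x,p)\in\mathbb R^d$ be a level set function, that is, a $C^2$ solution on $[0,\infty)\times\mathbb R^d\times\mathbb R^d$ of the Liouville equation $$\partial_t\phi^{[k]}+\nabla_pH\cdot\nabla_x\phi^{[k]}-\nabla_xH\cdot\nabla_p\phi^{[k]}=0,\qquad \phi^{[k]}(0,x,p)=p-u_0^{[k]}(x).$$ For a locally Lipschitz $G:\mathbb R^d\to\mathbb R$ define the ensemble average $$\langle G(t,x)\rangle=\int G(p)\,\frac1M\sum_{k=1}^M\delta(\phi^{[k]}(t,x,p))\,dp=\frac1M\sum_{k=1}^M\ \sum_{p:\,\phi^{[k]}(t,x,p)=0}\frac{G(p)}{|\det\partial_p\phi^{[k]}(t,x,p)|}.$$ *Discretisation.* Let $N\ge1$, $h=1/N$, $\Delta t>0$, $\lambda=\Delta t/h$, $t_n=n\Delta t$.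 Let $\delta_\omega(x)=\frac1\omega\beta(x/\omega)$ for $|x|\le\omega$ and $\delta_\omega(x)=0$ otherwise, where $\beta$ is Lipschitz on $\mathbb R$, vanishes outside $[-1,1]$ and has integral $1$. On the grid $\mathbf j,\mathbf l\in\{1,\dots,N\}^d$ put $$\psi^\omega_{0,\mathbf j,\mathbf l}=\frac1M\sum_{k=1}^M\prod_{i=1}^d\delta_\omega\big(l_ih-u^{[k]}_{0,i}(\mathbf jh)\big),$$ and let $\psi^\omega_{n+1}$ be obtained from $\psi^\omega_n$ by the forward Euler upwind scheme $$\psi^\omega_{n+1}=\psi^\omega_n-\lambda\sum_{i=1}^d\Big[\{\partial_{p_i}H\}_-(T_i^+-I)+\{\partial_{p_i}H\}_+(I-T_i^-)-\{\partial_{x_i}H\}_+(P_i^+-I)-\{\partial_{x_i}H\}_-(I-P_i^-)\Big]\psi^\omega_n .$$ Here the derivatives of $H$ are taken at $(\mathbf jh,\mathbf lh)$, $\alpha_+=\max(\alpha,0)$, $\alpha_-=\min(\alpha,0)$, $T_i^\pm$ and $P_i^\pm$ shift $j_i$ and $l_i$ by $\pm1$, and values outside of the grid are $0$. Put $$\langle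 G^\omega_{n,\mathbf j}\rangle=N^{-d}\sum_{\mathbf l\in\{1,\dots,N\}^d}G(\mathbf l/N)\,\psi^\omega_{n,\mathbf j,\mathbf l}.$$ The CFL condition is $\lambda\sum_{i=1}^d\big(|\partial_{x_i}H|+|\partial_{p_i}H|\big)\le1$ on $[0,1]^{2d}$. *Admissible points.* Let $K\subset[0,\infty)\times\mathbb R^d$ be compact such that for every $(t,x)\in K$, every $k$ and every $p$ with $\phi^{[k]}(t,x,p)=0$: the Jacobian $\det\partial_p\phi^{[k]}(t,x,p)$ is nonzero, and there is a solution $(X,P)$ on $[0,t]$ of $X'=\nabla_pH$, $P'=-\nabla_xH$ with $(X,P)(t)=(x,p)$ that stays in the open box $(0,1)^{2d}$. **Lemma.** For every $(t,x)\in K$ and every $k$, $\phi^{[k]}(t,x,\cdot)$ has only finitely many zeros, and there is a constant $C>0$, independent of $h$, $\omega$, $\Delta t$, $n$, $\mathbf j$, such that for all $N\ge1$ and $\Delta t>0$ satisfying the CFL condition, all integers $n\ge0$ and all $\mathbf j\in\{1,\dots,N\}^d$ with $(t_n,\mathbf j/N)\in K$, and all $\omega\ge h$, $$\big|\langle G(t_n,\mathbf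 j/N)\rangle-\langle G^\omega_{n,\mathbf j}\rangle\big|\le C\Big(\omega+\frac{dh}{\omega^2}\Big).$$ For the choice $\omega=(dh)^{1/3}$ one gets $$\big|\langle G(t_n,\mathbf j/N)\rangle-\langle G^\omega_{n,\mathbf j}\rangle\big|\le C(dh)^{1/3}.$$ -/

import Mathlib

open Set MeasureTheory

noncomputable section

/-- The partial derivative `∂H/∂x_i` of a Hamiltonian `H(x, p)` at `z = (x, p)`. -/
def dHdx {d : ℕ} (H : (Fin d → ℝ) × (Fin d → ℝ) → ℝ) (i : Fin d)
    (z : (Fin d → ℝ) × (Fin d → ℝ)) : ℝ :=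
  fderiv ℝ H z (Pi.single i 1, 0)

/-- The partial derivative `∂H/∂p_i` of a Hamiltonian `H(x, p)` at `z = (x, p)`. -/
def dHdp {d : ℕ} (H : (Fin d → ℝ) × (Fin d → ℝ) → ℝ) (i : Fin d)
    (z : (Fin d → ℝ) × (Fin d → ℝ)) : ℝ :=
  fderiv ℝ H z (0, Pi.single i 1)

/-- `s ↦ (X s, P s)` solves Hamilton's equations `X' = ∇_p H`, `P' = -∇_x H` on `[0, t]`. -/
def IsBicharacteristic {d : ℕ} (H : (Fin d → ℝ) × (Fin d → ℝ) → ℝ) (t : ℝ)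
    (X P : ℝ → Fin d → ℝ) : Prop :=
  ∀ s ∈ Icc (0 : ℝ) t,
    HasDerivWithinAt X (fun i => dHdp H i (X s, P s)) (Icc 0 t) s ∧
    HasDerivWithinAt P (fun i => -dHdx H i (X s, P s)) (Icc 0 t) s

/-- `φ(t, x, p)` is a (vector valued, `C²`) level set function: a solution of the Liouville equation
`∂_t φ + ∇_p H · ∇_x φ - ∇_x H · ∇_p φ = 0` for `t ≥ 0`, with `φ(0, x, p) = p - u₀(x)`. -/
structure IsLevelSetFunction {d : ℕ} (H : (Fin d → ℝ) × (Fin d → ℝ) → ℝ)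
    (u₀ : (Fin d → ℝ) → Fin d → ℝ)
    (φ : ℝ → (Fin d → ℝ) → (Fin d → ℝ) → Fin d → ℝ) : Prop where
  smooth : ContDiffOn ℝ 2
    (fun q : ℝ × (Fin d → ℝ) × (Fin d → ℝ) => φ q.1 q.2.1 q.2.2) (Ici 0 ×ˢ univ)
  initial : ∀ x p, φ 0 x p = p - u₀ x
  liouville : ∀ t : ℝ, 0 < t → ∀ x p,
    deriv (fun s => φ s x p) t
      + ∑ i, dHdp H i (x, p) • fderiv ℝ (fun y => φ t y p) x (Pi.single i 1)
      - ∑ i, dHdx H i (x, p) • fderiv ℝ (fun q => φ t x q) p (Pi.single i 1) = 0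

/-- The branches `u_γ(t, x)` of the multi-valued solution: the zeros of `φ(t, x, ·)`. -/
def branches {d : ℕ} (φ : ℝ → (Fin d → ℝ) → (Fin d → ℝ) → Fin d → ℝ) (t : ℝ) (x : Fin d → ℝ) :
    Set (Fin d → ℝ) :=
  {p | φ t x p = 0}

/-- The Jacobian `|det ∂φ/∂p|` at `(t, x, p)`. -/
def levelJacobian {d : ℕ} (φ : ℝ → (Fin d → ℝ) → (Fin d → ℝ) → Fin d → ℝ) (t : ℝ)
    (x p : Fin d → ℝ) : ℝ :=
  |(fderiv ℝ (fun q => φ t x q) p).det|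

/-- The ensemble average `⟨G(t, x)⟩ = ∫ G(p) ψ(t, x, p) dp` with `ψ = (1/M) ∑_k δ(φ^[k])`, where
`δ(φ) = ∑_γ δ(p - u_γ) / J_γ`, the sum running over the zeros `u_γ` of `φ(t, x, ·)`. -/
def ensembleAverage {d M : ℕ} (G : (Fin d → ℝ) → ℝ)
    (φ : Fin M → ℝ → (Fin d → ℝ) → (Fin d → ℝ) → Fin d → ℝ) (t : ℝ) (x : Fin d → ℝ) : ℝ :=
  (1 / (M : ℝ)) * ∑ k, ∑ᶠ p ∈ branches (φ k) t x, G p / levelJacobian (φ k) t x p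

/-- Admissible profiles `β` of a smoothed delta function (the hat function `1 - |x|` and the cosine
profile `(1 + cos (π x)) / 2`, cut off outside `[-1, 1]`, are examples). -/
structure IsDeltaProfile (β : ℝ → ℝ) : Prop where
  lipschitz : ∃ L, LipschitzWith L β
  support : ∀ x, 1 < |x| → β x = 0
  integral : ∫ x, β x = 1

/-- The smoothed delta function `δ_ω` on `ℝ`. -/
def deltaReg (β : ℝ → ℝ) (ω x : ℝ) : ℝ :=
  if |x| ≤ ω then (1 / ω) * β (x / ω) else 0

/-- The grid point `j / N`. -/
def gridPoint {d : ℕ} (N : ℕ) (j : Fin d → ℤ) : Fin d → ℝ :=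
  fun i => (j i : ℝ) / N

/-- The indices `{1, …, N}^d`. -/
def gridIndices (d N : ℕ) : Finset (Fin d → ℤ) :=
  Fintype.piFinset fun _ => Finset.Icc 1 (N : ℤ)

/-- The discretised initial datum `(1/M) ∑_k ∏_i δ_ω(l_i h - u₀^[k]_i(h j))`, for `h = 1/N`. -/
def initialGrid {d M : ℕ} (u₀ : Fin M → (Fin d → ℝ) → Fin d → ℝ) (β : ℝ → ℝ) (ω : ℝ) (N : ℕ)
    (j l : Fin d → ℤ) : ℝ :=
  (1 / (M : ℝ)) * ∑ k, ∏ i, deltaReg β ω (gridPoint N l i - u₀ k (gridPoint N j) i)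

/-- One forward Euler step of the first order upwind scheme for the Liouville equation, at the node
`(j/N, l/N)`; here `lam = Δt / h`. -/
def upwindStep {d : ℕ} (H : (Fin d → ℝ) × (Fin d → ℝ) → ℝ) (N : ℕ) (lam : ℝ)
    (ψ : (Fin d → ℤ) → (Fin d → ℤ) → ℝ) (j l : Fin d → ℤ) : ℝ :=
  ψ j l - lam * ∑ i,
    (min (dHdp H i (gridPoint N j, gridPoint N l)) 0 * (ψ (j + Pi.single i 1) l - ψ j l)
      + max (dHdp H i (gridPoint N j, gridPoint N l)) 0 * (ψ j l - ψ (j - Pi.single i 1) l)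
      - max (dHdx H i (gridPoint N j, gridPoint N l)) 0 * (ψ j (l + Pi.single i 1) - ψ j l)
      - min (dHdx H i (gridPoint N j, gridPoint N l)) 0 * (ψ j l - ψ j (l - Pi.single i 1)))

open Classical in
/-- The numerical solution `ψ^ω_{n, j, l}` on the grid `{1, …, N}^{2d}`, with mesh size `h = 1/N` and
time step `Δt`; values outside of the grid are zero. -/
def upwindSolution {d M : ℕ} (H : (Fin d → ℝ) × (Fin d → ℝ) → ℝ)
    (u₀ : Fin M → (Fin d → ℝ) → Fin d → ℝ) (β : ℝ → ℝ) (ω : ℝ) (N : ℕ) (Δt : ℝ) :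
    ℕ → (Fin d → ℤ) → (Fin d → ℤ) → ℝ
  | 0 => fun j l =>
      if j ∈ gridIndices d N ∧ l ∈ gridIndices d N then initialGrid u₀ β ω N j l else 0
  | n + 1 => fun j l =>
      if j ∈ gridIndices d N ∧ l ∈ gridIndices d N then
        upwindStep H N (Δt / (1 / (N : ℝ))) (upwindSolution H u₀ β ω N Δt n) j l
      else 0

/-- The discretised ensemble average
`⟨G^ω_{n, j}⟩ = N^{-d} ∑_{l ∈ {1, …, N}^d} G(l/N) ψ^ω_{n, j, l}`. -/
def discreteAverage {d M : ℕ} (G : (Fin d → ℝ) → ℝ) (H : (Fin d → ℝ) × (Fin d → ℝ) → ℝ)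
    (u₀ : Fin M → (Fin d → ℝ) → Fin d → ℝ) (β : ℝ → ℝ) (ω : ℝ) (N : ℕ) (Δt : ℝ)
    (n : ℕ) (j : Fin d → ℤ) : ℝ :=
  (1 / (N : ℝ) ^ d) * ∑ l ∈ gridIndices d N,
    G (gridPoint N l) * upwindSolution H u₀ β ω N Δt n j l

/-- The CFL condition of the upwind scheme in the `2d`-dimensional phase space box `[0, 1]^{2d}`:
`(Δt / h) ∑_i (|∂H/∂x_i| + |∂H/∂p_i|) ≤ 1` with `h = 1/N`. -/
def CFL {d : ℕ} (H : (Fin d → ℝ) × (Fin d → ℝ) → ℝ) (N : ℕ) (Δt : ℝ) : Prop :=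
  ∀ z ∈ Icc (0 : Fin d → ℝ) 1 ×ˢ Icc (0 : Fin d → ℝ) 1,
    Δt / (1 / (N : ℝ)) * ∑ i, (|dHdx H i z| + |dHdp H i z|) ≤ 1

/-- The observation point `(t, x)` is admissible for `φ`: at each branch `p` of `φ(t, x, ·)` the
Jacobian does not vanish (no caustic), and the bicharacteristic that arrives at `(x, p)` at time `t`
stays inside the computational domain `(0, 1)^{2d}` for all times in `[0, t]`. -/
def IsAdmissiblePoint {d : ℕ} (H : (Fin d → ℝ) × (Fin d → ℝ) → ℝ)
    (φ : ℝ → (Fin d → ℝ) → (Fin d → ℝ) → Fin d → ℝ) (t : ℝ) (x : Fin d → ℝ) : Prop :=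
  ∀ p ∈ branches φ t x,
    levelJacobian φ t x p ≠ 0 ∧
    ∃ X P : ℝ → Fin d → ℝ, IsBicharacteristic H t X P ∧ X t = x ∧ P t = p ∧
      ∀ s ∈ Icc (0 : ℝ) t, ∀ i, X s i ∈ Ioo (0 : ℝ) 1 ∧ P s i ∈ Ioo (0 : ℝ) 1

end

/-!
The upwind scheme is a random walk in disguise: under the CFL condition `ψ_{n+1}` at a node is a convex
combination of values of `ψ_n` at that node and its neighbours, so `ψ_n` at a node is the expectation
of the initial datum at the end point of a walk that follows the bicharacteristics backwards in time
and is frozen once it leaves the grid, where the datum vanishes. All walks over one spatial node `j`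
are driven by the same uniform random variables (`flowMap`, `flowAvg`), and the discrete average
becomes the expectation of a lattice sum of smoothed delta functions `δ_ω(Y_l)`, where `Y_l` is the value of `φ(0, ·)` at the end
point of the walk that starts at `(j, l)`.

Since `φ` is constant along bicharacteristics, `Y_l` is a noisy sample of `φ(t, x, l h)`. Three estimates
describe the noise. The fluctuation of `Y_l` has moments of order `√h` (`Observable.moment_le`). The
coupling makes the fluctuations of `Y_l` and `Y_l'` agree up to `√(h ρ)` when the starting points have
distance `ρ` (`Observable.pair_moment_le`): two walks at distance `ρ` jump differently with
probability `O(ρ)` only. A walk that starts near a branch stays near its bicharacteristic, and hence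
leaves the grid with small probability (`IsInnerCurve.exit_le`). The constants do not depend on `Δt`
because the CFL condition bounds the product of `Δt` and the speed by `h`.

On the geometric side, compactness of `K` makes the branches uniformly nondegenerate, uniformly
separated, and bounded in number; `φ` is small only near them
(`IsLevelSetFunction.exists_levelGeometry`), and their bicharacteristics keep a uniform distance from
the boundary of the computational domain (`exists_uniform_margin`).

The rest is a statement on correlated samples (`exists_sample_error`).
* If `h ≤ ω²`, the samples within a multiple of `ω` of a branch `b` are replaced by the linearisation
  `Y_{l₀} + A (l - l₀) h` at the sample nearest to `b`. The common fluctuation only shifts the lattice sum,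
  so that a Riemann sum remains whose value is `1 / |det A|` up to `O(ω)`; the error of the replacement
  is `√(h/ω) ≤ ω + h/ω²` (`IsSample.linearise_le`, `IsSample.near_le`). Only the size and the
  Lipschitz constant of `δ_ω` enter. The other samples are of size `ω` with small probability
  (`IsSample.sum_annulus_le`, `IsSample.sum_tail_le`).
* If `ω² ≤ h`, it suffices to bound the discrete average by a multiple of `h/ω² ≥ 1`. Samples of size
  `ω` are clustered: with overwhelming probability their starting points are at distance at most
  `max(ω, h^{1-ε})` of each other (`IsSample.clustered_le`), which bounds their number.
-/

/-! ### The random flow of a lattice walk -/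

section Flow

variable {D Z I : Type*} [Fintype D]

/-- Transition probabilities: from `z` the walk makes the jump `a` with probability `q a z` and
stays with the remaining probability. -/
structure IsRate (q : D → Z → ℝ) : Prop where
  nonneg : ∀ a z, 0 ≤ q a z
  sum_le_one : ∀ z, ∑ a, q a z ≤ 1

/-- The left end of the interval of uniform variables for which the walk at `z` makes the jump `a`.
The intervals of the different jumps are placed one after the other in `[0, 1)`. -/
noncomputable def cellLeft (q : D → Z → ℝ) (z : Z) (a : D) : ℝ :=
  ∑ b, if Fintype.equivFin D b < Fintype.equivFin D a then q b z else 0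

/-- The set of uniform variables for which the walk at `z` makes the jump `a`. -/
noncomputable def cell (q : D → Z → ℝ) (z : Z) (a : D) : Set ℝ :=
  Ico (cellLeft q z a) (cellLeft q z a + q a z)

/-- The random map that moves all sites simultaneously, driven by the same variable `u`. -/
noncomputable def flowMap [AddCommMonoid Z] (q : D → Z → ℝ) (e : D → Z) (u : ℝ) (z : Z) : Z :=
  z + ∑ a, (cell q z a).indicator (fun _ => e a) u

/-- The transition operator of the walk. -/
def walkStep [Add Z] (q : D → Z → ℝ) (e : D → Z) (f : Z → ℝ) (z : Z) : ℝ :=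
  f z + ∑ a, q a z * (f (z + e a) - f z)

/-- The uniform distribution on `[0, 1)`. -/
noncomputable def unif : Measure ℝ := volume.restrict (Ico 0 1)

instance : IsProbabilityMeasure unif := ⟨by simp [unif]⟩

lemma measurableSet_cell (q : D → Z → ℝ) (z : Z) (a : D) : MeasurableSet (cell q z a) :=
  measurableSet_Ico

variable {q : D → Z → ℝ}

lemma IsRate.cellLeft_nonneg (hq : IsRate q) (z : Z) (a : D) : 0 ≤ cellLeft q z a :=
  Finset.sum_nonneg fun b _ => by split_ifs <;> simp [hq.nonneg]

lemma IsRate.cellLeft_add_le_one (hq : IsRate q) (z : Z) (a : D) :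
    cellLeft q z a + q a z ≤ 1 := by
  classical
  refine le_trans ?_ (hq.sum_le_one z)
  have h : q a z = ∑ b, if b = a then q b z else 0 := by simp
  rw [h, cellLeft, ← Finset.sum_add_distrib]
  refine Finset.sum_le_sum fun b _ => ?_
  by_cases hb : b = a
  · subst hb; simp
  · simp only [hb, if_false, add_zero]
    split_ifs <;> simp [hq.nonneg]

lemma IsRate.cell_subset (hq : IsRate q) (z : Z) (a : D) : cell q z a ⊆ Ico 0 1 := fun _ hu =>
  ⟨(hq.cellLeft_nonneg z a).trans hu.1, hu.2.trans_le (hq.cellLeft_add_le_one z a)⟩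

lemma IsRate.cellLeft_add_le (hq : IsRate q) (z : Z) {a b : D}
    (hab : Fintype.equivFin D a < Fintype.equivFin D b) :
    cellLeft q z a + q a z ≤ cellLeft q z b := by
  classical
  have h : q a z = ∑ c, if c = a then q c z else 0 := by simp
  rw [h, cellLeft, cellLeft, ← Finset.sum_add_distrib]
  refine Finset.sum_le_sum fun c _ => ?_
  by_cases hc : c = a
  · subst hc; simp [hab]
  · simp only [hc, if_false, add_zero]
    split_ifs with h1 h2
    · rfl
    · exact absurd (h1.trans hab) h2
    · exact hq.nonneg c z
    · rfl

lemma IsRate.cell_unique (hq : IsRate q) {z : Z} {a b : D} {u : ℝ} (ha : u ∈ cell q z a)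
    (hb : u ∈ cell q z b) : a = b := by
  rcases lt_trichotomy (Fintype.equivFin D a) (Fintype.equivFin D b) with h | h | h
  · have := hq.cellLeft_add_le z h
    linarith [ha.2, hb.1]
  · exact (Fintype.equivFin D).injective h
  · have := hq.cellLeft_add_le z h
    linarith [hb.2, ha.1]

lemma IsRate.measureReal_cell (hq : IsRate q) (z : Z) (a : D) :
    unif.real (cell q z a) = q a z := by
  rw [unif, measureReal_restrict_apply (measurableSet_cell q z a),
    inter_eq_left.2 (hq.cell_subset z a), cell, Real.volume_real_Ico_of_le (by
      linarith [hq.nonneg a z])]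
  ring

/-- The variables `u` for which the walk at `z` jumps. -/
def jumpSet (q : D → Z → ℝ) (z : Z) : Set ℝ := ⋃ a, cell q z a

/-- The variables `u` for which the walks at `z` and `z'` make different jumps. -/
def splitSet (q : D → Z → ℝ) (z z' : Z) : Set ℝ := ⋃ a, symmDiff (cell q z a) (cell q z' a)

lemma measurableSet_jumpSet (q : D → Z → ℝ) (z : Z) : MeasurableSet (jumpSet q z) :=
  MeasurableSet.iUnion fun a => measurableSet_cell q z a

lemma measurableSet_splitSet (q : D → Z → ℝ) (z z' : Z) : MeasurableSet (splitSet q z z') :=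
  MeasurableSet.iUnion fun a => (measurableSet_cell q z a).symmDiff (measurableSet_cell q z' a)

lemma IsRate.measureReal_jumpSet_le (hq : IsRate q) (z : Z) :
    unif.real (jumpSet q z) ≤ ∑ a, q a z :=
  (measureReal_iUnion_fintype_le _).trans
    (Finset.sum_le_sum fun a _ => (hq.measureReal_cell z a).le)

lemma symmDiff_Ico_subset (a b a' b' : ℝ) :
    symmDiff (Ico a b) (Ico a' b') ⊆ Ico (min a a') (max a a') ∪ Ico (min b b') (max b b') := by
  intro u hu
  simp only [mem_union, mem_Ico, min_le_iff, lt_max_iff]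
  rcases hu with ⟨⟨h1, h2⟩, h3⟩ | ⟨⟨h1, h2⟩, h3⟩ <;>
  · rw [mem_Ico, not_and, not_lt] at h3
    by_cases h4 : u < a ∨ u < a'
    · left; constructor <;> tauto
    · push Not at h4
      right
      have := h3 (by tauto)
      tauto

lemma measureReal_splitSet_le {z z' : Z} {η : ℝ} (h : ∀ a, |q a z - q a z'| ≤ η) :
    unif.real (splitSet q z z') ≤
      Fintype.card D * ((2 * Fintype.card D + 1) * η) := by
  have hη : ∀ a : D, 0 ≤ η := fun a => (abs_nonneg _).trans (h a)
  have hl : ∀ a, |cellLeft q z a - cellLeft q z' a| ≤ Fintype.card D * η := by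
    intro a
    rw [cellLeft, cellLeft, ← Finset.sum_sub_distrib]
    refine (Finset.abs_sum_le_sum_abs _ _).trans ?_
    refine (Finset.sum_le_card_nsmul Finset.univ _ η fun b _ => ?_).trans_eq
      (by rw [nsmul_eq_mul, Finset.card_univ])
    split_ifs
    · exact h b
    · simpa using hη a
  refine (measureReal_iUnion_fintype_le _).trans ?_
  rw [← nsmul_eq_mul, ← Finset.card_univ]
  refine Finset.sum_le_card_nsmul _ _ _ fun a _ => ?_
  rw [Finset.card_univ]
  refine (measureReal_mono (symmDiff_Ico_subset _ _ _ _)).trans ?_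
  refine (measureReal_union_le _ _).trans ?_
  have hvol : ∀ x y : ℝ, unif.real (Ico (min x y) (max x y)) ≤ |x - y| := by
    intro x y
    rw [unif]
    refine (ENNReal.toReal_mono ?_ (Measure.restrict_apply_le _ _)).trans ?_
    · simp
    · rw [← measureReal_def, Real.volume_real_Ico_of_le min_le_max, max_sub_min_eq_abs, abs_sub_comm]
  refine (add_le_add (hvol _ _) (hvol _ _)).trans ?_
  have : |cellLeft q z a + q a z - (cellLeft q z' a + q a z')| ≤
      |cellLeft q z a - cellLeft q z' a| + |q a z - q a z'| := by
    rw [add_sub_add_comm]; exact abs_add_le _ _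
  linarith [hl a, h a]

section AddCommGroup

variable [AddCommGroup Z] {e : D → Z}

lemma IsRate.flowMap_of_mem (hq : IsRate q) {u : ℝ} {z : Z} {a : D} (h : u ∈ cell q z a) :
    flowMap q e u z = z + e a := by
  classical
  rw [flowMap, Finset.sum_eq_single a]
  · simp [h]
  · intro b _ hb
    exact indicator_of_notMem (fun hb' => hb (hq.cell_unique hb' h)) _
  · simp

lemma flowMap_of_notMem {u : ℝ} {z : Z} (h : ∀ a, u ∉ cell q z a) :
    flowMap q e u z = z := by
  rw [flowMap, Finset.sum_eq_zero, add_zero]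
  exact fun a _ => indicator_of_notMem (h a) _

lemma flowMap_of_frozen {z : Z} (h : ∀ a, q a z = 0) (u : ℝ) : flowMap q e u z = z :=
  flowMap_of_notMem fun a => by simp [cell, h]

lemma IsRate.apply_flowMap (hq : IsRate q) (f : Z → ℝ) (u : ℝ) (z : Z) :
    f (flowMap q e u z) = f z + ∑ a, (cell q z a).indicator (fun _ => f (z + e a) - f z) u := by
  classical
  by_cases h : ∃ a, u ∈ cell q z a
  · obtain ⟨a, ha⟩ := h
    rw [hq.flowMap_of_mem ha, Finset.sum_eq_single a]
    · simp [ha]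
    · intro b _ hb
      exact indicator_of_notMem (fun hb' => hb (hq.cell_unique hb' ha)) _
    · simp
  · push Not at h
    rw [flowMap_of_notMem h, Finset.sum_eq_zero, add_zero]
    exact fun a _ => indicator_of_notMem (h a) _

/-- A function of the images of finitely many sites takes finitely many values, on measurable sets,
so it is integrable. -/
lemma integrable_flow [Finite I] (q : D → Z → ℝ) (e : D → Z) (Φ : (I → Z) → ℝ) (c : I → Z) :
    Integrable (fun u => Φ fun i => flowMap q e u (c i)) unif := by
  classical
  cases nonempty_fintype I
  let b : ℝ → (I × D → Bool) := fun u x => decide (u ∈ cell q (c x.1) x.2)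
  let g : (I × D → Bool) → ℝ := fun w => Φ fun i => c i + ∑ a, if w (i, a) then e a else 0
  have hb : Measurable b := by
    refine measurable_pi_lambda _ fun x => ?_
    refine measurable_to_bool ?_
    convert measurableSet_cell q (c x.1) x.2 using 1
    ext u
    simp [b]
  have hg : (fun u => Φ fun i => flowMap q e u (c i)) = g ∘ b := by
    funext u
    simp only [g, b, Function.comp, flowMap, indicator, decide_eq_true_eq]
  rw [hg]
  obtain ⟨C, hC⟩ := (Set.finite_range fun w => ‖g w‖).bddAbove
  refine Integrable.of_bound ((measurable_of_finite g).comp hb).aestronglyMeasurable C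
    (Filter.Eventually.of_forall fun u => hC ⟨b u, rfl⟩)

/-- One step of the random flow, as an operator on functions of a finite configuration of sites. -/
noncomputable def flowAvg [Finite I] (q : D → Z → ℝ) (e : D → Z) :
    Module.End ℝ ((I → Z) → ℝ) where
  toFun Φ c := ∫ u, Φ (fun i => flowMap q e u (c i)) ∂unif
  map_add' Φ Ψ := by
    funext c
    exact integral_add (integrable_flow q e Φ c) (integrable_flow q e Ψ c)
  map_smul' r Φ := by
    funext c
    exact integral_const_mul _ _

section Operator

variable [Finite I]

lemma flowAvg_apply (Φ : (I → Z) → ℝ) (c : I → Z) :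
    flowAvg q e Φ c = ∫ u, Φ (fun i => flowMap q e u (c i)) ∂unif := rfl

lemma flowAvg_mono {Φ Ψ : (I → Z) → ℝ} (h : ∀ c, Φ c ≤ Ψ c) (c : I → Z) :
    flowAvg q e Φ c ≤ flowAvg q e Ψ c :=
  integral_mono (integrable_flow q e Φ c) (integrable_flow q e Ψ c) fun _ => h _

lemma flowAvg_const (r : ℝ) (c : I → Z) : flowAvg q e (fun _ => r) c = r := by
  simp [flowAvg_apply]

lemma flowAvg_pow_mono {Φ Ψ : (I → Z) → ℝ} (h : ∀ c, Φ c ≤ Ψ c) (n : ℕ) (c : I → Z) :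
    (flowAvg q e ^ n) Φ c ≤ (flowAvg q e ^ n) Ψ c := by
  induction n generalizing c with
  | zero => exact h c
  | succ n ih =>
    rw [pow_succ', Module.End.mul_apply, Module.End.mul_apply]
    exact flowAvg_mono ih c

lemma flowAvg_pow_const (r : ℝ) (n : ℕ) :
    (flowAvg q e ^ n) (fun _ : I → Z => r) = fun _ => r := by
  induction n with
  | zero => rfl
  | succ n ih =>
    rw [pow_succ', Module.End.mul_apply, ih]
    exact funext fun c => flowAvg_const r c

/-- The comparison principle: a supersolution of the evolution equation of the flow dominates the
solution. -/
lemma flowAvg_pow_le_of_supersolution {W : ℕ → (I → Z) → ℝ} {κ : ℝ} (hκ : 0 ≤ κ) {n : ℕ}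
    (h : ∀ k < n, ∀ c, flowAvg q e (W k) c ≤ κ * W (k + 1) c) (c : I → Z) :
    (flowAvg q e ^ n) (W 0) c ≤ κ ^ n * W n c := by
  induction n generalizing c with
  | zero => simp
  | succ n ih =>
    rw [pow_succ', Module.End.mul_apply]
    have h1 := flowAvg_mono (q := q) (e := e) (ih fun k hk => h k (hk.trans n.lt_succ_self)) c
    have h2 : flowAvg q e (fun c => κ ^ n * W n c) c = κ ^ n * flowAvg q e (W n) c := by
      have : (fun c => κ ^ n * W n c) = κ ^ n • W n := rfl
      rw [this, map_smul]; rfl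
    rw [h2] at h1
    refine h1.trans ?_
    rw [pow_succ, mul_assoc]
    exact mul_le_mul_of_nonneg_left (h n n.lt_succ_self c) (pow_nonneg hκ n)

lemma IsRate.flowAvg_eval (hq : IsRate q) (f : Z → ℝ) (i : I) (c : I → Z) :
    flowAvg q e (fun c => f (c i)) c = walkStep q e f (c i) := by
  rw [flowAvg_apply]
  simp_rw [hq.apply_flowMap f]
  have hint : ∀ a, Integrable ((cell q (c i) a).indicator fun _ => f (c i + e a) - f (c i)) unif :=
    fun a => (integrable_const _).indicator (measurableSet_cell _ _ _)
  rw [integral_add (integrable_const _) (integrable_finsetSum _ fun a _ => hint a),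
    integral_finsetSum _ fun a _ => hint a, walkStep]
  congr 1
  · simp
  · refine Finset.sum_congr rfl fun a _ => ?_
    rw [integral_indicator_const _ (measurableSet_cell _ _ _), hq.measureReal_cell, smul_eq_mul]

lemma IsRate.flowAvg_pow_eval (hq : IsRate q) (f : Z → ℝ) (i : I) (n : ℕ) (c : I → Z) :
    (flowAvg q e ^ n) (fun c => f (c i)) c = (walkStep q e)^[n] f (c i) := by
  induction n generalizing c with
  | zero => rfl
  | succ n ih =>
    rw [pow_succ', Module.End.mul_apply, Function.iterate_succ_apply', ← hq.flowAvg_eval]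
    exact congrArg (fun Ψ => flowAvg q e Ψ c) (funext ih)

end Operator

/-- Off the splitting set the two walks make the same move. -/
lemma IsRate.flowMap_of_notMem_splitSet (hq : IsRate q) {z z' : Z} {u : ℝ}
    (hu : u ∉ splitSet q z z') :
    (u ∉ jumpSet q z ∧ flowMap q e u z = z ∧ flowMap q e u z' = z') ∨
      ∃ a, u ∈ jumpSet q z ∧ flowMap q e u z = z + e a ∧ flowMap q e u z' = z' + e a := by
  simp only [splitSet, mem_iUnion, not_exists, mem_symmDiff, not_or, not_and, not_not] at hu
  by_cases h : ∃ a, u ∈ cell q z a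
  · obtain ⟨a, ha⟩ := h
    exact Or.inr ⟨a, mem_iUnion.2 ⟨a, ha⟩, hq.flowMap_of_mem ha,
      hq.flowMap_of_mem ((hu a).1 ha)⟩
  · push Not at h
    exact Or.inl ⟨by simpa [jumpSet] using h, flowMap_of_notMem h,
      flowMap_of_notMem fun a ha => h a ((hu a).2 ha)⟩

lemma IsRate.flowMap_cases (hq : IsRate q) (u : ℝ) (z : Z) :
    (u ∉ jumpSet q z ∧ flowMap q e u z = z) ∨
      ∃ a, u ∈ jumpSet q z ∧ flowMap q e u z = z + e a := by
  by_cases h : ∃ a, u ∈ cell q z a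
  · obtain ⟨a, ha⟩ := h
    exact Or.inr ⟨a, mem_iUnion.2 ⟨a, ha⟩, hq.flowMap_of_mem ha⟩
  · push Not at h
    exact Or.inl ⟨by simpa [jumpSet] using h, flowMap_of_notMem h⟩

end AddCommGroup

end Flow

/-! ### Moments of the walk -/

/-- Second order Taylor bound for a power. -/
lemma abs_add_pow_sub_le (y x : ℝ) (k : ℕ) :
    |(y + x) ^ (k + 2) - y ^ (k + 2) - (k + 2) * y ^ (k + 1) * x|
      ≤ (k + 2) ^ 2 * ((|y| + |x|) ^ k * x ^ 2) := by
  induction k with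
  | zero =>
    have : (y + x) ^ (0 + 2) - y ^ (0 + 2) - ((0 : ℕ) + 2) * y ^ (0 + 1) * x = x ^ 2 := by
      push_cast; ring
    rw [this, abs_of_nonneg (sq_nonneg x)]
    push_cast
    nlinarith [sq_nonneg x]
  | succ k ih =>
    have h1 : (y + x) ^ (k + 1 + 2) - y ^ (k + 1 + 2) - ((k + 1 : ℕ) + 2) * y ^ (k + 1 + 1) * x
        = (y + x) * ((y + x) ^ (k + 2) - y ^ (k + 2) - (k + 2) * y ^ (k + 1) * x)
          + (k + 2) * y ^ (k + 1) * x ^ 2 := by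
      push_cast; ring
    rw [h1]
    refine (abs_add_le _ _).trans ?_
    rw [abs_mul, abs_mul, abs_mul, abs_pow, abs_of_nonneg (sq_nonneg x)]
    have hk : |(k : ℝ) + 2| = k + 2 := abs_of_nonneg (by positivity)
    rw [hk]
    have h2 : |y + x| * |(y + x) ^ (k + 2) - y ^ (k + 2) - (k + 2) * y ^ (k + 1) * x|
        ≤ (|y| + |x|) * ((k + 2) ^ 2 * ((|y| + |x|) ^ k * x ^ 2)) :=
      mul_le_mul (abs_add_le _ _) ih (abs_nonneg _) (by positivity)
    have h3 : (k + 2 : ℝ) * |y| ^ (k + 1) * x ^ 2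
        ≤ (k + 2) * (|y| + |x|) ^ (k + 1) * x ^ 2 := by
      gcongr
      linarith [abs_nonneg x]
    refine (add_le_add h2 h3).trans ?_
    have h4 : (|y| + |x|) * ((k + 2) ^ 2 * ((|y| + |x|) ^ k * x ^ 2))
        + (k + 2) * (|y| + |x|) ^ (k + 1) * x ^ 2
        = ((k + 2 : ℝ) ^ 2 + (k + 2)) * ((|y| + |x|) ^ (k + 1) * x ^ 2) := by ring
    rw [h4]
    refine mul_le_mul_of_nonneg_right ?_ (by positivity)
    push_cast
    nlinarith [(Nat.cast_nonneg k : (0 : ℝ) ≤ k)]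

/-- The growth rate in `integral_add_pow_le`. -/
noncomputable def momentRate (k : ℕ) (A : ℝ) : ℝ := (k + 2) * A + (k + 2) ^ 2 * ((1 + A) ^ k * A)

lemma momentRate_nonneg (k : ℕ) {A : ℝ} (hA : 0 ≤ A) : 0 ≤ momentRate k A := by
  unfold momentRate; positivity

/-- The growth of a moment under a small random increment `ξ` whose mean is `O(dt σ)` and whose
second moment is `O(dt σ²)`. -/
lemma integral_add_pow_le {μ : Measure ℝ} [IsProbabilityMeasure μ] (k : ℕ) {A σ y dt : ℝ}
    (hA : 0 ≤ A) (hσ : 0 ≤ σ) {ξ : ℝ → ℝ} (h1 : Integrable ξ μ) (h2 : Integrable (fun u => ξ u ^ 2) μ)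
    (h3 : Integrable (fun u => (y + ξ u) ^ (k + 2)) μ)
    (hdt : 0 ≤ dt) (hb : ∀ u, |ξ u| ≤ A * σ) (hm : |∫ u, ξ u ∂μ| ≤ A * dt * σ)
    (hs : ∫ u, ξ u ^ 2 ∂μ ≤ A * dt * σ ^ 2) :
    ∫ u, (y + ξ u) ^ (k + 2) ∂μ
      ≤ y ^ (k + 2) + momentRate k A * dt * (|y| ^ (k + 2) + σ ^ (k + 2)) := by
  set M := max |y| σ with hM
  have hM0 : 0 ≤ M := (abs_nonneg y).trans (le_max_left _ _)
  have hMpow : M ^ (k + 2) ≤ |y| ^ (k + 2) + σ ^ (k + 2) := by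
    rcases max_choice |y| σ with h | h <;> rw [hM, h] <;>
      linarith [pow_nonneg (abs_nonneg y) (k + 2), pow_nonneg hσ (k + 2)]
  have hpt : ∀ u, (y + ξ u) ^ (k + 2) ≤ y ^ (k + 2) + (k + 2) * y ^ (k + 1) * ξ u
      + (k + 2) ^ 2 * ((1 + A) * M) ^ k * ξ u ^ 2 := by
    intro u
    have h := le_of_abs_le (abs_add_pow_sub_le y (ξ u) k)
    have h' : (|y| + |ξ u|) ^ k ≤ ((1 + A) * M) ^ k := by
      refine pow_le_pow_left₀ (by positivity) ?_ k
      have := (hb u).trans (mul_le_mul_of_nonneg_left (le_max_right |y| σ) hA)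
      linarith [le_max_left |y| σ]
    have h'' : ((k : ℝ) + 2) ^ 2 * ((|y| + |ξ u|) ^ k * ξ u ^ 2)
        ≤ (k + 2) ^ 2 * (((1 + A) * M) ^ k * ξ u ^ 2) := by gcongr
    linarith
  have hint : Integrable (fun u => y ^ (k + 2) + (k + 2) * y ^ (k + 1) * ξ u
      + (k + 2) ^ 2 * ((1 + A) * M) ^ k * ξ u ^ 2) μ :=
    ((integrable_const _).add (h1.const_mul _)).add (h2.const_mul _)
  refine (integral_mono h3 hint hpt).trans ?_
  have e : ∫ u, (y ^ (k + 2) + (k + 2) * y ^ (k + 1) * ξ u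
      + (k + 2) ^ 2 * ((1 + A) * M) ^ k * ξ u ^ 2) ∂μ
      = y ^ (k + 2) + (k + 2) * y ^ (k + 1) * ∫ u, ξ u ∂μ
        + (k + 2) ^ 2 * ((1 + A) * M) ^ k * ∫ u, ξ u ^ 2 ∂μ := by
    rw [integral_add (by exact (integrable_const _).add (h1.const_mul _)) (h2.const_mul _),
      integral_add (integrable_const _) (h1.const_mul _), integral_const_mul, integral_const_mul]
    simp
  rw [e, add_assoc]
  refine add_le_add le_rfl ?_
  have b1 : ((k : ℝ) + 2) * y ^ (k + 1) * ∫ u, ξ u ∂μ ≤ (k + 2) * M ^ (k + 1) * (A * dt * M) := by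
    refine (le_abs_self _).trans ?_
    rw [abs_mul, abs_mul, abs_pow, abs_of_nonneg (by positivity : (0 : ℝ) ≤ k + 2)]
    refine mul_le_mul ?_ (hm.trans ?_) (abs_nonneg _) (by positivity)
    · gcongr; exact le_max_left _ _
    · gcongr; exact le_max_right _ _
  have b2 : ((k : ℝ) + 2) ^ 2 * ((1 + A) * M) ^ k * ∫ u, ξ u ^ 2 ∂μ
      ≤ (k + 2) ^ 2 * ((1 + A) * M) ^ k * (A * dt * M ^ 2) := by
    refine mul_le_mul_of_nonneg_left (hs.trans ?_) (by positivity)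
    gcongr; exact le_max_right _ _
  refine (add_le_add b1 b2).trans ?_
  have e2 : ((k : ℝ) + 2) * M ^ (k + 1) * (A * dt * M)
      + (k + 2) ^ 2 * ((1 + A) * M) ^ k * (A * dt * M ^ 2)
      = momentRate k A * dt * M ^ (k + 2) := by
    rw [mul_pow, momentRate]; ring
  rw [e2]
  exact mul_le_mul_of_nonneg_left hMpow (mul_nonneg (momentRate_nonneg k hA) hdt)

lemma add_two_mul_pow_le {r h : ℝ} (h0 : 0 ≤ h) (hr : h ≤ r) (m : ℕ) :
    (r + 2 * h) ^ (m + 1) ≤ r ^ (m + 1) + 4 ^ (m + 1) * (h * r ^ m) := by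
  have r0 : 0 ≤ r := h0.trans hr
  induction m with
  | zero => norm_num; linarith
  | succ m ih =>
    have h4 : (4 : ℝ) ≤ 4 ^ (m + 1) := le_self_pow₀ (by norm_num) (by omega)
    have h5 : h * r ^ m * h ≤ h * r ^ (m + 1) := by
      rw [pow_succ, ← mul_assoc]; gcongr
    have h6 : 0 ≤ h * r ^ (m + 1) := by positivity
    calc (r + 2 * h) ^ (m + 1 + 1) = (r + 2 * h) ^ (m + 1) * (r + 2 * h) := pow_succ _ _
      _ ≤ (r ^ (m + 1) + 4 ^ (m + 1) * (h * r ^ m)) * (r + 2 * h) := by gcongr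
      _ = r ^ (m + 1 + 1) + (2 + 4 ^ (m + 1)) * (h * r ^ (m + 1))
          + 2 * 4 ^ (m + 1) * (h * r ^ m * h) := by ring
      _ ≤ r ^ (m + 1 + 1) + (2 + 4 ^ (m + 1)) * (h * r ^ (m + 1))
          + 2 * 4 ^ (m + 1) * (h * r ^ (m + 1)) := by gcongr
      _ ≤ r ^ (m + 1 + 1) + 4 ^ (m + 1 + 1) * (h * r ^ (m + 1)) := by
        have : (4 : ℝ) ^ (m + 1 + 1) = 4 * 4 ^ (m + 1) := by ring
        rw [this]; nlinarith

section Walk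

variable {D Z I P : Type*} [Fintype D] [AddCommGroup Z] [SeminormedAddCommGroup P] [Finite I]

/-- The bounds on a walk with mesh size `h` and time step `dt` that the moment estimates use. The
walk is frozen outside of the set `alive`, and `pt z` is the position of the site `z`. -/
structure WalkBounds (q : D → Z → ℝ) (e : D → Z) (alive : Set Z) (pt : Z →+ P)
    (h dt L : ℝ) : Prop where
  rate : IsRate q
  h_pos : 0 < h
  h_le_one : h ≤ 1
  dt_nonneg : 0 ≤ dt
  one_le : 1 ≤ L
  frozen : ∀ z ∉ alive, ∀ a, q a z = 0
  rate_le : ∀ a, ∀ z ∈ alive, q a z * h ≤ dt * L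
  rate_lip : ∀ a, ∀ z ∈ alive, ∀ z' ∈ alive, |q a z - q a z'| * h ≤ dt * L * ‖pt z - pt z'‖
  jump_le : ∀ a, ‖pt (e a)‖ ≤ h
  diam_le : ∀ z ∈ alive, ∀ z' ∈ alive, ‖pt z - pt z'‖ ≤ 1

/-- A time dependent function `g` that the walk conserves in the mean up to the truncation error
`O(h dt)` of the upwind scheme, with the Lipschitz bounds of a smooth function. -/
structure Observable (q : D → Z → ℝ) (e : D → Z) (alive : Set Z) (pt : Z →+ P)
    (h dt L : ℝ) (n : ℕ) (g : ℕ → Z → ℝ) : Prop where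
  mean : ∀ k < n, ∀ z ∈ alive, |walkStep q e (g k) z - g (k + 1) z| ≤ L * h * dt
  jump : ∀ k < n, ∀ z ∈ alive, ∀ a, |g k (z + e a) - g k z| ≤ L * h
  time : ∀ k < n, ∀ z ∈ alive, |g (k + 1) z - g k z| ≤ L * dt
  time' : ∀ k < n, ∀ z ∈ alive, |g (k + 1) z - g k z| ≤ L * h
  jump_lip : ∀ k < n, ∀ z ∈ alive, ∀ z' ∈ alive, ∀ a,
    |g k (z + e a) - g k z - (g k (z' + e a) - g k z')| ≤ L * h * ‖pt z - pt z'‖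
  time_lip : ∀ k < n, ∀ z ∈ alive, ∀ z' ∈ alive,
    |g (k + 1) z - g k z - (g (k + 1) z' - g k z')| ≤ L * dt * ‖pt z - pt z'‖

variable {q : D → Z → ℝ} {e : D → Z} {alive : Set Z} {pt : Z →+ P} {h dt L : ℝ} {n : ℕ}
  {g : ℕ → Z → ℝ}

lemma integrable_flow₁ (q : D → Z → ℝ) (e : D → Z) (f : Z → ℝ) (z : Z) :
    Integrable (fun u => f (flowMap q e u z)) unif :=
  integrable_flow q e (fun c : Unit → Z => f (c ())) (fun _ => z)

lemma integrable_flow₂ (q : D → Z → ℝ) (e : D → Z) (f : Z → Z → ℝ) (z z' : Z) :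
    Integrable (fun u => f (flowMap q e u z) (flowMap q e u z')) unif :=
  integrable_flow q e (fun c : Bool → Z => f (c true) (c false)) (fun b => if b then z else z')

lemma IsRate.integral_flow (hq : IsRate q) (f : Z → ℝ) (z : Z) :
    ∫ u, f (flowMap q e u z) ∂unif = walkStep q e f z :=
  hq.flowAvg_eval f () (fun _ : Unit => z)

lemma WalkBounds.measureReal_jumpSet_mul_le (w : WalkBounds q e alive pt h dt L) {z : Z}
    (hz : z ∈ alive) : unif.real (jumpSet q z) * h ≤ Fintype.card D * (dt * L) := by
  refine (mul_le_mul_of_nonneg_right (w.rate.measureReal_jumpSet_le z) w.h_pos.le).trans ?_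
  rw [Finset.sum_mul]
  refine (Finset.sum_le_card_nsmul _ _ _ fun a _ => w.rate_le a z hz).trans_eq ?_
  rw [nsmul_eq_mul, Finset.card_univ]

lemma WalkBounds.measureReal_splitSet_mul_le (w : WalkBounds q e alive pt h dt L) {z z' : Z}
    (hz : z ∈ alive) (hz' : z' ∈ alive) : unif.real (splitSet q z z') * h ≤
      Fintype.card D * (2 * Fintype.card D + 1) * (dt * L * ‖pt z - pt z'‖) := by
  have := measureReal_splitSet_le (q := q) (z := z) (z' := z')
    (η := dt * L * ‖pt z - pt z'‖ / h) fun a => by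
      rw [le_div_iff₀ w.h_pos]; exact w.rate_lip a z hz z' hz'
  refine (mul_le_mul_of_nonneg_right this w.h_pos.le).trans_eq ?_
  field_simp [w.h_pos.ne']

/-- The growth rate of the moments of one walk. -/
noncomputable def singleRate (D : Type*) [Fintype D] (L : ℝ) (m : ℕ) : ℝ :=
  momentRate (2 * m) (2 * L ^ 3 * (Fintype.card D + 1))

lemma one_add_mul_pow_le_exp {C dt : ℝ} (hC : 0 ≤ C) (hdt : 0 ≤ dt) (n : ℕ) :
    (1 + C * dt) ^ n ≤ Real.exp (C * (n * dt)) := by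
  have : C * (n * dt) = n * (C * dt) := by ring
  rw [this, Real.exp_nat_mul]
  refine pow_le_pow_left₀ (by positivity) ?_ n
  linarith [Real.add_one_le_exp (C * dt)]

/-- The moments of a conserved quantity along one walk: the fluctuations are of order `√h`. -/
lemma Observable.moment_le (w : WalkBounds q e alive pt h dt L)
    (o : Observable q e alive pt h dt L n g) (m : ℕ) (a : ℝ) (i : I) (c : I → Z) :
    (flowAvg q e ^ n) (fun c => alive.indicator (fun z => (g 0 z - a) ^ (2 * m + 2)) (c i)) c
      ≤ Real.exp (singleRate D L m * (n * dt)) *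
        ((g n (c i) - a) ^ (2 * m + 2) + h ^ (m + 1)) := by
  classical
  have hL := w.one_le
  have hh := w.h_pos
  have hdt := w.dt_nonneg
  set A : ℝ := 2 * L ^ 3 * (Fintype.card D + 1) with hA
  have hA0 : 0 ≤ A := by positivity
  have hC0 : 0 ≤ singleRate D L m := momentRate_nonneg _ hA0
  have hLA : 2 * L ≤ A := by
    have h1 : L ≤ L ^ 3 := le_self_pow₀ hL (by norm_num)
    have h2 : (1 : ℝ) ≤ Fintype.card D + 1 := by simp
    rw [hA]; nlinarith
  let V : ℕ → Z → ℝ := fun k z => (g k z - a) ^ (2 * m + 2) + h ^ (m + 1)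
  have hV : ∀ k z, 0 ≤ V k z := fun k z => by
    have : 0 ≤ (g k z - a) ^ (2 * m + 2) := Even.pow_nonneg ⟨m + 1, by ring⟩ _
    positivity
  have key : ∀ k < n, ∀ c : I → Z, flowAvg q e (fun c => alive.indicator (V k) (c i)) c
      ≤ (1 + singleRate D L m * dt) * alive.indicator (V (k + 1)) (c i) := by
    intro k hk c
    rw [flowAvg_apply]
    by_cases hz : c i ∈ alive
    swap
    · simp_rw [flowMap_of_frozen (e := e) (w.frozen _ hz)]
      simp [hz]
    set z := c i with hzdef
    refine (integral_mono (g := fun u => V k (flowMap q e u z))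
      (integrable_flow₁ q e (alive.indicator (V k)) z)
      (integrable_flow₁ q e (V k) z)
      fun u => indicator_le_self' (fun _ _ => hV k _) _).trans ?_
    rw [indicator_of_mem hz]
    simp only [V]
    set y := g (k + 1) z - a with hy
    let ξ : ℝ → ℝ := fun u => g k (flowMap q e u z) - g (k + 1) z
    have hξ : ∀ u, g k (flowMap q e u z) - a = y + ξ u := fun u => by simp only [ξ, hy]; ring
    have hsq : √h ^ 2 = h := Real.sq_sqrt hh.le
    have hhs : h ≤ √h := by
      have := Real.sqrt_le_one.2 w.h_le_one
      nlinarith [Real.sqrt_nonneg h]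
    have ht1 := o.time k hk z hz
    have ht2 := o.time' k hk z hz
    have hpt : ∀ u, |ξ u| ≤ 2 * L * h ∧ ξ u ^ 2 ≤
        (jumpSet q z).indicator (fun _ => 2 * (L * h) ^ 2) u + 2 * (L * dt * (L * h)) := by
      intro u
      have hsq' : (g (k + 1) z - g k z) ^ 2 ≤ L * dt * (L * h) := by
        rw [← sq_abs, sq]
        exact mul_le_mul ht1 ht2 (abs_nonneg _) (by positivity)
      rcases w.rate.flowMap_cases (e := e) u z with ⟨hu, h1⟩ | ⟨b, hu, h1⟩
      · simp only [ξ, h1, indicator_of_notMem hu]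
        rw [abs_sub_comm]
        constructor
        · nlinarith [mul_pos (zero_lt_one.trans_le hL) hh]
        · nlinarith [mul_nonneg (mul_nonneg (zero_le_one.trans hL) hdt)
            (mul_nonneg (zero_le_one.trans hL) hh.le)]
      · have hj := o.jump k hk z hz b
        have e1 : g k (z + e b) - g (k + 1) z
            = (g k (z + e b) - g k z) - (g (k + 1) z - g k z) := by ring
        simp only [ξ, h1, indicator_of_mem hu]
        rw [e1]
        constructor
        · refine (abs_sub _ _).trans ?_
          linarith
        · have : (g k (z + e b) - g k z) ^ 2 ≤ (L * h) ^ 2 := by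
            rw [← sq_abs]; exact pow_le_pow_left₀ (abs_nonneg _) hj 2
          nlinarith [sq_nonneg ((g k (z + e b) - g k z) + (g (k + 1) z - g k z))]
    have hmom := integral_add_pow_le (μ := unif) (2 * m) (A := A) (σ := √h) (y := y) (dt := dt)
      (ξ := ξ) hA0 (Real.sqrt_nonneg h)
      (integrable_flow₁ q e (fun x => g k x - g (k + 1) z) z)
      (integrable_flow₁ q e (fun x => (g k x - g (k + 1) z) ^ 2) z)
      (integrable_flow₁ q e (fun x => (y + (g k x - g (k + 1) z)) ^ (2 * m + 2)) z) hdt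
      (fun u => by
        refine (hpt u).1.trans ?_
        exact mul_le_mul hLA hhs hh.le hA0)
      (by
        have : ∫ u, ξ u ∂unif = walkStep q e (g k) z - g (k + 1) z := by
          simp only [ξ]
          rw [integral_sub (integrable_flow₁ q e (g k) z) (integrable_const _),
            w.rate.integral_flow]
          simp
        rw [this]
        refine (o.mean k hk z hz).trans ?_
        have : L * h * dt = L * dt * h := by ring
        rw [this]
        have hLA' : L ≤ A := by linarith
        gcongr)
      (by
        refine (integral_mono (integrable_flow₁ q e (fun x => (g k x - g (k + 1) z) ^ 2) z)
          (((integrable_const _).indicator (measurableSet_jumpSet q z)).add (integrable_const _))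
          fun u => (hpt u).2).trans ?_
        rw [integral_add' ((integrable_const _).indicator (measurableSet_jumpSet q z))
          (integrable_const _), integral_indicator_const _ (measurableSet_jumpSet q z)]
        have hj := w.measureReal_jumpSet_mul_le hz
        have e2 : unif.real (jumpSet q z) • (2 * (L * h) ^ 2)
            = 2 * L ^ 2 * h * (unif.real (jumpSet q z) * h) := by
          rw [smul_eq_mul]; ring
        have h5 : 2 * L ^ 2 * h * (unif.real (jumpSet q z) * h)
            ≤ 2 * L ^ 2 * h * (Fintype.card D * (dt * L)) := by gcongr
        have h6 : (0 : ℝ) ≤ dt * h := mul_nonneg hdt hh.le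
        have h7 : 2 * L ^ 2 * (dt * h) ≤ 2 * L ^ 3 * (dt * h) := by
          have : L ^ 2 ≤ L ^ 3 := pow_le_pow_right₀ hL (by norm_num)
          gcongr
        rw [e2, hsq, hA]
        simp only [integral_const, probReal_univ, smul_eq_mul, one_mul]
        nlinarith)
    simp_rw [hξ]
    rw [integral_add (integrable_flow₁ q e (fun x => (y + (g k x - g (k + 1) z)) ^ (2 * m + 2)) z)
      (integrable_const _)]
    have h8 : √h ^ (2 * m + 2) = h ^ (m + 1) := by
      rw [show 2 * m + 2 = 2 * (m + 1) by ring, pow_mul, hsq]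
    have h9 : |y| ^ (2 * m + 2) = y ^ (2 * m + 2) := Even.pow_abs ⟨m + 1, by ring⟩ _
    rw [h8, h9] at hmom
    simp only [integral_const, probReal_univ, smul_eq_mul, one_mul]
    have : momentRate (2 * m) A = singleRate D L m := rfl
    rw [this] at hmom
    linarith
  have h0 : ∀ c : I → Z, alive.indicator (fun z => (g 0 z - a) ^ (2 * m + 2)) (c i)
      ≤ alive.indicator (V 0) (c i) := fun c =>
    indicator_le_indicator (by simp only [V]; linarith [pow_pos hh (m + 1)])
  refine (flowAvg_pow_mono h0 n c).trans ?_
  refine (flowAvg_pow_le_of_supersolution (W := fun k c => alive.indicator (V k) (c i))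
    (by positivity) key c).trans ?_
  refine mul_le_mul (one_add_mul_pow_le_exp hC0 hdt n) (indicator_le_self' (fun _ _ => hV n _) _)
    (indicator_nonneg (fun _ _ => hV n _) _) (Real.exp_pos _).le

/-- The constant in the bound for the increments of a pair of walks. -/
noncomputable def pairConst (D : Type*) [Fintype D] (L : ℝ) : ℝ :=
  20 * L ^ 3 * ((Fintype.card D + 1) * (2 * Fintype.card D + 1))

/-- The growth rate of the moments of a pair of walks. -/
noncomputable def pairRate (D : Type*) [Fintype D] (L : ℝ) (m : ℕ) : ℝ :=
  momentRate (2 * m) (pairConst D L)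
    + 4 ^ (m + 1) * (Fintype.card D * (2 * Fintype.card D + 1) * L)

set_option maxHeartbeats 800000 in
/-- One step of the moment bound for a pair of walks: the moment of the difference. -/
lemma Observable.pair_moment_step (w : WalkBounds q e alive pt h dt L)
    (o : Observable q e alive pt h dt L n g) (m : ℕ) (a : ℝ) {k : ℕ} (hk : k < n) {z z' : Z}
    (hz : z ∈ alive) (hz' : z' ∈ alive) :
    ∫ u, (g k (flowMap q e u z) - g k (flowMap q e u z') - a) ^ (2 * m + 2) ∂unif
      ≤ (g (k + 1) z - g (k + 1) z' - a) ^ (2 * m + 2) + momentRate (2 * m) (pairConst D L) * dt *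
        ((g (k + 1) z - g (k + 1) z' - a) ^ (2 * m + 2)
          + (h * (‖pt z - pt z'‖ + h)) ^ (m + 1)) := by
  have hL := w.one_le
  have hL0 : 0 ≤ L := zero_le_one.trans hL
  have hh := w.h_pos
  have hdt := w.dt_nonneg
  have hR1 := w.diam_le z hz z' hz'
  have hR0 := norm_nonneg (pt z - pt z')
  have hjump := w.measureReal_jumpSet_mul_le hz
  have hsplit := w.measureReal_splitSet_mul_le hz hz'
  have jl := fun b => o.jump_lip k hk z hz z' hz' b
  have tl := o.time_lip k hk z hz z' hz'
  set R := ‖pt z - pt z'‖ with hR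
  set N : ℝ := (Fintype.card D : ℝ) with hN
  have hN0 : 0 ≤ N := Nat.cast_nonneg _
  set A : ℝ := pairConst D L with hA
  have hA' : A = 20 * L ^ 3 * ((N + 1) * (2 * N + 1)) := rfl
  have hA0 : 0 ≤ A := by rw [hA']; positivity
  have hLA : 4 * L ≤ A := by
    have h1 : L ≤ L ^ 3 := le_self_pow₀ hL (by norm_num)
    have h2 : (1 : ℝ) ≤ (N + 1) * (2 * N + 1) := by nlinarith
    rw [hA']; nlinarith
  set σ := √(h * (R + h)) with hσ
  have hσ0 : 0 ≤ σ := Real.sqrt_nonneg _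
  have hsq : σ ^ 2 = h * (R + h) := Real.sq_sqrt (by positivity)
  have hhσ : h ≤ σ := Real.le_sqrt_of_sq_le (by nlinarith)
  set y := g (k + 1) z - g (k + 1) z' - a with hy
  let Ξ : Z → Z → ℝ := fun x x' => g k x - g k x' - (g (k + 1) z - g (k + 1) z')
  let ξ : ℝ → ℝ := fun u => Ξ (flowMap q e u z) (flowMap q e u z')
  have hξ : ∀ u, g k (flowMap q e u z) - g k (flowMap q e u z') - a = y + ξ u := fun u => by
    simp only [ξ, Ξ, hy]; ring
  have tz := o.time' k hk z hz
  have tz' := o.time' k hk z' hz'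
  set T := g (k + 1) z - g k z with hT
  set T' := g (k + 1) z' - g k z' with hT'
  have hTT : |T - T'| ≤ 2 * (L * h) := (abs_sub _ _).trans (by linarith)
  have hTsq : (T - T') ^ 2 ≤ L * dt * R * (2 * (L * h)) := by
    rw [← sq_abs, sq]
    exact mul_le_mul tl hTT (abs_nonneg _) (by positivity)
  have hpos : 0 ≤ L * dt * R * (2 * (L * h)) := by positivity
  have hpt : ∀ u, |ξ u| ≤ 4 * L * h ∧ ξ u ^ 2 ≤
      (jumpSet q z).indicator (fun _ => 2 * (L * h * R) ^ 2) u
      + (splitSet q z z').indicator (fun _ => 16 * (L * h) ^ 2) u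
      + 2 * (L * dt * R * (2 * (L * h))) := by
    intro u
    have ij : 0 ≤ (jumpSet q z).indicator (fun _ => 2 * (L * h * R) ^ 2) u :=
      indicator_nonneg (fun _ _ => by positivity) _
    have is : 0 ≤ (splitSet q z z').indicator (fun _ => 16 * (L * h) ^ 2) u :=
      indicator_nonneg (fun _ _ => by positivity) _
    have habs : |ξ u| ≤ 4 * L * h := by
      have one : ∀ x ∈ alive, |g k (flowMap q e u x) - g k x| ≤ L * h := by
        intro x hx
        rcases w.rate.flowMap_cases (e := e) u x with ⟨_, h1⟩ | ⟨b, _, h1⟩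
        · rw [h1, sub_self, abs_zero]; positivity
        · rw [h1]; exact o.jump k hk x hx b
      have e1 : ξ u = (g k (flowMap q e u z) - g k z) - (g k (flowMap q e u z') - g k z')
          - (T - T') := by simp only [ξ, Ξ, hT, hT']; ring
      rw [e1]
      refine (abs_sub _ _).trans ?_
      have := abs_sub (g k (flowMap q e u z) - g k z) (g k (flowMap q e u z') - g k z')
      linarith [one z hz, one z' hz']
    refine ⟨habs, ?_⟩
    by_cases hu : u ∈ splitSet q z z'
    · rw [indicator_of_mem hu]
      have : ξ u ^ 2 ≤ (4 * L * h) ^ 2 := by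
        rw [← sq_abs]; exact pow_le_pow_left₀ (abs_nonneg _) habs 2
      have e2 : (4 * L * h) ^ 2 = 16 * (L * h) ^ 2 := by ring
      linarith
    · rcases w.rate.flowMap_of_notMem_splitSet (e := e) hu with ⟨_, h1, h2⟩ | ⟨b, hj, h1, h2⟩
      · have e1 : ξ u = -(T - T') := by simp only [ξ, Ξ, hT, hT', h1, h2]; ring
        rw [e1, neg_sq]
        linarith
      · have e1 : ξ u = (g k (z + e b) - g k z - (g k (z' + e b) - g k z')) - (T - T') := by
          simp only [ξ, Ξ, hT, hT', h1, h2]; ring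
        rw [indicator_of_mem hj, e1]
        have : (g k (z + e b) - g k z - (g k (z' + e b) - g k z')) ^ 2 ≤ (L * h * R) ^ 2 := by
          rw [← sq_abs]; exact pow_le_pow_left₀ (abs_nonneg _) (jl b) 2
        nlinarith [sq_nonneg ((g k (z + e b) - g k z - (g k (z' + e b) - g k z')) + (T - T'))]
  have hmom := integral_add_pow_le (μ := unif) (2 * m) (A := A) (σ := σ) (y := y) (dt := dt)
    (ξ := ξ) hA0 hσ0
    (integrable_flow₂ q e Ξ z z')
    (integrable_flow₂ q e (fun x x' => Ξ x x' ^ 2) z z')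
    (integrable_flow₂ q e (fun x x' => (y + Ξ x x') ^ (2 * m + 2)) z z') hdt
    (fun u => (hpt u).1.trans (mul_le_mul hLA hhσ hh.le hA0))
    (by
      have : ∫ u, ξ u ∂unif = (walkStep q e (g k) z - g (k + 1) z)
          - (walkStep q e (g k) z' - g (k + 1) z') := by
        simp only [ξ, Ξ]
        rw [integral_sub
          (by exact (integrable_flow₁ q e (g k) z).sub (integrable_flow₁ q e (g k) z'))
          (integrable_const _), integral_sub (integrable_flow₁ q e (g k) z)
          (integrable_flow₁ q e (g k) z'), w.rate.integral_flow, w.rate.integral_flow]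
        simp only [integral_const, probReal_univ, smul_eq_mul, one_mul]
        ring
      rw [this]
      refine (abs_sub _ _).trans ?_
      have h1 := o.mean k hk z hz
      have h2 := o.mean k hk z' hz'
      have h3 : 2 * L * dt * h ≤ A * dt * σ := by
        have : 2 * L ≤ A := by linarith
        gcongr
      linarith)
    (by
      have hi1 : Integrable ((jumpSet q z).indicator fun _ => 2 * (L * h * R) ^ 2) unif :=
        (integrable_const _).indicator (measurableSet_jumpSet q z)
      have hi2 : Integrable ((splitSet q z z').indicator fun _ => 16 * (L * h) ^ 2) unif :=
        (integrable_const _).indicator (measurableSet_splitSet q z z')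
      refine (integral_mono (integrable_flow₂ q e (fun x x' => Ξ x x' ^ 2) z z')
        ((hi1.add hi2).add (integrable_const _)) fun u => (hpt u).2).trans ?_
      rw [integral_add' (hi1.add hi2) (integrable_const _), integral_add' hi1 hi2,
        integral_indicator_const _ (measurableSet_jumpSet q z),
        integral_indicator_const _ (measurableSet_splitSet q z z')]
      have e2 : unif.real (jumpSet q z) • (2 * (L * h * R) ^ 2)
          = 2 * L ^ 2 * h * R ^ 2 * (unif.real (jumpSet q z) * h) := by
        rw [smul_eq_mul]; ring
      have e3 : unif.real (splitSet q z z') • (16 * (L * h) ^ 2)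
          = 16 * L ^ 2 * h * (unif.real (splitSet q z z') * h) := by
        rw [smul_eq_mul]; ring
      have h5 : 2 * L ^ 2 * h * R ^ 2 * (unif.real (jumpSet q z) * h)
          ≤ 2 * L ^ 2 * h * R * (N * (dt * L)) := by
        have : R ^ 2 ≤ R := by nlinarith
        gcongr
      have h5' : 16 * L ^ 2 * h * (unif.real (splitSet q z z') * h)
          ≤ 16 * L ^ 2 * h * (N * (2 * N + 1) * (dt * L * R)) := by gcongr
      have h7 : 4 * L ^ 2 * (dt * h * R) ≤ 4 * L ^ 3 * (dt * h * R) := by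
        have : L ^ 2 ≤ L ^ 3 := pow_le_pow_right₀ hL (by norm_num)
        gcongr
      rw [e2, e3, hsq, hA']
      simp only [integral_const, probReal_univ, smul_eq_mul, one_mul]
      have h8 : 2 * L ^ 2 * h * R * (N * (dt * L)) + 16 * L ^ 2 * h * (N * (2 * N + 1) * (dt * L * R))
          + 4 * L ^ 3 * (dt * h * R)
          = (2 * N + 16 * (N * (2 * N + 1)) + 4) * (L ^ 3 * (dt * h * R)) := by ring
      have h9 : (2 * N + 16 * (N * (2 * N + 1)) + 4) * (L ^ 3 * (dt * h * R))
          ≤ 20 * ((N + 1) * (2 * N + 1)) * (L ^ 3 * (dt * h * R)) := by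
        refine mul_le_mul_of_nonneg_right ?_ (by positivity)
        have hNN := mul_nonneg hN0 hN0
        linear_combination 8 * hNN + 42 * hN0
      have h10 : 20 * ((N + 1) * (2 * N + 1)) * (L ^ 3 * (dt * h * R))
          ≤ 20 * ((N + 1) * (2 * N + 1)) * (L ^ 3 * (dt * h * (R + h))) := by
        gcongr; linarith
      have h11 : 20 * ((N + 1) * (2 * N + 1)) * (L ^ 3 * (dt * h * (R + h)))
          = 20 * L ^ 3 * ((N + 1) * (2 * N + 1)) * dt * (h * (R + h)) := by ring
      have h12 : 2 * (L * dt * R * (2 * (L * h))) = 4 * L ^ 2 * (dt * h * R) := by ring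
      linarith)
  simp_rw [hξ]
  have h8 : σ ^ (2 * m + 2) = (h * (R + h)) ^ (m + 1) := by
    rw [show 2 * m + 2 = 2 * (m + 1) by ring, pow_mul, hsq]
  have h9 : |y| ^ (2 * m + 2) = y ^ (2 * m + 2) := Even.pow_abs ⟨m + 1, by ring⟩ _
  rwa [h8, h9] at hmom

/-- One step of the moment bound for a pair of walks: the moment of the distance. -/
lemma WalkBounds.pair_dist_step (w : WalkBounds q e alive pt h dt L) (m : ℕ) {z z' : Z}
    (hz : z ∈ alive) (hz' : z' ∈ alive) :
    ∫ u, (‖pt (flowMap q e u z) - pt (flowMap q e u z')‖ + h) ^ (m + 1) ∂unif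
      ≤ (1 + 4 ^ (m + 1) * (Fintype.card D * (2 * Fintype.card D + 1) * L) * dt) *
        (‖pt z - pt z'‖ + h) ^ (m + 1) := by
  have hh := w.h_pos
  have hsplit := w.measureReal_splitSet_mul_le hz hz'
  have hR0 := norm_nonneg (pt z - pt z')
  set R := ‖pt z - pt z'‖ with hR
  set N : ℝ := (Fintype.card D : ℝ) with hN
  have hdt := w.dt_nonneg
  have hL0 : 0 ≤ L := zero_le_one.trans w.one_le
  have hi : Integrable ((splitSet q z z').indicator
      fun _ => 4 ^ (m + 1) * (h * (R + h) ^ m)) unif :=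
    (integrable_const _).indicator (measurableSet_splitSet q z z')
  have hpt : ∀ u, (‖pt (flowMap q e u z) - pt (flowMap q e u z')‖ + h) ^ (m + 1)
      ≤ (R + h) ^ (m + 1) + (splitSet q z z').indicator
        (fun _ => 4 ^ (m + 1) * (h * (R + h) ^ m)) u := by
    intro u
    by_cases hu : u ∈ splitSet q z z'
    · rw [indicator_of_mem hu]
      refine le_trans ?_ (add_two_mul_pow_le hh.le (by linarith) m)
      refine pow_le_pow_left₀ (by positivity) ?_ _
      have one : ∀ x, ‖pt (flowMap q e u x) - pt x‖ ≤ h := by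
        intro x
        rcases w.rate.flowMap_cases (e := e) u x with ⟨_, h1⟩ | ⟨b, _, h1⟩
        · rw [h1, sub_self, norm_zero]; exact hh.le
        · rw [h1, map_add, add_sub_cancel_left]; exact w.jump_le b
      have e1 : pt (flowMap q e u z) - pt (flowMap q e u z') = (pt z - pt z')
          + (pt (flowMap q e u z) - pt z) - (pt (flowMap q e u z') - pt z') := by abel
      have : ‖pt (flowMap q e u z) - pt (flowMap q e u z')‖ ≤ R + h + h := by
        rw [e1]
        refine (norm_sub_le _ _).trans (add_le_add ((norm_add_le _ _).trans ?_) (one z'))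
        exact add_le_add le_rfl (one z)
      linarith
    · rw [indicator_of_notMem hu, add_zero]
      rcases w.rate.flowMap_of_notMem_splitSet (e := e) hu with ⟨_, h1, h2⟩ | ⟨b, _, h1, h2⟩
      · rw [h1, h2]
      · rw [h1, h2, map_add, map_add, add_sub_add_right_eq_sub]
  refine (integral_mono (integrable_flow₂ q e (fun x x' => (‖pt x - pt x'‖ + h) ^ (m + 1)) z z')
    ((integrable_const _).add hi) hpt).trans ?_
  rw [integral_add' (integrable_const _) hi,
    integral_indicator_const _ (measurableSet_splitSet q z z')]
  simp only [integral_const, probReal_univ, smul_eq_mul, one_mul]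
  have e1 : unif.real (splitSet q z z') * (4 ^ (m + 1) * (h * (R + h) ^ m))
      = 4 ^ (m + 1) * (R + h) ^ m * (unif.real (splitSet q z z') * h) := by ring
  have e2 : 4 ^ (m + 1) * (R + h) ^ m * (unif.real (splitSet q z z') * h)
      ≤ 4 ^ (m + 1) * (R + h) ^ m * (N * (2 * N + 1) * (dt * L * (R + h))) := by
    have : N * (2 * N + 1) * (dt * L * R) ≤ N * (2 * N + 1) * (dt * L * (R + h)) := by
      gcongr; linarith
    exact mul_le_mul_of_nonneg_left (hsplit.trans this) (by positivity)
  rw [e1]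
  refine (add_le_add le_rfl e2).trans_eq ?_
  ring

/-- The moments of the change of `g (Z) - g (Z')` along a pair of walks that are driven by the same
random variables. The walks separate with probability proportional to their distance, so
the fluctuation of the difference is of order `√(h · distance)`, not just `√h`. -/
lemma Observable.pair_moment_le (w : WalkBounds q e alive pt h dt L)
    (o : Observable q e alive pt h dt L n g) (m : ℕ) (i j : I) (c : I → Z) :
    (flowAvg q e ^ n) (fun c' => (alive ×ˢ alive).indicator
        (fun z => (g 0 z.1 - g 0 z.2 - (g n (c i) - g n (c j))) ^ (2 * m + 2)) (c' i, c' j)) c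
      ≤ Real.exp (pairRate D L m * (n * dt)) * (h * (‖pt (c i) - pt (c j)‖ + h)) ^ (m + 1) := by
  have hh := w.h_pos
  have hdt := w.dt_nonneg
  have hL0 : 0 ≤ L := zero_le_one.trans w.one_le
  have hA0 : 0 ≤ pairConst D L := by unfold pairConst; positivity
  have hm0 := momentRate_nonneg (2 * m) hA0
  have hC0 : 0 ≤ pairRate D L m := by unfold pairRate; positivity
  set a := g n (c i) - g n (c j) with ha
  let V : ℕ → Z × Z → ℝ := fun k z => (g k z.1 - g k z.2 - a) ^ (2 * m + 2)
    + (h * (‖pt z.1 - pt z.2‖ + h)) ^ (m + 1)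
  have hpow : ∀ k (z : Z × Z), 0 ≤ (g k z.1 - g k z.2 - a) ^ (2 * m + 2) :=
    fun k z => Even.pow_nonneg ⟨m + 1, by ring⟩ _
  have hV : ∀ k z, 0 ≤ V k z := fun k z => add_nonneg (hpow k z) (by positivity)
  have key : ∀ k < n, ∀ c : I → Z,
      flowAvg q e (fun c => (alive ×ˢ alive).indicator (V k) (c i, c j)) c
      ≤ (1 + pairRate D L m * dt) * (alive ×ˢ alive).indicator (V (k + 1)) (c i, c j) := by
    intro k hk c
    rw [flowAvg_apply]
    by_cases hz : (c i, c j) ∈ alive ×ˢ alive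
    swap
    · rw [indicator_of_notMem hz, mul_zero]
      refine (integral_eq_zero_of_ae (Filter.Eventually.of_forall fun u => ?_)).le
      refine indicator_of_notMem (fun hm => hz ?_) _
      rw [mem_prod] at hm ⊢
      constructor
      · by_contra hc
        exact hc (by simpa [flowMap_of_frozen (e := e) (w.frozen _ hc)] using hm.1)
      · by_contra hc
        exact hc (by simpa [flowMap_of_frozen (e := e) (w.frozen _ hc)] using hm.2)
    rw [indicator_of_mem hz]
    refine (integral_mono (g := fun u => V k (flowMap q e u (c i), flowMap q e u (c j)))
      (integrable_flow₂ q e (fun x x' => (alive ×ˢ alive).indicator (V k) (x, x')) (c i) (c j))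
      (integrable_flow₂ q e (fun x x' => V k (x, x')) (c i) (c j))
      fun u => indicator_le_self' (fun _ _ => hV k _) _).trans ?_
    simp only [V]
    rw [integral_add (integrable_flow₂ q e (fun x x' => (g k x - g k x' - a) ^ (2 * m + 2)) _ _)
      (integrable_flow₂ q e (fun x x' => (h * (‖pt x - pt x'‖ + h)) ^ (m + 1)) _ _)]
    have h1 := o.pair_moment_step w m a hk hz.1 hz.2
    have h2 := w.pair_dist_step m hz.1 hz.2
    have h3 := mul_le_mul_of_nonneg_left h2 (pow_nonneg hh.le (m + 1))
    rw [← integral_const_mul] at h3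
    simp_rw [← mul_pow] at h3
    refine (add_le_add h1 h3).trans ?_
    have h4 := hpow (k + 1) (c i, c j)
    simp only at h4
    set Y := (g (k + 1) (c i) - g (k + 1) (c j) - a) ^ (2 * m + 2)
    rw [mul_pow, pairRate]
    set S := (‖pt (c i) - pt (c j)‖ + h) ^ (m + 1)
    set B := (4 : ℝ) ^ (m + 1) * (Fintype.card D * (2 * Fintype.card D + 1) * L)
    have hB : 0 ≤ B * dt * Y := by positivity
    linarith
  have h0 : ∀ c' : I → Z, (alive ×ˢ alive).indicator
      (fun z => (g 0 z.1 - g 0 z.2 - a) ^ (2 * m + 2)) (c' i, c' j)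
      ≤ (alive ×ˢ alive).indicator (V 0) (c' i, c' j) := fun c' =>
    indicator_le_indicator (le_add_of_nonneg_right (by positivity))
  refine (flowAvg_pow_mono h0 n c).trans ?_
  refine (flowAvg_pow_le_of_supersolution
    (W := fun k c => (alive ×ˢ alive).indicator (V k) (c i, c j)) (by positivity) key c).trans ?_
  have hVn : V n (c i, c j) = (h * (‖pt (c i) - pt (c j)‖ + h)) ^ (m + 1) := by
    simp [V, ha]
  rw [← hVn]
  exact mul_le_mul (one_add_mul_pow_le_exp hC0 hdt n) (indicator_le_self' (fun _ _ => hV n _) _)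
    (indicator_nonneg (fun _ _ => hV n _) _) (Real.exp_pos _).le

/-- The growth rate in the bound for the exit probability. -/
noncomputable def exitRate (D κ : Type*) [Fintype D] [Fintype κ] (L : ℝ) : ℝ :=
  momentRate 0 (2 * (Fintype.card D + 1) * L) * (1 + Fintype.card κ)

/-- A walk that starts near the end point of a trajectory `ζ` of the mean drift stays near `ζ`,
so that it leaves the domain with small probability if `ζ` keeps a distance from its complement. -/
lemma WalkBounds.exit_le {κ : Type*} [Fintype κ] (w : WalkBounds q e alive pt h dt L)
    (x : Z →+ (κ → ℝ)) (ζ : ℕ → κ → ℝ) {δ : ℝ} (hδ : 0 < δ)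
    (hx : ∀ a, ‖x (e a)‖ ≤ h)
    (hmean : ∀ k < n, ∀ z ∈ alive, ∀ i,
      |walkStep q e (fun z => x z i) z - x z i + (ζ (k + 1) i - ζ k i)|
        ≤ L * dt * (‖x z - ζ (k + 1)‖ + h))
    (hζ : ∀ k < n, ‖ζ (k + 1) - ζ k‖ ≤ h) (hζ' : ∀ k < n, ‖ζ (k + 1) - ζ k‖ ≤ L * dt)
    (hout : ∀ k ≤ n, ∀ z ∉ alive, δ ≤ ‖x z - ζ k‖) (i : I) (c : I → Z) :
    (flowAvg q e ^ n) (fun c => aliveᶜ.indicator (fun _ => 1) (c i)) c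
      ≤ Real.exp (exitRate D κ L * (n * dt)) *
        ((∑ j, (x (c i) j - ζ n j) ^ 2 + h) / δ ^ 2) := by
  classical
  have hL := w.one_le
  have hL0 : 0 ≤ L := zero_le_one.trans hL
  have hh := w.h_pos
  have hdt := w.dt_nonneg
  set N : ℝ := (Fintype.card D : ℝ) with hN
  have hN0 : 0 ≤ N := Nat.cast_nonneg _
  set A : ℝ := 2 * (N + 1) * L with hA
  have hA0 : 0 ≤ A := by positivity
  have hA2 : 2 * L ≤ A := by rw [hA]; nlinarith
  have hC0 : 0 ≤ exitRate D κ L := mul_nonneg (momentRate_nonneg 0 hA0) (by positivity)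
  let B : ℕ → Z → ℝ := fun k z => ∑ j, (x z j - ζ k j) ^ 2 + h
  have hB0 : ∀ k z, 0 ≤ B k z := fun k z =>
    add_nonneg (Finset.sum_nonneg fun _ _ => sq_nonneg _) hh.le
  have hnorm : ∀ k z, ‖x z - ζ k‖ ≤ √(B k z) := by
    intro k z
    rw [pi_norm_le_iff_of_nonneg (Real.sqrt_nonneg _)]
    intro j
    refine Real.le_sqrt_of_sq_le ?_
    rw [Real.norm_eq_abs, sq_abs, Pi.sub_apply]
    have := Finset.single_le_sum (f := fun j => (x z j - ζ k j) ^ 2)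
      (fun _ _ => sq_nonneg _) (Finset.mem_univ j)
    simp only [B]
    linarith
  have hδB : ∀ k ≤ n, ∀ z ∉ alive, 1 ≤ B k z / δ ^ 2 := by
    intro k hk z hz
    rw [one_le_div (by positivity)]
    have h1 := pow_le_pow_left₀ hδ.le ((hout k hk z hz).trans (hnorm k z)) 2
    rwa [Real.sq_sqrt (hB0 k z)] at h1
  have step : ∀ k < n, ∀ z ∈ alive, ∫ u, B k (flowMap q e u z) ∂unif
      ≤ (1 + exitRate D κ L * dt) * B (k + 1) z := by
    intro k hk z hz
    set σ := √(B (k + 1) z) with hσ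
    have hσ0 : 0 ≤ σ := Real.sqrt_nonneg _
    have hσsq : σ ^ 2 = B (k + 1) z := Real.sq_sqrt (hB0 _ _)
    have hhB : h ≤ B (k + 1) z := le_add_of_nonneg_left (Finset.sum_nonneg fun _ _ => sq_nonneg _)
    have hhσ : h ≤ σ := by
      refine Real.le_sqrt_of_sq_le (le_trans ?_ hhB)
      nlinarith [w.h_le_one]
    have comp : ∀ j, ∫ u, (x (flowMap q e u z) j - ζ k j) ^ 2 ∂unif
        ≤ (x z j - ζ (k + 1) j) ^ 2 + momentRate 0 A * dt *
          ((x z j - ζ (k + 1) j) ^ 2 + σ ^ 2) := by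
      intro j
      set y := x z j - ζ (k + 1) j with hy
      set d := ζ (k + 1) j - ζ k j with hd
      have hd1 : |d| ≤ h := (norm_le_pi_norm (ζ (k + 1) - ζ k) j).trans (hζ k hk)
      have hd2 : |d| ≤ L * dt := (norm_le_pi_norm (ζ (k + 1) - ζ k) j).trans (hζ' k hk)
      let Ξ : Z → ℝ := fun v => x v j - x z j + d
      let ξ : ℝ → ℝ := fun u => Ξ (flowMap q e u z)
      have hξ : ∀ u, x (flowMap q e u z) j - ζ k j = y + ξ u := fun u => by
        simp only [ξ, Ξ, hy, hd]; ring
      have hpt : ∀ u, |ξ u| ≤ 2 * h ∧ ξ u ^ 2 ≤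
          (jumpSet q z).indicator (fun _ => 2 * h ^ 2) u + 2 * (L * dt * h) := by
        intro u
        have hdsq : d ^ 2 ≤ L * dt * h := by
          rw [← sq_abs, sq]
          exact mul_le_mul hd2 hd1 (abs_nonneg _) (by positivity)
        rcases w.rate.flowMap_cases (e := e) u z with ⟨hu, h1⟩ | ⟨b, hu, h1⟩
        · simp only [ξ, Ξ, h1, indicator_of_notMem hu, sub_self, zero_add]
          constructor
          · linarith
          · linarith [sq_nonneg d]
        · have e1 : x (z + e b) j - x z j = x (e b) j := by
            rw [map_add, Pi.add_apply]; ring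
          have hj : |x (e b) j| ≤ h := (norm_le_pi_norm (x (e b)) j).trans (hx b)
          simp only [ξ, Ξ, h1, indicator_of_mem hu, e1]
          constructor
          · refine (abs_add_le _ _).trans ?_
            linarith
          · have : x (e b) j ^ 2 ≤ h ^ 2 := by
              rw [← sq_abs]; exact pow_le_pow_left₀ (abs_nonneg _) hj 2
            nlinarith [sq_nonneg (x (e b) j - d)]
      have hmom := integral_add_pow_le (μ := unif) 0 (A := A) (σ := σ) (y := y) (dt := dt)
        (ξ := ξ) hA0 hσ0
        (integrable_flow₁ q e Ξ z)
        (integrable_flow₁ q e (fun v => Ξ v ^ 2) z)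
        (integrable_flow₁ q e (fun v => (y + Ξ v) ^ (0 + 2)) z) hdt
        (fun u => by
          refine (hpt u).1.trans ?_
          have : (2 : ℝ) ≤ A := by linarith
          exact mul_le_mul this hhσ hh.le hA0)
        (by
          have : ∫ u, ξ u ∂unif = walkStep q e (fun z => x z j) z - x z j + d := by
            simp only [ξ, Ξ]
            rw [integral_add
              (by exact (integrable_flow₁ q e (fun v => x v j) z).sub (integrable_const _))
              (integrable_const _), integral_sub (integrable_flow₁ q e (fun v => x v j) z)
              (integrable_const _),
              show ∫ u, x (flowMap q e u z) j ∂unif = walkStep q e (fun z => x z j) z from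
                w.rate.integral_flow (fun v => x v j) z]
            simp
          rw [this]
          refine (hmean k hk z hz j).trans ?_
          have h1 : ‖x z - ζ (k + 1)‖ + h ≤ 2 * σ := by linarith [hnorm (k + 1) z]
          have h2 : L * dt * (‖x z - ζ (k + 1)‖ + h) ≤ L * dt * (2 * σ) := by gcongr
          have h3 : 2 * L * (dt * σ) ≤ A * (dt * σ) := by gcongr
          linarith)
        (by
          have hi : Integrable ((jumpSet q z).indicator fun _ => 2 * h ^ 2) unif :=
            (integrable_const _).indicator (measurableSet_jumpSet q z)
          refine (integral_mono (integrable_flow₁ q e (fun v => Ξ v ^ 2) z)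
            (hi.add (integrable_const _)) fun u => (hpt u).2).trans ?_
          rw [integral_add' hi (integrable_const _),
            integral_indicator_const _ (measurableSet_jumpSet q z)]
          have hj := w.measureReal_jumpSet_mul_le hz
          have e2 : unif.real (jumpSet q z) • (2 * h ^ 2)
              = 2 * h * (unif.real (jumpSet q z) * h) := by
            rw [smul_eq_mul]; ring
          have h5 : 2 * h * (unif.real (jumpSet q z) * h) ≤ 2 * h * (N * (dt * L)) := by gcongr
          have h6 : A * dt * h ≤ A * dt * σ ^ 2 := by rw [hσsq]; gcongr
          rw [e2]
          simp only [integral_const, probReal_univ, smul_eq_mul, one_mul]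
          have e3 : A * dt * h = 2 * h * (N * (dt * L)) + 2 * (L * dt * h) := by rw [hA]; ring
          linarith)
      simp_rw [hξ]
      have h9 : |y| ^ (0 + 2) = y ^ 2 := by simp
      rw [h9] at hmom
      exact hmom
    simp only [B]
    rw [integral_add (integrable_flow₁ q e (fun v => ∑ j, (x v j - ζ k j) ^ 2) z)
      (integrable_const _),
      integral_finsetSum _ fun j _ => integrable_flow₁ q e (fun v => (x v j - ζ k j) ^ 2) z]
    refine (add_le_add (Finset.sum_le_sum fun j _ => comp j) le_rfl).trans ?_
    rw [Finset.sum_add_distrib, ← Finset.mul_sum, Finset.sum_add_distrib, Finset.sum_const, hσsq]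
    simp only [integral_const, probReal_univ, smul_eq_mul, one_mul, nsmul_eq_mul,
      Finset.card_univ, B, exitRate, ← hN, ← hA]
    have hS : 0 ≤ ∑ j, (x z j - ζ (k + 1) j) ^ 2 := Finset.sum_nonneg fun _ _ => sq_nonneg _
    have hr := momentRate_nonneg 0 hA0
    have hrdt : 0 ≤ momentRate 0 A * dt * h := by positivity
    nlinarith
  let V : ℕ → Z → ℝ := fun k z => if z ∈ alive then B k z / δ ^ 2 else 1
  have key : ∀ k < n, ∀ c : I → Z, flowAvg q e (fun c => V k (c i)) c
      ≤ (1 + exitRate D κ L * dt) * V (k + 1) (c i) := by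
    intro k hk c
    rw [flowAvg_apply]
    by_cases hz : c i ∈ alive
    swap
    · simp_rw [flowMap_of_frozen (e := e) (w.frozen _ hz)]
      simp only [V, hz, if_false, integral_const, probReal_univ, smul_eq_mul, mul_one]
      exact le_add_of_nonneg_right (by positivity)
    refine (integral_mono (g := fun u => B k (flowMap q e u (c i)) / δ ^ 2)
      (integrable_flow₁ q e (V k) (c i)) (integrable_flow₁ q e (fun v => B k v / δ ^ 2) (c i))
      fun u => ?_).trans ?_
    · simp only [V]
      split_ifs with hu
      · exact le_rfl
      · exact hδB k hk.le _ hu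
    · rw [integral_div]
      simp only [V, hz, if_true]
      rw [← mul_div_assoc]
      exact div_le_div_of_nonneg_right (step k hk _ hz) (by positivity)
  have h0 : ∀ c : I → Z, aliveᶜ.indicator (fun _ => (1 : ℝ)) (c i) ≤ V 0 (c i) := by
    intro c
    simp only [V, indicator, mem_compl_iff]
    by_cases h1 : c i ∈ alive
    · simpa [h1] using div_nonneg (hB0 0 (c i)) (by positivity : 0 ≤ δ ^ 2)
    · simp [h1]
  refine (flowAvg_pow_mono h0 n c).trans ?_
  refine (flowAvg_pow_le_of_supersolution (W := fun k c => V k (c i))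
    (by positivity) key c).trans ?_
  have hVn : V n (c i) ≤ B n (c i) / δ ^ 2 := by
    simp only [V]
    split_ifs with hu
    · exact le_rfl
    · exact hδB n le_rfl _ hu
  have hVn0 : 0 ≤ V n (c i) := by
    simp only [V]
    split_ifs
    · exact div_nonneg (hB0 _ _) (by positivity)
    · exact zero_le_one
  exact mul_le_mul (one_add_mul_pow_le_exp hC0 hdt n) hVn hVn0 (Real.exp_pos _).le

end Walk

/-! ### The upwind scheme as a random walk -/

section Upwind

variable {d M : ℕ}

/-- The sites `(j, l)` of the phase space lattice. -/
abbrev Site (d : ℕ) : Type := (Fin d → ℤ) × (Fin d → ℤ)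

/-- The jumps of the walk: a coordinate, whether it is a momentum, and a sign. -/
abbrev Dir (d : ℕ) : Type := Fin d × Bool × Bool

/-- The grid points in phase space. -/
def gridSites (d N : ℕ) : Set (Site d) := {z | z.1 ∈ gridIndices d N ∧ z.2 ∈ gridIndices d N}

/-- The displacement of a jump. -/
def dirVec : Dir d → Site d
  | (i, false, true) => (Pi.single i 1, 0)
  | (i, false, false) => (-Pi.single i 1, 0)
  | (i, true, true) => (0, Pi.single i 1)
  | (i, true, false) => (0, -Pi.single i 1)

/-- The speed of a jump: the walk follows the bicharacteristics backwards in time. -/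
noncomputable def dirSpeed (H : (Fin d → ℝ) × (Fin d → ℝ) → ℝ) : Dir d → (Fin d → ℝ) × (Fin d → ℝ) → ℝ
  | (i, false, true), z => max (-dHdp H i z) 0
  | (i, false, false), z => max (dHdp H i z) 0
  | (i, true, true), z => max (dHdx H i z) 0
  | (i, true, false), z => max (-dHdx H i z) 0

/-- The position of a site. -/
noncomputable def sitePoint (d N : ℕ) : Site d →+ (Fin d → ℝ) × (Fin d → ℝ) where
  toFun z := (gridPoint N z.1, gridPoint N z.2)
  map_zero' := by ext <;> simp [gridPoint]
  map_add' z z' := by ext <;> simp [gridPoint, add_div]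

open Classical in
/-- The transition probabilities of the walk, which is frozen outside of the grid. -/
noncomputable def gridRate (H : (Fin d → ℝ) × (Fin d → ℝ) → ℝ) (N : ℕ) (Δt : ℝ) (a : Dir d)
    (z : Site d) : ℝ :=
  if z ∈ gridSites d N then Δt / (1 / (N : ℝ)) * dirSpeed H a (sitePoint d N z) else 0

lemma sitePoint_apply (N : ℕ) (z : Site d) :
    sitePoint d N z = (gridPoint N z.1, gridPoint N z.2) := rfl

lemma dirSpeed_nonneg (H : (Fin d → ℝ) × (Fin d → ℝ) → ℝ) (a : Dir d)
    (z : (Fin d → ℝ) × (Fin d → ℝ)) : 0 ≤ dirSpeed H a z := by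
  rcases a with ⟨i, _ | _, _ | _⟩ <;> exact le_max_right _ _

lemma sum_dir {A : Type*} [AddCommMonoid A] (f : Dir d → A) :
    ∑ a, f a = ∑ i, (f (i, true, true) + f (i, true, false)
      + (f (i, false, true) + f (i, false, false))) := by
  rw [Fintype.sum_prod_type]
  refine Finset.sum_congr rfl fun i _ => ?_
  rw [Fintype.sum_prod_type]
  simp

lemma max_zero_add_max_neg (x : ℝ) : max x 0 + max (-x) 0 = |x| := by
  rcases le_total 0 x with h | h
  · rw [max_eq_left h, max_eq_right (by linarith), abs_of_nonneg h, add_zero]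
  · rw [max_eq_right h, max_eq_left (by linarith), abs_of_nonpos h, zero_add]

lemma max_zero_sub_max_neg (x : ℝ) : max x 0 - max (-x) 0 = x := by
  rcases le_total 0 x with h | h
  · rw [max_eq_left h, max_eq_right (by linarith), sub_zero]
  · rw [max_eq_right h, max_eq_left (by linarith), zero_sub, neg_neg]

lemma sum_dirSpeed (H : (Fin d → ℝ) × (Fin d → ℝ) → ℝ) (z : (Fin d → ℝ) × (Fin d → ℝ)) :
    ∑ a, dirSpeed H a z = ∑ i, (|dHdx H i z| + |dHdp H i z|) := by
  rw [sum_dir]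
  refine Finset.sum_congr rfl fun i _ => ?_
  simp only [dirSpeed]
  rw [max_zero_add_max_neg, add_comm (max (-dHdp H i z) 0), max_zero_add_max_neg]

lemma gridPoint_mem_Icc {N : ℕ} (hN : 1 ≤ N) {j : Fin d → ℤ} (hj : j ∈ gridIndices d N) :
    gridPoint N j ∈ Icc (0 : Fin d → ℝ) 1 := by
  have hN' : (0 : ℝ) < N := by exact_mod_cast hN
  rw [gridIndices, Fintype.mem_piFinset] at hj
  refine ⟨fun i => ?_, fun i => ?_⟩ <;> have := Finset.mem_Icc.1 (hj i)
  · exact div_nonneg (Int.cast_nonneg (zero_le_one.trans this.1)) hN'.le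
  · exact (div_le_one hN').2 (by exact_mod_cast this.2)

lemma one_div_le_gridPoint {N : ℕ} (hN : 1 ≤ N) {j : Fin d → ℤ} (hj : j ∈ gridIndices d N)
    (i : Fin d) : 1 / (N : ℝ) ≤ gridPoint N j i := by
  have hN' : (0 : ℝ) < N := by exact_mod_cast hN
  rw [gridIndices, Fintype.mem_piFinset] at hj
  exact div_le_div_of_nonneg_right (by exact_mod_cast (Finset.mem_Icc.1 (hj i)).1) hN'.le

lemma sitePoint_mem {N : ℕ} (hN : 1 ≤ N) {z : Site d} (hz : z ∈ gridSites d N) :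
    sitePoint d N z ∈ Icc (0 : Fin d → ℝ) 1 ×ˢ Icc (0 : Fin d → ℝ) 1 :=
  ⟨gridPoint_mem_Icc hN hz.1, gridPoint_mem_Icc hN hz.2⟩

lemma CFL.isRate {H : (Fin d → ℝ) × (Fin d → ℝ) → ℝ} {N : ℕ} {Δt : ℝ} (hN : 1 ≤ N)
    (hΔt : 0 < Δt) (hC : CFL H N Δt) : IsRate (gridRate H N Δt) where
  nonneg a z := by
    unfold gridRate
    split_ifs
    · exact mul_nonneg (by positivity) (dirSpeed_nonneg _ _ _)
    · exact le_rfl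
  sum_le_one z := by
    unfold gridRate
    split_ifs with hz
    · rw [← Finset.mul_sum, sum_dirSpeed]
      exact hC _ (sitePoint_mem hN hz)
    · simp

/-- The numerical solution is the expectation of the initial datum at the end of the walk. -/
lemma upwindSolution_eq_iterate (H : (Fin d → ℝ) × (Fin d → ℝ) → ℝ)
    (u₀ : Fin M → (Fin d → ℝ) → Fin d → ℝ) (β : ℝ → ℝ) (ω : ℝ) (N : ℕ) (Δt : ℝ) (n : ℕ)
    (z : Site d) :
    upwindSolution H u₀ β ω N Δt n z.1 z.2 = (walkStep (gridRate H N Δt) dirVec)^[n]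
      ((gridSites d N).indicator fun z => initialGrid u₀ β ω N z.1 z.2) z := by
  classical
  induction n generalizing z with
  | zero =>
    simp only [upwindSolution, Function.iterate_zero, id, indicator, gridSites, mem_ofPred_eq]
  | succ n ih =>
    rw [Function.iterate_succ_apply', walkStep]
    simp_rw [← ih]
    by_cases hz : z ∈ gridSites d N
    · have hz' : z.1 ∈ gridIndices d N ∧ z.2 ∈ gridIndices d N := hz
      simp only [upwindSolution, if_pos hz', upwindStep, sub_eq_add_neg (upwindSolution _ _ _ _ _ _ _ _ _)]
      congr 1
      rw [sum_dir, Finset.mul_sum, ← Finset.sum_neg_distrib]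
      refine Finset.sum_congr rfl fun i _ => ?_
      have hmin : ∀ x : ℝ, min x 0 = -max (-x) 0 := fun x => by
        rcases le_total 0 x with h | h
        · rw [min_eq_right h, max_eq_right (by linarith), neg_zero]
        · rw [min_eq_left h, max_eq_left (by linarith), neg_neg]
      simp only [gridRate, hz, if_true, dirSpeed, dirVec, sitePoint_apply, hmin, Prod.fst_add,
        Prod.snd_add, add_zero, ← sub_eq_add_neg]
      ring
    · have hz' : ¬(z.1 ∈ gridIndices d N ∧ z.2 ∈ gridIndices d N) := hz
      have h0 : ∀ n, upwindSolution H u₀ β ω N Δt n z.1 z.2 = 0 := by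
        intro n
        cases n <;> simp only [upwindSolution, if_neg hz']
      simp [h0, gridRate, hz]

/-- The drift `(∇_p H, -∇_x H)` of the bicharacteristics. -/
noncomputable def drift (H : (Fin d → ℝ) × (Fin d → ℝ) → ℝ) (z : (Fin d → ℝ) × (Fin d → ℝ)) :
    (Fin d → ℝ) × (Fin d → ℝ) :=
  (fun i => dHdp H i z, fun i => -dHdx H i z)

/-- The mean displacement of the walk in one step. -/
lemma sum_gridRate_smul (H : (Fin d → ℝ) × (Fin d → ℝ) → ℝ) {N : ℕ} (hN : 1 ≤ N) (Δt : ℝ)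
    {z : Site d} (hz : z ∈ gridSites d N) :
    ∑ a, gridRate H N Δt a z • sitePoint d N (dirVec a) = -(Δt • drift H (sitePoint d N z)) := by
  classical
  have hN' : (N : ℝ) ≠ 0 := by positivity
  have hs : ∀ i : Fin d, gridPoint N (Pi.single i (1 : ℤ)) = (1 / (N : ℝ)) • Pi.single i 1 := by
    intro i; ext k
    by_cases hk : k = i
    · subst hk; simp [gridPoint]
    · simp [gridPoint, hk]
  have hneg : ∀ v : Fin d → ℤ, gridPoint N (-v) = -gridPoint N v := by
    intro v; ext k; simp [gridPoint, neg_div]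
  have hzero : gridPoint N (0 : Fin d → ℤ) = 0 := by ext; simp [gridPoint]
  rw [sum_dir]
  simp only [gridRate, hz, if_true, dirSpeed, dirVec, sitePoint_apply, hs, hneg, hzero]
  set p := (gridPoint N z.1, gridPoint N z.2)
  have key : ∀ i : Fin d,
      (Δt / (1 / (N : ℝ)) * max (dHdx H i p) 0) •
            ((0 : Fin d → ℝ), (1 / (N : ℝ)) • (Pi.single i 1 : Fin d → ℝ))
          + (Δt / (1 / (N : ℝ)) * max (-dHdx H i p) 0) •
            ((0 : Fin d → ℝ), -((1 / (N : ℝ)) • (Pi.single i 1 : Fin d → ℝ)))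
        + ((Δt / (1 / (N : ℝ)) * max (-dHdp H i p) 0) •
            ((1 / (N : ℝ)) • (Pi.single i 1 : Fin d → ℝ), (0 : Fin d → ℝ))
          + (Δt / (1 / (N : ℝ)) * max (dHdp H i p) 0) •
            (-((1 / (N : ℝ)) • (Pi.single i 1 : Fin d → ℝ)), (0 : Fin d → ℝ)))
      = (-(Δt * dHdp H i p) • (Pi.single i 1 : Fin d → ℝ),
          (Δt * dHdx H i p) • (Pi.single i 1 : Fin d → ℝ)) := by
    intro i
    have h1 := max_zero_sub_max_neg (dHdx H i p)
    have h2 := max_zero_sub_max_neg (dHdp H i p)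
    ext k
    · simp only [Prod.fst_add, Prod.smul_fst, Pi.add_apply, Pi.smul_apply, smul_eq_mul,
        Pi.neg_apply, Pi.zero_apply]
      generalize max (dHdp H i p) 0 = A at h2 ⊢
      generalize max (-dHdp H i p) 0 = B at h2 ⊢
      rw [← h2]
      field_simp
      ring
    · simp only [Prod.snd_add, Prod.smul_snd, Pi.add_apply, Pi.smul_apply, smul_eq_mul,
        Pi.neg_apply, Pi.zero_apply]
      generalize max (dHdx H i p) 0 = A at h1 ⊢
      generalize max (-dHdx H i p) 0 = B at h1 ⊢
      rw [← h1]
      field_simp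
      ring
  rw [Finset.sum_congr rfl fun i _ => key i]
  ext k <;>
    simp [drift, Prod.fst_sum, Prod.snd_sum, Finset.sum_apply, Pi.single_apply]

lemma norm_gridPoint_single (N : ℕ) (i : Fin d) :
    ‖gridPoint N (Pi.single i (1 : ℤ))‖ ≤ 1 / (N : ℝ) := by
  rw [pi_norm_le_iff_of_nonneg (by positivity)]
  intro k
  by_cases hk : k = i
  · subst hk; simp [gridPoint]
  · simp [gridPoint, hk]

lemma norm_sitePoint_dirVec_le (N : ℕ) (a : Dir d) :
    ‖sitePoint d N (dirVec a)‖ ≤ 1 / (N : ℝ) := by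
  have hz : gridPoint N (0 : Fin d → ℤ) = 0 := by ext; simp [gridPoint]
  have hneg : ∀ v : Fin d → ℤ, gridPoint N (-v) = -gridPoint N v := by
    intro v; ext k; simp [gridPoint, neg_div]
  rcases a with ⟨i, _ | _, _ | _⟩ <;>
    simp only [dirVec, sitePoint_apply, hz, hneg, Prod.norm_def, norm_neg, norm_zero] <;>
    exact max_le (by first | exact norm_gridPoint_single N i | positivity)
      (by first | exact norm_gridPoint_single N i | positivity)

/-- Bounds on the drift in the computational domain. -/
structure DriftBounds (H : (Fin d → ℝ) × (Fin d → ℝ) → ℝ) (L : ℝ) : Prop where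
  one_le : 1 ≤ L
  norm_le : ∀ z ∈ Icc (0 : Fin d → ℝ) 1 ×ˢ Icc (0 : Fin d → ℝ) 1, ‖drift H z‖ ≤ L
  lip : ∀ z ∈ Icc (0 : Fin d → ℝ) 1 ×ˢ Icc (0 : Fin d → ℝ) 1,
    ∀ z' ∈ Icc (0 : Fin d → ℝ) 1 ×ˢ Icc (0 : Fin d → ℝ) 1, ‖drift H z - drift H z'‖ ≤ L * ‖z - z'‖

lemma contDiff_drift {H : (Fin d → ℝ) × (Fin d → ℝ) → ℝ} (hH : ContDiff ℝ 3 H) :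
    ContDiff ℝ 1 (drift H) := by
  have h1 : ContDiff ℝ 1 (fderiv ℝ H) := hH.fderiv_right (by norm_num)
  refine ContDiff.prodMk ?_ ?_
  · exact contDiff_pi.2 fun i => h1.clm_apply contDiff_const
  · exact contDiff_pi.2 fun i => (h1.clm_apply contDiff_const).neg

lemma exists_driftBounds {H : (Fin d → ℝ) × (Fin d → ℝ) → ℝ} (hH : ContDiff ℝ 3 H) :
    ∃ L, DriftBounds H L := by
  have hK : IsCompact (Icc (0 : Fin d → ℝ) 1 ×ˢ Icc (0 : Fin d → ℝ) 1) :=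
    isCompact_Icc.prod isCompact_Icc
  obtain ⟨C, hC⟩ := hK.exists_bound_of_continuousOn (contDiff_drift hH).continuous.continuousOn
  obtain ⟨K, hKl⟩ := LocallyLipschitzOn.exists_lipschitzOnWith_of_compact hK
    (contDiff_drift hH).locallyLipschitz.locallyLipschitzOn
  refine ⟨max 1 (max C K), le_max_left _ _, fun z hz => (hC z hz).trans ?_, fun z hz z' hz' => ?_⟩
  · exact (le_max_left _ _).trans (le_max_right _ _)
  · refine (hKl.norm_sub_le hz hz').trans ?_
    gcongr
    exact (le_max_right _ _).trans (le_max_right _ _)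

lemma abs_max_zero_sub_max_zero_le (x y : ℝ) : |max x 0 - max y 0| ≤ |x - y| :=
  abs_max_sub_max_le_abs x y 0

lemma abs_dHdp_le_norm_drift (H : (Fin d → ℝ) × (Fin d → ℝ) → ℝ) (i : Fin d)
    (z : (Fin d → ℝ) × (Fin d → ℝ)) : |dHdp H i z| ≤ ‖drift H z‖ :=
  (norm_le_pi_norm (drift H z).1 i).trans (norm_fst_le _)

lemma abs_dHdx_le_norm_drift (H : (Fin d → ℝ) × (Fin d → ℝ) → ℝ) (i : Fin d)
    (z : (Fin d → ℝ) × (Fin d → ℝ)) : |dHdx H i z| ≤ ‖drift H z‖ := by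
  have := (norm_le_pi_norm (drift H z).2 i).trans (norm_snd_le _)
  simpa [drift] using this

lemma dirSpeed_le (H : (Fin d → ℝ) × (Fin d → ℝ) → ℝ) (a : Dir d)
    (z : (Fin d → ℝ) × (Fin d → ℝ)) : dirSpeed H a z ≤ ‖drift H z‖ := by
  rcases a with ⟨i, _ | _, _ | _⟩ <;> refine max_le ?_ (norm_nonneg _)
  · exact (le_abs_self _).trans (abs_dHdp_le_norm_drift H i z)
  · exact (neg_le_abs _).trans (abs_dHdp_le_norm_drift H i z)
  · exact (neg_le_abs _).trans (abs_dHdx_le_norm_drift H i z)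
  · exact (le_abs_self _).trans (abs_dHdx_le_norm_drift H i z)

lemma abs_dirSpeed_sub_le (H : (Fin d → ℝ) × (Fin d → ℝ) → ℝ) (a : Dir d)
    (z z' : (Fin d → ℝ) × (Fin d → ℝ)) :
    |dirSpeed H a z - dirSpeed H a z'| ≤ ‖drift H z - drift H z'‖ := by
  have hp : ∀ i, |dHdp H i z - dHdp H i z'| ≤ ‖drift H z - drift H z'‖ := fun i =>
    (norm_le_pi_norm (drift H z - drift H z').1 i).trans (norm_fst_le _)
  have hx : ∀ i, |-dHdx H i z - -dHdx H i z'| ≤ ‖drift H z - drift H z'‖ := fun i =>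
    (norm_le_pi_norm (drift H z - drift H z').2 i).trans (norm_snd_le _)
  have hp' : ∀ i, |-dHdp H i z - -dHdp H i z'| ≤ ‖drift H z - drift H z'‖ := fun i => by
    rw [← abs_neg]; convert hp i using 2; ring
  have hx' : ∀ i, |dHdx H i z - dHdx H i z'| ≤ ‖drift H z - drift H z'‖ := fun i => by
    rw [← abs_neg]; convert hx i using 2; ring
  rcases a with ⟨i, _ | _, _ | _⟩
  · exact (abs_max_zero_sub_max_zero_le _ _).trans (hp i)
  · exact (abs_max_zero_sub_max_zero_le _ _).trans (hp' i)
  · exact (abs_max_zero_sub_max_zero_le _ _).trans (hx i)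
  · exact (abs_max_zero_sub_max_zero_le _ _).trans (hx' i)

/-- The CFL condition bounds the displacement along the drift in one time step by the mesh size. -/
lemma CFL.mul_norm_drift_le {H : (Fin d → ℝ) × (Fin d → ℝ) → ℝ} {N : ℕ} {Δt : ℝ} (hN : 1 ≤ N)
    (hΔt : 0 < Δt) (hC : CFL H N Δt) {z : (Fin d → ℝ) × (Fin d → ℝ)}
    (hz : z ∈ Icc (0 : Fin d → ℝ) 1 ×ˢ Icc (0 : Fin d → ℝ) 1) :
    Δt * ‖drift H z‖ ≤ 1 / (N : ℝ) := by
  have hN' : (0 : ℝ) < N := by exact_mod_cast hN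
  have h := hC z hz
  set S := ∑ i, (|dHdx H i z| + |dHdp H i z|) with hS
  have hle : ‖drift H z‖ ≤ S := by
    have h0 : 0 ≤ S := Finset.sum_nonneg fun _ _ => by positivity
    have h1 : ∀ i, |dHdx H i z| + |dHdp H i z| ≤ S := fun i =>
      Finset.single_le_sum (f := fun i => |dHdx H i z| + |dHdp H i z|)
        (fun _ _ => by positivity) (Finset.mem_univ i)
    refine max_le ?_ ?_ <;> refine (pi_norm_le_iff_of_nonneg h0).2 fun i => ?_
    · simp only [drift, Real.norm_eq_abs]
      linarith [h1 i, abs_nonneg (dHdx H i z)]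
    · simp only [drift, Real.norm_eq_abs, abs_neg]
      linarith [h1 i, abs_nonneg (dHdp H i z)]
  have h2 : Δt * S ≤ 1 / (N : ℝ) := by
    rw [le_div_iff₀ hN']
    calc Δt * S * N = Δt / (1 / (N : ℝ)) * S := by field_simp
      _ ≤ 1 := h
  exact (mul_le_mul_of_nonneg_left hle hΔt.le).trans h2

lemma walkBounds_gridRate {H : (Fin d → ℝ) × (Fin d → ℝ) → ℝ} {L : ℝ} (hL : DriftBounds H L)
    {N : ℕ} {Δt : ℝ} (hN : 1 ≤ N) (hΔt : 0 < Δt) (hC : CFL H N Δt) :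
    WalkBounds (gridRate H N Δt) dirVec (gridSites d N) (sitePoint d N) (1 / (N : ℝ)) Δt L where
  rate := hC.isRate hN hΔt
  h_pos := by positivity
  h_le_one := by
    rw [div_le_one (by positivity)]
    exact_mod_cast hN
  dt_nonneg := hΔt.le
  one_le := hL.one_le
  frozen z hz a := by simp [gridRate, hz]
  rate_le a z hz := by
    have hN' : (0 : ℝ) < N := by exact_mod_cast hN
    simp only [gridRate, hz, if_true]
    have h1 := (dirSpeed_le H a (sitePoint d N z)).trans (hL.norm_le _ (sitePoint_mem hN hz))
    calc Δt / (1 / (N : ℝ)) * dirSpeed H a (sitePoint d N z) * (1 / (N : ℝ))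
        = Δt * dirSpeed H a (sitePoint d N z) := by field_simp
      _ ≤ Δt * L := by gcongr
  rate_lip a z hz z' hz' := by
    have hN' : (0 : ℝ) < N := by exact_mod_cast hN
    simp only [gridRate, hz, hz', if_true]
    have h1 := (abs_dirSpeed_sub_le H a (sitePoint d N z) (sitePoint d N z')).trans
      (hL.lip _ (sitePoint_mem hN hz) _ (sitePoint_mem hN hz'))
    rw [← mul_sub, abs_mul, abs_of_nonneg (by positivity : 0 ≤ Δt / (1 / (N : ℝ)))]
    calc Δt / (1 / (N : ℝ)) * |dirSpeed H a (sitePoint d N z) - dirSpeed H a (sitePoint d N z')|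
          * (1 / (N : ℝ))
        = Δt * |dirSpeed H a (sitePoint d N z) - dirSpeed H a (sitePoint d N z')| := by field_simp
      _ ≤ Δt * (L * ‖sitePoint d N z - sitePoint d N z'‖) := by gcongr
      _ = _ := by ring
  jump_le := norm_sitePoint_dirVec_le N
  diam_le z hz z' hz' := by
    have h1 := sitePoint_mem hN hz
    have h2 := sitePoint_mem hN hz'
    refine max_le ?_ ?_ <;> refine (pi_norm_le_iff_of_nonneg zero_le_one).2 fun i => ?_ <;>
      rw [Real.norm_eq_abs, abs_le]
    · have a1 := h1.1.1 i; have a2 := h1.1.2 i; have a3 := h2.1.1 i; have a4 := h2.1.2 i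
      simp only [Prod.fst_sub, Pi.sub_apply, Pi.zero_apply, Pi.one_apply] at *
      constructor <;> linarith
    · have a1 := h1.2.1 i; have a2 := h1.2.2 i; have a3 := h2.2.1 i; have a4 := h2.2.2 i
      simp only [Prod.snd_sub, Pi.sub_apply, Pi.zero_apply, Pi.one_apply] at *
      constructor <;> linarith

end Upwind

/-! ### Smoothness of the level set functions -/

section Smooth

variable {X Y : Type*} [NormedAddCommGroup X] [NormedSpace ℝ X] [NormedAddCommGroup Y]
  [NormedSpace ℝ Y]

/-- Bounds for a function whose derivative is Lipschitz on a convex set. -/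
structure SmoothBounds (F : X → Y) (F' : X → X →L[ℝ] Y) (S : Set X) (L : ℝ) : Prop where
  convex : Convex ℝ S
  nonneg : 0 ≤ L
  hasFDeriv : ∀ q ∈ S, HasFDerivWithinAt F (F' q) S q
  bound : ∀ q ∈ S, ‖F' q‖ ≤ L
  lip : ∀ q ∈ S, ∀ q' ∈ S, ‖F' q - F' q'‖ ≤ L * ‖q - q'‖

variable {F : X → Y} {F' : X → X →L[ℝ] Y} {S : Set X} {L : ℝ}

lemma SmoothBounds.mono (b : SmoothBounds F F' S L) {L' : ℝ} (h : L ≤ L') :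
    SmoothBounds F F' S L' where
  convex := b.convex
  nonneg := b.nonneg.trans h
  hasFDeriv := b.hasFDeriv
  bound q hq := (b.bound q hq).trans h
  lip q hq q' hq' := (b.lip q hq q' hq').trans (by gcongr)

lemma SmoothBounds.norm_sub_le (b : SmoothBounds F F' S L) {q q' : X} (hq : q ∈ S)
    (hq' : q' ∈ S) : ‖F q' - F q‖ ≤ L * ‖q' - q‖ :=
  b.convex.norm_image_sub_le_of_norm_hasFDerivWithin_le b.hasFDeriv b.bound hq hq'

lemma SmoothBounds.taylor (b : SmoothBounds F F' S L) {q q' : X} (hq : q ∈ S) (hq' : q' ∈ S) :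
    ‖F q' - F q - F' q (q' - q)‖ ≤ L * ‖q' - q‖ ^ 2 := by
  have hseg : segment ℝ q q' ⊆ S := b.convex.segment_subset hq hq'
  have h := (convex_segment q q').norm_image_sub_le_of_norm_hasFDerivWithin_le' (f := F) (f' := F')
    (φ := F' q) (C := L * ‖q' - q‖) (fun x hx => (b.hasFDeriv x (hseg hx)).mono hseg)
    (fun x hx => (b.lip x (hseg hx) q hq).trans (by
      have : ‖x - q‖ ≤ ‖q' - q‖ := by
        obtain ⟨θ, hθ, rfl⟩ := (segment_eq_image' ℝ q q') ▸ hx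
        rw [add_sub_cancel_left, norm_smul, Real.norm_eq_abs, abs_of_nonneg hθ.1]
        exact mul_le_of_le_one_left (norm_nonneg _) hθ.2
      exact mul_le_mul_of_nonneg_left this b.nonneg))
    (left_mem_segment ℝ q q') (right_mem_segment ℝ q q')
  rwa [mul_assoc, ← sq] at h

/-- The increment of a smooth function is a Lipschitz function of the base point. -/
lemma SmoothBounds.second_difference (b : SmoothBounds F F' S L) {q q' v : X} (hq : q ∈ S)
    (hq' : q' ∈ S) (hqv : q + v ∈ S) (hqv' : q' + v ∈ S) :
    ‖F (q' + v) - F q' - (F (q + v) - F q)‖ ≤ L * ‖v‖ * ‖q' - q‖ := by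
  have hconv : Convex ℝ (S ∩ (fun x => x + v) ⁻¹' S) :=
    b.convex.inter (b.convex.translate_preimage_left v)
  refine hconv.norm_image_sub_le_of_norm_hasFDerivWithin_le (f := fun x => F (x + v) - F x)
    (f' := fun x => F' (x + v) - F' x) (fun x hx => ?_) (fun x hx => ?_) ⟨hq, hqv⟩ ⟨hq', hqv'⟩
  · have h1 : HasFDerivWithinAt (fun x => x + v) (ContinuousLinearMap.id ℝ X)
        (S ∩ (fun x => x + v) ⁻¹' S) x := (hasFDerivWithinAt_id x _).add_const v
    have h2 := (b.hasFDeriv (x + v) hx.2).comp x h1 (fun y hy => hy.2)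
    rw [ContinuousLinearMap.comp_id] at h2
    exact h2.sub ((b.hasFDeriv x hx.1).mono inter_subset_left)
  · refine (b.lip _ hx.2 _ hx.1).trans_eq ?_
    rw [add_sub_cancel_left]

lemma exists_smoothBounds {U : Set X} (hU : UniqueDiffOn ℝ U) (hUc : Convex ℝ U)
    (hF : ContDiffOn ℝ 2 F U) (hS : IsCompact S) (hSc : Convex ℝ S) (hSU : S ⊆ U) :
    ∃ L, SmoothBounds F (fderivWithin ℝ F U) S L := by
  have h1 : ContDiffOn ℝ 1 (fderivWithin ℝ F U) U := hF.fderivWithin hU (by norm_num)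
  obtain ⟨C, hC⟩ := hS.exists_bound_of_continuousOn (h1.continuousOn.mono hSU)
  obtain ⟨K, hK⟩ := LocallyLipschitzOn.exists_lipschitzOnWith_of_compact hS
    ((h1.locallyLipschitzOn hUc).mono hSU)
  refine ⟨max (max C K) 0, hSc, le_max_right _ _, fun q hq => ?_,
    fun q hq => (hC q hq).trans ((le_max_left _ _).trans (le_max_left _ _)), fun q hq q' hq' => ?_⟩
  · exact ((hF.differentiableOn (by norm_num)) q (hSU hq)).hasFDerivWithinAt.mono hSU
  · refine (hK.norm_sub_le hq hq').trans ?_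
    gcongr
    exact (le_max_right _ _).trans (le_max_left _ _)

end Smooth

section Level

variable {d : ℕ}

/-- The half space `t ≥ 0` of `(t, x, p)`. -/
def halfSpace (d : ℕ) : Set (ℝ × (Fin d → ℝ) × (Fin d → ℝ)) := Ici 0 ×ˢ univ

/-- A compact convex set of `(t, x, p)` that contains a neighbourhood of the computational domain. -/
def slab (d : ℕ) (T : ℝ) : Set (ℝ × (Fin d → ℝ) × (Fin d → ℝ)) :=
  Icc 0 T ×ˢ (Icc (-1) 2 ×ˢ Icc (-1) 2)

/-- The function `(t, x, p) ↦ φ(t, x, p)`. -/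
def levelMap (φ : ℝ → (Fin d → ℝ) → (Fin d → ℝ) → Fin d → ℝ) :
    ℝ × (Fin d → ℝ) × (Fin d → ℝ) → Fin d → ℝ :=
  fun q => φ q.1 q.2.1 q.2.2

/-- The derivative of `φ` in all variables, for `t ≥ 0`. -/
noncomputable def levelDeriv (φ : ℝ → (Fin d → ℝ) → (Fin d → ℝ) → Fin d → ℝ) :
    ℝ × (Fin d → ℝ) × (Fin d → ℝ) → ℝ × (Fin d → ℝ) × (Fin d → ℝ) →L[ℝ] Fin d → ℝ :=
  fderivWithin ℝ (levelMap φ) (halfSpace d)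

lemma uniqueDiffOn_halfSpace : UniqueDiffOn ℝ (halfSpace d) :=
  (uniqueDiffOn_Ici 0).prod uniqueDiffOn_univ

lemma convex_halfSpace : Convex ℝ (halfSpace d) := (convex_Ici 0).prod convex_univ

lemma isCompact_slab (T : ℝ) : IsCompact (slab d T) :=
  isCompact_Icc.prod (isCompact_Icc.prod isCompact_Icc)

lemma convex_slab (T : ℝ) : Convex ℝ (slab d T) :=
  (convex_Icc 0 T).prod ((convex_Icc (-1) 2).prod (convex_Icc (-1) 2))

lemma slab_subset_halfSpace (T : ℝ) : slab d T ⊆ halfSpace d := fun _ hq => ⟨hq.1.1, mem_univ _⟩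

variable {H : (Fin d → ℝ) × (Fin d → ℝ) → ℝ} {u₀ : (Fin d → ℝ) → Fin d → ℝ}
  {φ : ℝ → (Fin d → ℝ) → (Fin d → ℝ) → Fin d → ℝ}

lemma IsLevelSetFunction.hasFDerivWithinAt (hφ : IsLevelSetFunction H u₀ φ)
    {q : ℝ × (Fin d → ℝ) × (Fin d → ℝ)} (hq : 0 ≤ q.1) :
    HasFDerivWithinAt (levelMap φ) (levelDeriv φ q) (halfSpace d) q :=
  (hφ.smooth.differentiableOn (by norm_num) q ⟨hq, mem_univ _⟩).hasFDerivWithinAt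

lemma IsLevelSetFunction.continuousOn_levelDeriv (hφ : IsLevelSetFunction H u₀ φ) :
    ContinuousOn (levelDeriv φ) (halfSpace d) :=
  ContDiffOn.continuousOn_fderivWithin (n := 2) hφ.smooth uniqueDiffOn_halfSpace (by norm_num)

lemma IsLevelSetFunction.continuousOn_levelMap (hφ : IsLevelSetFunction H u₀ φ) :
    ContinuousOn (levelMap φ) (halfSpace d) := hφ.smooth.continuousOn

/-- The derivative of `φ` in `p`, as a restriction of the full derivative. -/
lemma IsLevelSetFunction.hasFDerivAt_right (hφ : IsLevelSetFunction H u₀ φ) {t : ℝ} (ht : 0 ≤ t)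
    (x p : Fin d → ℝ) :
    HasFDerivAt (fun p => φ t x p) ((levelDeriv φ (t, x, p)).comp
      ((ContinuousLinearMap.inr ℝ ℝ ((Fin d → ℝ) × (Fin d → ℝ))).comp
        (ContinuousLinearMap.inr ℝ (Fin d → ℝ) (Fin d → ℝ)))) p := by
  rw [← hasFDerivWithinAt_univ]
  have h1 : HasFDerivWithinAt (fun p : Fin d → ℝ => (t, x, p))
      ((ContinuousLinearMap.inr ℝ ℝ ((Fin d → ℝ) × (Fin d → ℝ))).comp
        (ContinuousLinearMap.inr ℝ (Fin d → ℝ) (Fin d → ℝ))) univ p := by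
    exact (HasFDerivAt.comp (g := fun z : (Fin d → ℝ) × (Fin d → ℝ) => (t, z))
      (f := fun p : Fin d → ℝ => (x, p)) p (hasFDerivAt_prodMk_right (𝕜 := ℝ) t (x, p))
      (hasFDerivAt_prodMk_right (𝕜 := ℝ) x p)).hasFDerivWithinAt
  exact (hφ.hasFDerivWithinAt (q := (t, x, p)) ht).comp p h1
    (fun _ _ => mem_prod.2 ⟨ht, mem_univ _⟩)

lemma IsLevelSetFunction.fderiv_right (hφ : IsLevelSetFunction H u₀ φ) {t : ℝ} (ht : 0 ≤ t)
    (x p v : Fin d → ℝ) :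
    fderiv ℝ (fun p => φ t x p) p v = levelDeriv φ (t, x, p) (0, 0, v) := by
  rw [(hφ.hasFDerivAt_right ht x p).fderiv]; rfl

/-- The level set function is constant along the bicharacteristic direction, up to `t = 0`. -/
lemma IsLevelSetFunction.transport (hφ : IsLevelSetFunction H u₀ φ) {t : ℝ} (ht : 0 ≤ t)
    (z : (Fin d → ℝ) × (Fin d → ℝ)) : levelDeriv φ (t, z) (1, drift H z) = 0 := by
  have hpos : ∀ t : ℝ, 0 < t → levelDeriv φ (t, z) (1, drift H z) = 0 := by
    intro t ht
    obtain ⟨x, p⟩ := z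
    have hd : HasFDerivAt (levelMap φ) (levelDeriv φ (t, x, p)) (t, x, p) :=
      (hφ.hasFDerivWithinAt (q := (t, x, p)) ht.le).hasFDerivAt
        (prod_mem_nhds (Ici_mem_nhds ht) Filter.univ_mem)
    have h1 : deriv (fun s => φ s x p) t = levelDeriv φ (t, x, p) (1, 0, 0) := by
      have := (hd.comp t (hasFDerivAt_prodMk_left t (x, p))).hasDerivAt.deriv
      exact this
    have h2 : ∀ v, fderiv ℝ (fun y => φ t y p) x v = levelDeriv φ (t, x, p) (0, v, 0) := by
      intro v
      have := (HasFDerivAt.comp x hd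
        (HasFDerivAt.comp (g := fun z : (Fin d → ℝ) × (Fin d → ℝ) => (t, z))
          (f := fun y : Fin d → ℝ => (y, p)) x (hasFDerivAt_prodMk_right (𝕜 := ℝ) t (x, p))
          (hasFDerivAt_prodMk_left (𝕜 := ℝ) x p))).fderiv
      exact congrArg (fun A : (Fin d → ℝ) →L[ℝ] Fin d → ℝ => A v) this
    have h := hφ.liouville t ht x p
    rw [h1] at h
    simp_rw [h2, hφ.fderiv_right ht.le] at h
    have e : ((1 : ℝ), drift H (x, p)) = ((1 : ℝ), (0 : Fin d → ℝ), (0 : Fin d → ℝ))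
        + ∑ i, dHdp H i (x, p) • ((0 : ℝ), (Pi.single i 1 : Fin d → ℝ), (0 : Fin d → ℝ))
        - ∑ i, dHdx H i (x, p) • ((0 : ℝ), (0 : Fin d → ℝ), (Pi.single i 1 : Fin d → ℝ)) := by
      ext k
      · simp [Prod.fst_sum]
      · simp [drift, Prod.fst_sum, Prod.snd_sum, Finset.sum_apply, Pi.single_apply]
      · simp [drift, Prod.snd_sum, Finset.sum_apply, Pi.single_apply]
    rw [e, map_sub, map_add, map_sum, map_sum]
    simpa only [map_smul] using h
  have hc : ContinuousOn (fun t => levelDeriv φ (t, z) (1, drift H z)) (Ici 0) :=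
    (hφ.continuousOn_levelDeriv.comp (by fun_prop) fun s hs => ⟨hs, mem_univ _⟩).clm_apply
      continuousOn_const
  have heq : EqOn (fun t => levelDeriv φ (t, z) (1, drift H z)) (fun _ => 0) (Ici 0) :=
    EqOn.of_subset_closure (s := Ioi 0) (fun s hs => hpos s hs) hc continuousOn_const
      Ioi_subset_Ici_self (by rw [closure_Ioi])
  exact heq ht

lemma IsLevelSetFunction.exists_smoothBounds (hφ : IsLevelSetFunction H u₀ φ) (T : ℝ) :
    ∃ L, SmoothBounds (levelMap φ) (levelDeriv φ) (slab d T) L :=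
  _root_.exists_smoothBounds uniqueDiffOn_halfSpace convex_halfSpace hφ.smooth (isCompact_slab T)
    (convex_slab T) (slab_subset_halfSpace T)

lemma DriftBounds.mono {L L' : ℝ} (b : DriftBounds H L) (h : L ≤ L') : DriftBounds H L' where
  one_le := b.one_le.trans h
  norm_le z hz := (b.norm_le z hz).trans h
  lip z hz z' hz' := (b.lip z hz z' hz').trans (by gcongr)

/-- The constant in the bounds for the observables. -/
noncomputable def obsConst (d : ℕ) (L : ℝ) : ℝ := L ^ 2 * (Fintype.card (Dir d) + 1)

lemma le_obsConst {L : ℝ} (hL : 1 ≤ L) : L ≤ obsConst d L := by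
  unfold obsConst
  have h1 : L ≤ L ^ 2 := le_self_pow₀ hL (by norm_num)
  have h2 : L ^ 2 * 1 ≤ L ^ 2 * (Fintype.card (Dir d) + 1) := by gcongr; simp
  linarith

lemma sitePoint_mem_two {N : ℕ} (hN : 1 ≤ N) {z : Site d} (hz : z ∈ gridSites d N) :
    sitePoint d N z ∈ Icc (-1 : Fin d → ℝ) 2 ×ˢ Icc (-1 : Fin d → ℝ) 2 := by
  have h := sitePoint_mem hN hz
  have h12 : (1 : Fin d → ℝ) ≤ 2 := fun i => by norm_num
  have h01 : (-1 : Fin d → ℝ) ≤ 0 := fun i => by norm_num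
  exact ⟨⟨h01.trans h.1.1, h.1.2.trans h12⟩, ⟨h01.trans h.2.1, h.2.2.trans h12⟩⟩

lemma sitePoint_add_mem_two {N : ℕ} (hN : 1 ≤ N) {z : Site d} (hz : z ∈ gridSites d N)
    (a : Dir d) :
    sitePoint d N (z + dirVec a) ∈ Icc (-1 : Fin d → ℝ) 2 ×ˢ Icc (-1 : Fin d → ℝ) 2 := by
  have hN' : (0 : ℝ) < N := by exact_mod_cast hN
  have h1N : 1 / (N : ℝ) ≤ 1 := by
    rw [div_le_one hN']
    exact_mod_cast hN
  have h := sitePoint_mem hN hz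
  have ha := norm_sitePoint_dirVec_le N a
  rw [map_add]
  have key : ∀ (v w : Fin d → ℝ), (∀ i, 1 / (N : ℝ) ≤ v i) → v ∈ Icc (0 : Fin d → ℝ) 1 →
      ‖w‖ ≤ 1 / (N : ℝ) → v + w ∈ Icc (-1 : Fin d → ℝ) 2 := by
    intro v w hv hv1 hw
    have h1 : ∀ i, -(1 / (N : ℝ)) ≤ w i ∧ w i ≤ 1 / (N : ℝ) := fun i =>
      abs_le.1 ((norm_le_pi_norm w i).trans hw)
    refine ⟨fun i => ?_, fun i => ?_⟩
    · simp only [Pi.add_apply, Pi.neg_apply, Pi.one_apply]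
      linarith [(h1 i).1, hv i]
    · have h3 := hv1.2 i
      simp only [Pi.add_apply, Pi.ofNat_apply] at h3 ⊢
      linarith [(h1 i).2]
  exact ⟨key _ _ (one_div_le_gridPoint hN hz.1) h.1 ((norm_fst_le _).trans ha),
    key _ _ (one_div_le_gridPoint hN hz.2) h.2 ((norm_snd_le _).trans ha)⟩

section Time

variable {T L Δt : ℝ} {N : ℕ}

lemma hasDerivWithinAt_level (b : SmoothBounds (levelMap φ) (levelDeriv φ) (slab d T) L)
    {z : (Fin d → ℝ) × (Fin d → ℝ)} (hz : z ∈ Icc (-1 : Fin d → ℝ) 2 ×ˢ Icc (-1 : Fin d → ℝ) 2)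
    {τ τ' s : ℝ} (hτ : 0 ≤ τ) (hτ' : τ' ≤ T) (hs : s ∈ Icc τ τ') :
    HasDerivWithinAt (fun s => levelMap φ (s, z)) (levelDeriv φ (s, z) (1, 0)) (Icc τ τ') s := by
  have hmem : ∀ s ∈ Icc τ τ', (s, z) ∈ slab d T := fun s hs =>
    ⟨⟨hτ.trans hs.1, hs.2.trans hτ'⟩, hz⟩
  have h1 : HasDerivWithinAt (fun s : ℝ => (s, z)) ((1 : ℝ), (0 : (Fin d → ℝ) × (Fin d → ℝ)))
      (Icc τ τ') s := (hasDerivWithinAt_id s _).prodMk (hasDerivWithinAt_const s _ z)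
  exact (b.hasFDeriv (s, z) (hmem s hs)).comp_hasDerivWithinAt s h1 fun y hy => hmem y hy

/-- Over one time step the level set function changes by `O(h)`. -/
lemma norm_level_time_le (hφ : IsLevelSetFunction H u₀ φ)
    (b : SmoothBounds (levelMap φ) (levelDeriv φ) (slab d T) L)
    {z : (Fin d → ℝ) × (Fin d → ℝ)} (hz : z ∈ Icc (-1 : Fin d → ℝ) 2 ×ˢ Icc (-1 : Fin d → ℝ) 2)
    {τ h : ℝ} (hτ : 0 ≤ τ) (hΔt : 0 ≤ Δt) (hτ' : τ + Δt ≤ T) (hv : Δt * ‖drift H z‖ ≤ h) :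
    ‖levelMap φ (τ + Δt, z) - levelMap φ (τ, z)‖ ≤ L * h := by
  have h1 := norm_image_sub_le_of_norm_deriv_le_segment'
    (fun s hs => hasDerivWithinAt_level b hz hτ hτ' hs) (C := L * ‖drift H z‖) (fun s hs => by
      have ht := hφ.transport (hτ.trans hs.1) z
      have e : ((1 : ℝ), drift H z) = (1, 0) + (0, drift H z) := by simp
      rw [e, map_add] at ht
      rw [eq_neg_of_add_eq_zero_left ht, norm_neg]
      refine (ContinuousLinearMap.le_opNorm _ _).trans ?_
      have hn : ‖((0 : ℝ), drift H z)‖ = ‖drift H z‖ := by simp [Prod.norm_def]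
      rw [hn]
      gcongr
      exact b.bound _ ⟨⟨hτ.trans hs.1, hs.2.le.trans hτ'⟩, hz⟩) (τ + Δt)
    ⟨by linarith, le_rfl⟩
  refine h1.trans ?_
  have e : L * ‖drift H z‖ * (τ + Δt - τ) = L * (Δt * ‖drift H z‖) := by ring
  rw [e]
  exact mul_le_mul_of_nonneg_left hv b.nonneg

/-- The truncation error of the forward Euler step in time. -/
lemma norm_level_time_taylor_le (hφ : IsLevelSetFunction H u₀ φ)
    (b : SmoothBounds (levelMap φ) (levelDeriv φ) (slab d T) L)
    {z : (Fin d → ℝ) × (Fin d → ℝ)} (hz : z ∈ Icc (-1 : Fin d → ℝ) 2 ×ˢ Icc (-1 : Fin d → ℝ) 2)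
    {τ h : ℝ} (hτ : 0 ≤ τ) (hΔt : 0 ≤ Δt) (hτ' : τ + Δt ≤ T) (hv : Δt * ‖drift H z‖ ≤ h) :
    ‖levelMap φ (τ + Δt, z) - levelMap φ (τ, z) + Δt • levelDeriv φ (τ, z) (0, drift H z)‖
      ≤ L * h * Δt := by
  set A := levelDeriv φ (τ, z) (0, drift H z) with hA
  have hd : ∀ s ∈ Icc τ (τ + Δt), HasDerivWithinAt (fun s => levelMap φ (s, z) + (s - τ) • A)
      (levelDeriv φ (s, z) (1, 0) + A) (Icc τ (τ + Δt)) s := by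
    intro s hs
    have h2 : HasDerivWithinAt (fun s : ℝ => (s - τ) • A) ((1 : ℝ) • A) (Icc τ (τ + Δt)) s :=
      ((hasDerivWithinAt_id s _).sub_const τ).smul_const A
    rw [one_smul] at h2
    exact (hasDerivWithinAt_level b hz hτ hτ' hs).add h2
  have h1 := norm_image_sub_le_of_norm_deriv_le_segment' hd (C := L * h) (fun s hs => by
      have hsT : s ≤ T := hs.2.le.trans hτ'
      have ht := hφ.transport (hτ.trans hs.1) z
      have e : ((1 : ℝ), drift H z) = (1, 0) + (0, drift H z) := by simp
      rw [e, map_add] at ht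
      rw [eq_neg_of_add_eq_zero_left ht, hA, neg_add_eq_sub, ← _root_.sub_apply]
      refine (ContinuousLinearMap.le_opNorm _ _).trans ?_
      have hn : ‖((0 : ℝ), drift H z)‖ = ‖drift H z‖ := by simp [Prod.norm_def]
      have hl := b.lip (τ, z) ⟨⟨hτ, by linarith⟩, hz⟩ (s, z) ⟨⟨hτ.trans hs.1, hsT⟩, hz⟩
      have hn2 : ‖((τ, z) : ℝ × (Fin d → ℝ) × (Fin d → ℝ)) - (s, z)‖ ≤ Δt := by
        rw [Prod.mk_sub_mk, sub_self, Prod.norm_def]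
        refine max_le ?_ (by simpa using hΔt)
        rw [Real.norm_eq_abs, abs_sub_comm, abs_of_nonneg (by linarith [hs.1])]
        linarith [hs.2]
      rw [hn]
      calc _ ≤ L * Δt * ‖drift H z‖ := by
            refine mul_le_mul_of_nonneg_right (hl.trans ?_) (norm_nonneg _)
            exact mul_le_mul_of_nonneg_left hn2 b.nonneg
        _ = L * (Δt * ‖drift H z‖) := by ring
        _ ≤ L * h := mul_le_mul_of_nonneg_left hv b.nonneg) (τ + Δt) ⟨by linarith, le_rfl⟩
  have e2 : levelMap φ (τ + Δt, z) + (τ + Δt - τ) • A - (levelMap φ (τ, z) + (τ - τ) • A)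
      = levelMap φ (τ + Δt, z) - levelMap φ (τ, z) + Δt • A := by
    rw [sub_self, zero_smul, add_sub_cancel_left]; abel
  rw [e2] at h1
  refine h1.trans_eq ?_
  ring

/-- The components of the level set function satisfy the bounds that the moment estimates use. -/
lemma IsLevelSetFunction.observable (hφ : IsLevelSetFunction H u₀ φ) (hL : DriftBounds H L)
    (b : SmoothBounds (levelMap φ) (levelDeriv φ) (slab d T) L) (hN : 1 ≤ N) (hΔt : 0 < Δt)
    (hC : CFL H N Δt) {n : ℕ} (hn : n * Δt ≤ T) (i : Fin d) :
    Observable (gridRate H N Δt) dirVec (gridSites d N) (sitePoint d N) (1 / (N : ℝ)) Δt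
      (obsConst d L) n (fun k z => levelMap φ (k * Δt, sitePoint d N z) i) := by
  have hN' : (0 : ℝ) < N := by exact_mod_cast hN
  have w := walkBounds_gridRate hL hN hΔt hC
  have hL1 := hL.one_le
  have hL0 : 0 ≤ L := b.nonneg
  have hLC : L ≤ obsConst d L := le_obsConst hL1
  have hC0 : 0 ≤ obsConst d L := hL0.trans hLC
  set h := 1 / (N : ℝ) with hh
  have hh0 : 0 < h := by positivity
  have hk0 : ∀ k : ℕ, (0 : ℝ) ≤ k * Δt := fun k => by positivity
  have hkT : ∀ k < n, (k : ℝ) * Δt + Δt ≤ T := by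
    intro k hk
    refine le_trans ?_ hn
    have : (k : ℝ) + 1 ≤ n := by exact_mod_cast hk
    nlinarith
  have hcast : ∀ k : ℕ, ((k + 1 : ℕ) : ℝ) * Δt = k * Δt + Δt := fun k => by push_cast; ring
  have hv : ∀ z ∈ gridSites d N, Δt * ‖drift H (sitePoint d N z)‖ ≤ h := fun z hz =>
    hC.mul_norm_drift_le hN hΔt (sitePoint_mem hN hz)
  have mem0 : ∀ k < n, ∀ z ∈ gridSites d N, ((k : ℝ) * Δt, sitePoint d N z) ∈ slab d T :=
    fun k hk z hz => ⟨⟨hk0 k, by linarith [hkT k hk]⟩, sitePoint_mem_two hN hz⟩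
  have mem1 : ∀ k < n, ∀ z ∈ gridSites d N, ∀ a,
      ((k : ℝ) * Δt, sitePoint d N (z + dirVec a)) ∈ slab d T :=
    fun k hk z hz a => ⟨⟨hk0 k, by linarith [hkT k hk]⟩, sitePoint_add_mem_two hN hz a⟩
  have hcomp : ∀ v : Fin d → ℝ, |v i| ≤ ‖v‖ := fun v => norm_le_pi_norm v i
  have hpair : ∀ (s : ℝ) (y y' : (Fin d → ℝ) × (Fin d → ℝ)), ‖(s, y) - (s, y')‖ = ‖y - y'‖ := by
    intro s y y'
    rw [Prod.mk_sub_mk, sub_self, Prod.norm_def]; simp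
  have hpair0 : ∀ (y : (Fin d → ℝ) × (Fin d → ℝ)), ‖((0 : ℝ), y)‖ = ‖y‖ := by
    intro y; simp [Prod.norm_def]
  refine ⟨fun k hk z hz => ?_, fun k hk z hz a => ?_, fun k hk z hz => ?_, fun k hk z hz => ?_,
    fun k hk z hz z' hz' a => ?_, fun k hk z hz z' hz' => ?_⟩
  · -- the truncation error in space and in time
    set t := (k : ℝ) * Δt
    set Fz := levelMap φ (t, sitePoint d N z) with hFz
    set A := levelDeriv φ (t, sitePoint d N z) with hA
    set E : Dir d → Fin d → ℝ := fun a => levelMap φ (t, sitePoint d N (z + dirVec a)) - Fz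
      - A (0, sitePoint d N (dirVec a)) with hE
    have hEb : ∀ a, ‖E a‖ ≤ L * h ^ 2 := by
      intro a
      have := b.taylor (mem0 k hk z hz) (mem1 k hk z hz a)
      rw [hpair, map_add, add_sub_cancel_left, Prod.mk_sub_mk, sub_self,
        add_sub_cancel_left] at this
      have e : E a = levelMap φ (k * Δt, sitePoint d N z + sitePoint d N (dirVec a)) - Fz
          - A (0, sitePoint d N (dirVec a)) := by rw [hE, ← map_add]
      rw [e]
      refine this.trans ?_
      have := norm_sitePoint_dirVec_le N a
      gcongr
    set B := levelMap φ (t + Δt, sitePoint d N z) - Fz + Δt • A (0, drift H (sitePoint d N z))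
      with hB
    have hBb : ‖B‖ ≤ L * h * Δt :=
      norm_level_time_taylor_le hφ b (sitePoint_mem_two hN hz) (hk0 k) hΔt.le (hkT k hk) (hv z hz)
    have hsum : ∑ a, gridRate H N Δt a z • A (0, sitePoint d N (dirVec a))
        = -(Δt • A (0, drift H (sitePoint d N z))) := by
      have h1 := congrArg (fun v => A ((0 : ℝ), v)) (sum_gridRate_smul H hN Δt hz)
      have e1 : ((0 : ℝ), ∑ a, gridRate H N Δt a z • sitePoint d N (dirVec a))
          = ∑ a, gridRate H N Δt a z • ((0 : ℝ), sitePoint d N (dirVec a)) := by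
        ext <;> simp [Prod.fst_sum, Prod.snd_sum]
      have e2 : ((0 : ℝ), -(Δt • drift H (sitePoint d N z)))
          = -(Δt • ((0 : ℝ), drift H (sitePoint d N z))) := by
        simp [Prod.smul_mk]
      rw [e1, e2, map_sum, map_neg, map_smul] at h1
      rw [← h1]
      simp only [map_smul]
    have hmain : walkStep (gridRate H N Δt) dirVec
        (fun z => levelMap φ (t, sitePoint d N z) i) z
        - levelMap φ (((k + 1 : ℕ) : ℝ) * Δt, sitePoint d N z) i
        = (∑ a, gridRate H N Δt a z • E a - B) i := by
      have e3 : ∑ a, gridRate H N Δt a z • E a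
          = ∑ a, gridRate H N Δt a z • (levelMap φ (t, sitePoint d N (z + dirVec a)) - Fz)
            + Δt • A (0, drift H (sitePoint d N z)) := by
        have : ∀ a, gridRate H N Δt a z • E a
            = gridRate H N Δt a z • (levelMap φ (t, sitePoint d N (z + dirVec a)) - Fz)
              - gridRate H N Δt a z • A (0, sitePoint d N (dirVec a)) := fun a => smul_sub _ _ _
        rw [Finset.sum_congr rfl fun a _ => this a, Finset.sum_sub_distrib, hsum, sub_neg_eq_add]
      rw [e3, hcast, hB, walkStep]
      simp only [Pi.sub_apply, Pi.add_apply, Finset.sum_apply, Pi.smul_apply, smul_eq_mul, hFz]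
      ring
    rw [hmain]
    refine (hcomp _).trans ((norm_sub_le _ _).trans ?_)
    have hEs : ‖∑ a, gridRate H N Δt a z • E a‖ ≤ Fintype.card (Dir d) * (Δt * L * (L * h)) := by
      rw [← nsmul_eq_mul, ← Finset.card_univ]
      refine (norm_sum_le _ _).trans (Finset.sum_le_card_nsmul _ _ _ fun a _ => ?_)
      rw [norm_smul, Real.norm_eq_abs, abs_of_nonneg (w.rate.nonneg a z)]
      calc gridRate H N Δt a z * ‖E a‖ ≤ gridRate H N Δt a z * (L * h ^ 2) :=
            mul_le_mul_of_nonneg_left (hEb a) (w.rate.nonneg a z)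
        _ = gridRate H N Δt a z * h * (L * h) := by ring
        _ ≤ Δt * L * (L * h) := mul_le_mul_of_nonneg_right (w.rate_le a z hz) (by positivity)
    have hLL : L * h * Δt ≤ L ^ 2 * h * Δt := by
      have : L ≤ L ^ 2 := le_self_pow₀ hL1 (by norm_num)
      gcongr
    have e4 : obsConst d L * h * Δt
        = Fintype.card (Dir d) * (Δt * L * (L * h)) + L ^ 2 * h * Δt := by
      rw [obsConst]; ring
    linarith
  · refine (hcomp (levelMap φ (k * Δt, sitePoint d N (z + dirVec a))
      - levelMap φ (k * Δt, sitePoint d N z))).trans ?_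
    refine (b.norm_sub_le (mem0 k hk z hz) (mem1 k hk z hz a)).trans ?_
    rw [hpair, map_add, add_sub_cancel_left]
    have := norm_sitePoint_dirVec_le N a
    gcongr
  · simp only [hcast]
    refine (hcomp (levelMap φ (k * Δt + Δt, sitePoint d N z)
      - levelMap φ (k * Δt, sitePoint d N z))).trans ?_
    refine (b.norm_sub_le (mem0 k hk z hz)
      ⟨⟨add_nonneg (hk0 k) hΔt.le, hkT k hk⟩, sitePoint_mem_two hN hz⟩).trans ?_
    have : ‖((k : ℝ) * Δt + Δt, sitePoint d N z) - ((k : ℝ) * Δt, sitePoint d N z)‖ = Δt := by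
      rw [Prod.mk_sub_mk, sub_self, add_sub_cancel_left, Prod.norm_def]
      simp [abs_of_pos hΔt, hΔt.le]
    rw [this]
    gcongr
  · simp only [hcast]
    refine (hcomp (levelMap φ (k * Δt + Δt, sitePoint d N z)
      - levelMap φ (k * Δt, sitePoint d N z))).trans ?_
    refine (norm_level_time_le hφ b (sitePoint_mem_two hN hz) (hk0 k) hΔt.le (hkT k hk)
      (hv z hz)).trans ?_
    gcongr
  · refine (hcomp (levelMap φ (k * Δt, sitePoint d N (z + dirVec a))
      - levelMap φ (k * Δt, sitePoint d N z)
      - (levelMap φ (k * Δt, sitePoint d N (z' + dirVec a))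
        - levelMap φ (k * Δt, sitePoint d N z')))).trans ?_
    have e : ∀ z, ((k : ℝ) * Δt, sitePoint d N (z + dirVec a))
        = ((k : ℝ) * Δt, sitePoint d N z) + (0, sitePoint d N (dirVec a)) := fun z => by
      rw [map_add]
      exact Prod.ext (add_zero _).symm rfl
    have m1 := mem1 k hk z hz a
    have m2 := mem1 k hk z' hz' a
    rw [e] at m1 m2 ⊢
    rw [e]
    refine (b.second_difference (mem0 k hk z' hz') (mem0 k hk z hz) m2 m1).trans ?_
    rw [hpair, hpair0]
    have := norm_sitePoint_dirVec_le N a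
    gcongr
  · simp only [hcast]
    refine (hcomp (levelMap φ (k * Δt + Δt, sitePoint d N z)
      - levelMap φ (k * Δt, sitePoint d N z)
      - (levelMap φ (k * Δt + Δt, sitePoint d N z')
        - levelMap φ (k * Δt, sitePoint d N z')))).trans ?_
    have e : ∀ z, ((k : ℝ) * Δt + Δt, sitePoint d N z)
        = ((k : ℝ) * Δt, sitePoint d N z) + (Δt, 0) := fun z =>
      Prod.ext rfl (add_zero _).symm
    have m : ∀ z ∈ gridSites d N, ((k : ℝ) * Δt + Δt, sitePoint d N z) ∈ slab d T := fun z hz =>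
      ⟨⟨add_nonneg (hk0 k) hΔt.le, hkT k hk⟩, sitePoint_mem_two hN hz⟩
    have m1 := m z hz
    have m2 := m z' hz'
    rw [e] at m1 m2 ⊢
    rw [e]
    refine (b.second_difference (mem0 k hk z' hz') (mem0 k hk z hz) m2 m1).trans ?_
    have hn : ‖(Δt, (0 : (Fin d → ℝ) × (Fin d → ℝ)))‖ = Δt := by
      simp [Prod.norm_def, abs_of_pos hΔt, hΔt.le]
    rw [hpair, hn]
    gcongr

end Time

end Level

/-! ### Bicharacteristics that end at a branch -/

section Bichar

variable {d : ℕ} {H : (Fin d → ℝ) × (Fin d → ℝ) → ℝ}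

/-- The interior of the computational domain. -/
def openBox (d : ℕ) : Set ((Fin d → ℝ) × (Fin d → ℝ)) :=
  {z | ∀ i, z.1 i ∈ Ioo (0 : ℝ) 1 ∧ z.2 i ∈ Ioo (0 : ℝ) 1}

lemma isOpen_openBox : IsOpen (openBox d) := by
  have : openBox d = ⋂ i, {z : (Fin d → ℝ) × (Fin d → ℝ) | z.1 i ∈ Ioo (0 : ℝ) 1} ∩
      {z | z.2 i ∈ Ioo (0 : ℝ) 1} := by
    ext z; simp [openBox]
  rw [this]
  refine isOpen_iInter_of_finite fun i => IsOpen.inter ?_ ?_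
  · exact isOpen_Ioo.preimage (by fun_prop : Continuous fun z : (Fin d → ℝ) × (Fin d → ℝ) => z.1 i)
  · exact isOpen_Ioo.preimage (by fun_prop : Continuous fun z : (Fin d → ℝ) × (Fin d → ℝ) => z.2 i)

lemma openBox_subset : openBox d ⊆ Icc (0 : Fin d → ℝ) 1 ×ˢ Icc (0 : Fin d → ℝ) 1 := fun _ hz =>
  ⟨⟨fun i => (hz i).1.1.le, fun i => (hz i).1.2.le⟩, ⟨fun i => (hz i).2.1.le, fun i => (hz i).2.2.le⟩⟩

/-- `ζ` is a bicharacteristic on `[0, t]`, as a curve in phase space, and keeps the distance `δ`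
from the boundary of the computational domain. -/
structure IsInnerCurve (H : (Fin d → ℝ) × (Fin d → ℝ) → ℝ) (t δ : ℝ)
    (ζ : ℝ → (Fin d → ℝ) × (Fin d → ℝ)) : Prop where
  deriv : ∀ s ∈ Icc 0 t, HasDerivWithinAt ζ (drift H (ζ s)) (Icc 0 t) s
  margin : ∀ s ∈ Icc 0 t, Metric.ball (ζ s) δ ⊆ openBox d
  pos : 0 < δ

variable {t δ L : ℝ} {ζ : ℝ → (Fin d → ℝ) × (Fin d → ℝ)}

lemma IsInnerCurve.mem_openBox (hζ : IsInnerCurve H t δ ζ) {s : ℝ} (hs : s ∈ Icc 0 t) :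
    ζ s ∈ openBox d := hζ.margin s hs (Metric.mem_ball_self hζ.pos)

lemma IsInnerCurve.mem_Icc (hζ : IsInnerCurve H t δ ζ) {s : ℝ} (hs : s ∈ Icc 0 t) :
    ζ s ∈ Icc (0 : Fin d → ℝ) 1 ×ˢ Icc (0 : Fin d → ℝ) 1 := openBox_subset (hζ.mem_openBox hs)

lemma IsInnerCurve.continuousOn (hζ : IsInnerCurve H t δ ζ) : ContinuousOn ζ (Icc 0 t) :=
  fun s hs => (hζ.deriv s hs).continuousWithinAt

lemma IsInnerCurve.norm_sub_le (hζ : IsInnerCurve H t δ ζ) {C a b : ℝ} (ha : 0 ≤ a)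
    (hb : b ≤ t) (hab : a ≤ b)
    (hC : ∀ z ∈ Icc (0 : Fin d → ℝ) 1 ×ˢ Icc (0 : Fin d → ℝ) 1, ‖drift H z‖ ≤ C) :
    ‖ζ b - ζ a‖ ≤ C * (b - a) := by
  have hsub : Icc a b ⊆ Icc 0 t := Icc_subset_Icc ha hb
  refine norm_image_sub_le_of_norm_deriv_le_segment' (f := ζ) (f' := fun s => drift H (ζ s))
    (fun s hs => (hζ.deriv s (hsub hs)).mono hsub)
    (fun s hs => hC _ (hζ.mem_Icc (hsub ⟨hs.1, hs.2.le⟩))) b ⟨hab, le_rfl⟩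

/-- A bicharacteristic is close to the straight line in the direction of the drift at a nearby
point. -/
lemma IsInnerCurve.norm_sub_sub_le (hL : DriftBounds H L) (hζ : IsInnerCurve H t δ ζ) {a Δt h : ℝ}
    (ha : 0 ≤ a) (hb : a + Δt ≤ t) (hΔt : 0 ≤ Δt)
    (hC : ∀ z ∈ Icc (0 : Fin d → ℝ) 1 ×ˢ Icc (0 : Fin d → ℝ) 1, Δt * ‖drift H z‖ ≤ h)
    {z : (Fin d → ℝ) × (Fin d → ℝ)} (hz : z ∈ Icc (0 : Fin d → ℝ) 1 ×ˢ Icc (0 : Fin d → ℝ) 1) :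
    ‖ζ (a + Δt) - ζ a - Δt • drift H z‖ ≤ L * Δt * (‖z - ζ (a + Δt)‖ + h) := by
  rcases hΔt.eq_or_lt with rfl | hpos
  · simp
  have hsub : Icc a (a + Δt) ⊆ Icc 0 t := Icc_subset_Icc ha hb
  have hL0 : 0 ≤ L := zero_le_one.trans hL.one_le
  have hC' : ∀ z ∈ Icc (0 : Fin d → ℝ) 1 ×ˢ Icc (0 : Fin d → ℝ) 1, ‖drift H z‖ ≤ h / Δt :=
    fun z hz => by rw [le_div_iff₀ hpos, mul_comm]; exact hC z hz
  have h0 : 0 ≤ h / Δt := (norm_nonneg _).trans (hC' z hz)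
  have hd : ∀ s ∈ Icc a (a + Δt), HasDerivWithinAt (fun s => ζ s - (s - a) • drift H z)
      (drift H (ζ s) - drift H z) (Icc a (a + Δt)) s := by
    intro s hs
    have h2 : HasDerivWithinAt (fun s : ℝ => (s - a) • drift H z) ((1 : ℝ) • drift H z)
        (Icc a (a + Δt)) s := ((hasDerivWithinAt_id s _).sub_const a).smul_const _
    rw [one_smul] at h2
    exact ((hζ.deriv s (hsub hs)).mono hsub).sub h2
  have h1 := norm_image_sub_le_of_norm_deriv_le_segment' hd (C := L * (‖z - ζ (a + Δt)‖ + h))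
    (fun s hs => by
      refine (hL.lip _ (hζ.mem_Icc (hsub ⟨hs.1, hs.2.le⟩)) _ hz).trans ?_
      refine mul_le_mul_of_nonneg_left ?_ hL0
      have h3 := hζ.norm_sub_le (ha.trans hs.1) hb hs.2.le hC'
      have h4 : h / Δt * (a + Δt - s) ≤ h := by
        calc h / Δt * (a + Δt - s) ≤ h / Δt * Δt := by gcongr; linarith [hs.1]
          _ = h := by field_simp
      have h5 := norm_sub_le_norm_sub_add_norm_sub (ζ s) (ζ (a + Δt)) z
      rw [norm_sub_rev (ζ s) (ζ (a + Δt)), norm_sub_rev (ζ (a + Δt)) z] at h5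
      linarith) (a + Δt) ⟨by linarith, le_rfl⟩
  have e2 : ζ (a + Δt) - (a + Δt - a) • drift H z - (ζ a - (a - a) • drift H z)
      = ζ (a + Δt) - ζ a - Δt • drift H z := by
    rw [sub_self, zero_smul, sub_zero, add_sub_cancel_left]; abel
  rw [e2] at h1
  refine h1.trans_eq ?_
  ring

lemma gridSites_of_mem_openBox {N : ℕ} (hN : 1 ≤ N) {z : Site d}
    (hz : sitePoint d N z ∈ openBox d) : z ∈ gridSites d N := by
  have hN' : (0 : ℝ) < N := by exact_mod_cast hN
  have key : ∀ m : ℤ, (m : ℝ) / N ∈ Ioo (0 : ℝ) 1 → m ∈ Finset.Icc 1 (N : ℤ) := by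
    intro m hm
    have h1 : (0 : ℝ) < m := by
      have := hm.1
      rwa [lt_div_iff₀ hN', zero_mul] at this
    have h2 : (m : ℝ) < N := by
      have := hm.2
      rwa [div_lt_iff₀ hN', one_mul] at this
    have h1' : (0 : ℤ) < m := by exact_mod_cast h1
    have h2' : m < (N : ℤ) := by exact_mod_cast h2
    exact Finset.mem_Icc.2 ⟨by omega, h2'.le⟩
  exact ⟨Fintype.mem_piFinset.2 fun i => key _ (hz i).1,
    Fintype.mem_piFinset.2 fun i => key _ (hz i).2⟩

/-- The coordinates of a point of phase space, positions and momenta. -/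
noncomputable def phaseCoord (d : ℕ) :
    (Fin d → ℝ) × (Fin d → ℝ) →ₗ[ℝ] Fin d ⊕ Fin d → ℝ where
  toFun z := Sum.elim z.1 z.2
  map_add' z z' := by ext (i | i) <;> rfl
  map_smul' r z := by ext (i | i) <;> rfl

lemma norm_phaseCoord (z : (Fin d → ℝ) × (Fin d → ℝ)) : ‖phaseCoord d z‖ = ‖z‖ := by
  refine le_antisymm ?_ ?_
  · refine (pi_norm_le_iff_of_nonneg (norm_nonneg _)).2 fun i => ?_
    rcases i with i | i
    · exact (norm_le_pi_norm z.1 i).trans (norm_fst_le z)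
    · exact (norm_le_pi_norm z.2 i).trans (norm_snd_le z)
  · refine max_le ?_ ?_ <;> refine (pi_norm_le_iff_of_nonneg (norm_nonneg _)).2 fun i => ?_
    · exact norm_le_pi_norm (phaseCoord d z) (Sum.inl i)
    · exact norm_le_pi_norm (phaseCoord d z) (Sum.inr i)

/-- A walk that starts near the end of a bicharacteristic, which stays inside the computational
domain, leaves the grid with small probability. -/
lemma IsInnerCurve.exit_le {I : Type*} [Finite I] {N : ℕ} {Δt : ℝ} {n : ℕ} (hL : DriftBounds H L)
    (hN : 1 ≤ N) (hΔt : 0 < Δt) (hC : CFL H N Δt) (hζ : IsInnerCurve H (n * Δt) δ ζ)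
    (i : I) (c : I → Site d) (hc : gridPoint N (c i).1 = (ζ (n * Δt)).1) :
    (flowAvg (gridRate H N Δt) dirVec ^ n) (fun c => (gridSites d N)ᶜ.indicator (fun _ => 1) (c i)) c
      ≤ Real.exp (exitRate (Dir d) (Fin d ⊕ Fin d) L * (n * Δt)) *
        ((d * ‖gridPoint N (c i).2 - (ζ (n * Δt)).2‖ ^ 2 + 1 / (N : ℝ)) / δ ^ 2) := by
  have w := walkBounds_gridRate hL hN hΔt hC
  have hN' : (0 : ℝ) < N := by exact_mod_cast hN
  have hk0 : ∀ k : ℕ, (0 : ℝ) ≤ k * Δt := fun k => by positivity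
  have hkT : ∀ k < n, (k : ℝ) * Δt + Δt ≤ n * Δt := by
    intro k hk
    have : (k : ℝ) + 1 ≤ n := by exact_mod_cast hk
    nlinarith
  have hcast : ∀ k : ℕ, ((k + 1 : ℕ) : ℝ) * Δt = k * Δt + Δt := fun k => by push_cast; ring
  have hbox := fun z hz => hC.mul_norm_drift_le hN hΔt (z := z) hz
  have h := w.exit_le (n := n) ((phaseCoord d).toAddMonoidHom.comp (sitePoint d N))
    (fun k => phaseCoord d (ζ (k * Δt))) hζ.pos
    (fun a => by
      simp only [AddMonoidHom.comp_apply, LinearMap.toAddMonoidHom_coe, norm_phaseCoord]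
      exact norm_sitePoint_dirVec_le N a)
    (fun k hk z hz i => by
      simp only [AddMonoidHom.comp_apply, LinearMap.toAddMonoidHom_coe, hcast, ← map_sub,
        norm_phaseCoord]
      have h1 := hζ.norm_sub_sub_le hL (hk0 k) (hkT k hk) hΔt.le hbox (sitePoint_mem hN hz)
      refine le_trans ?_ h1
      rw [← norm_phaseCoord]
      refine le_trans (le_of_eq ?_) (norm_le_pi_norm _ i)
      rw [Real.norm_eq_abs]
      congr 1
      have h2 : walkStep (gridRate H N Δt) dirVec (fun z => phaseCoord d (sitePoint d N z) i) z
          - phaseCoord d (sitePoint d N z) i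
          = phaseCoord d (∑ a, gridRate H N Δt a z • sitePoint d N (dirVec a)) i := by
        rw [walkStep, add_sub_cancel_left, map_sum, Finset.sum_apply]
        refine Finset.sum_congr rfl fun a _ => ?_
        rw [map_add, map_add, Pi.add_apply, add_sub_cancel_left, map_smul, Pi.smul_apply,
          smul_eq_mul]
      rw [h2, sum_gridRate_smul H hN Δt hz, map_sub, map_sub, map_neg]
      simp only [Pi.sub_apply, Pi.neg_apply]
      ring)
    (fun k hk => by
      rw [← map_sub, norm_phaseCoord, hcast]
      have h1 := hζ.norm_sub_le (C := 1 / (N : ℝ) / Δt) (hk0 k) (hkT k hk) (by linarith)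
        fun z hz => by rw [le_div_iff₀ hΔt, mul_comm]; exact hbox z hz
      rw [add_sub_cancel_left] at h1
      exact h1.trans_eq (by field_simp))
    (fun k hk => by
      rw [← map_sub, norm_phaseCoord, hcast]
      have h1 := hζ.norm_sub_le (hk0 k) (hkT k hk) (by linarith) hL.norm_le
      rwa [add_sub_cancel_left] at h1)
    (fun k hk z hz => by
      simp only [AddMonoidHom.comp_apply, LinearMap.toAddMonoidHom_coe, ← map_sub, norm_phaseCoord]
      by_contra hlt
      push Not at hlt
      have hks : (k : ℝ) * Δt ∈ Icc 0 (n * Δt) :=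
        ⟨hk0 k, mul_le_mul_of_nonneg_right (by exact_mod_cast hk) hΔt.le⟩
      refine hz (gridSites_of_mem_openBox hN (hζ.margin _ hks ?_))
      rwa [Metric.mem_ball, dist_eq_norm]) i c
  refine h.trans ?_
  refine mul_le_mul_of_nonneg_left ?_ (Real.exp_pos _).le
  refine div_le_div_of_nonneg_right (add_le_add ?_ le_rfl) (by positivity)
  rw [Fintype.sum_sum_type]
  have e1 : ∀ i', ((phaseCoord d).toAddMonoidHom.comp (sitePoint d N)) (c i) (Sum.inl i')
      - phaseCoord d (ζ (n * Δt)) (Sum.inl i') = 0 := fun i' => by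
    have := congrFun hc i'
    exact sub_eq_zero.2 this
  simp_rw [e1]
  have e2 : ∀ i', (((phaseCoord d).toAddMonoidHom.comp (sitePoint d N)) (c i) (Sum.inr i')
      - phaseCoord d (ζ (n * Δt)) (Sum.inr i')) ^ 2
      ≤ ‖gridPoint N (c i).2 - (ζ (n * Δt)).2‖ ^ 2 := fun i' => by
    rw [← sq_abs]
    exact pow_le_pow_left₀ (abs_nonneg _)
      (norm_le_pi_norm (gridPoint N (c i).2 - (ζ (n * Δt)).2) i') 2
  refine (add_le_add le_rfl (Finset.sum_le_card_nsmul _ _ _ fun i' _ => e2 i')).trans_eq ?_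
  simp

/-- Two bicharacteristics whose end points are close stay close, if their times are counted
from the end. -/
lemma IsInnerCurve.norm_reverse_sub_le (hL : DriftBounds H L) {t' δ' : ℝ}
    {ζ' : ℝ → (Fin d → ℝ) × (Fin d → ℝ)} (hζ : IsInnerCurve H t δ ζ)
    (hζ' : IsInnerCurve H t' δ' ζ') {r : ℝ} (hr : 0 ≤ r) (hrt : r ≤ t) (hrt' : r ≤ t') :
    ‖ζ' (t' - r) - ζ (t - r)‖ ≤ ‖ζ' t' - ζ t‖ * Real.exp (L * r) := by
  have hL0 : 0 ≤ L := zero_le_one.trans hL.one_le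
  have hlip : LipschitzOnWith L.toNNReal (fun z => -drift H z)
      (Icc (0 : Fin d → ℝ) 1 ×ˢ Icc (0 : Fin d → ℝ) 1) := by
    refine LipschitzOnWith.of_dist_le_mul fun z hz z' hz' => ?_
    rw [dist_neg_neg, dist_eq_norm, dist_eq_norm, Real.coe_toNNReal L hL0]
    exact hL.lip z hz z' hz'
  have rev : ∀ {T ε : ℝ} {η : ℝ → (Fin d → ℝ) × (Fin d → ℝ)}, IsInnerCurve H T ε η → r ≤ T →
      ContinuousOn (fun s => η (T - s)) (Icc 0 r) ∧ (∀ s ∈ Ico 0 r,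
        HasDerivWithinAt (fun s => η (T - s)) (-drift H (η (T - s))) (Ici s) s) ∧
      ∀ s ∈ Ico 0 r, η (T - s) ∈ Icc (0 : Fin d → ℝ) 1 ×ˢ Icc (0 : Fin d → ℝ) 1 := by
    intro T ε η hη hrT
    have hmaps : MapsTo (fun s => T - s) (Icc 0 r) (Icc 0 T) := fun s hs =>
      ⟨by linarith [hs.2], by linarith [hs.1]⟩
    refine ⟨hη.continuousOn.comp (by fun_prop) hmaps, fun s hs => ?_, fun s hs => ?_⟩
    · have h1 : HasDerivWithinAt (fun s => T - s) (-1) (Icc 0 r) s := by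
        simpa using (hasDerivWithinAt_id s (Icc 0 r)).const_sub T
      have h2 := HasDerivWithinAt.scomp s (hη.deriv (T - s) (hmaps ⟨hs.1, hs.2.le⟩)) h1 hmaps
      rw [neg_one_smul] at h2
      exact h2.mono_of_mem_nhdsWithin (Icc_mem_nhdsGE_of_mem hs)
    · exact hη.mem_Icc (hmaps ⟨hs.1, hs.2.le⟩)
  obtain ⟨c1, d1, m1⟩ := rev hζ' hrt'
  obtain ⟨c2, d2, m2⟩ := rev hζ hrt
  have := dist_le_of_trajectories_ODE_of_mem (v := fun _ z => -drift H z)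
    (s := fun _ => Icc (0 : Fin d → ℝ) 1 ×ˢ Icc (0 : Fin d → ℝ) 1) (K := L.toNNReal)
    (fun _ _ => hlip) c1 d1 m1 c2 d2 m2 (δ := ‖ζ' t' - ζ t‖) (by simp [dist_eq_norm]) r ⟨hr, le_rfl⟩
  rw [sub_zero, Real.coe_toNNReal L hL0, dist_eq_norm] at this
  exact this

/-- The bicharacteristics that end at a compact set of branches keep a common distance from the
boundary of the computational domain. -/
lemma exists_uniform_margin (hL : DriftBounds H L)
    {Γ : Set (ℝ × (Fin d → ℝ) × (Fin d → ℝ))} (hΓ : IsCompact Γ) (hΓ0 : ∀ γ ∈ Γ, 0 ≤ γ.1)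
    (h : ∀ γ ∈ Γ, ∃ ζ δ, IsInnerCurve H γ.1 δ ζ ∧ ζ γ.1 = γ.2) :
    ∃ δ > 0, ∀ γ ∈ Γ, ∃ ζ, IsInnerCurve H γ.1 δ ζ ∧ ζ γ.1 = γ.2 := by
  have hL0 : 0 ≤ L := zero_le_one.trans hL.one_le
  obtain ⟨T, hT⟩ : ∃ T, ∀ γ ∈ Γ, γ.1 ≤ T := by
    obtain ⟨T, hT⟩ := (hΓ.image continuous_fst).bddAbove
    exact ⟨T, fun γ hγ => hT ⟨γ, hγ, rfl⟩⟩
  have shrink : ∀ {t δ δ' : ℝ} {ζ : ℝ → (Fin d → ℝ) × (Fin d → ℝ)}, IsInnerCurve H t δ ζ →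
      0 < δ' → δ' ≤ δ → IsInnerCurve H t δ' ζ := fun hζ h0 hle =>
    ⟨hζ.deriv, fun s hs => (Metric.ball_subset_ball hle).trans (hζ.margin s hs), h0⟩
  suffices ∃ δ > 0, ∀ γ ∈ Γ, γ ∈ Γ → ∃ ζ, IsInnerCurve H γ.1 δ ζ ∧ ζ γ.1 = γ.2 by
    obtain ⟨δ, hδ, hh⟩ := this
    exact ⟨δ, hδ, fun γ hγ => hh γ hγ hγ⟩
  refine hΓ.induction_on (p := fun U => ∃ δ > 0, ∀ γ ∈ U, γ ∈ Γ →
    ∃ ζ, IsInnerCurve H γ.1 δ ζ ∧ ζ γ.1 = γ.2) ⟨1, one_pos, fun _ h => absurd h (by simp)⟩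
    (fun U V hUV ⟨δ, hδ, hV⟩ => ⟨δ, hδ, fun γ hγ => hV γ (hUV hγ)⟩) ?_ ?_
  · rintro U V ⟨δ, hδ, hU⟩ ⟨δ', hδ', hV⟩
    refine ⟨min δ δ', lt_min hδ hδ', fun γ hγ hγΓ => ?_⟩
    rcases hγ with hγ | hγ
    · obtain ⟨ζ, h1, h2⟩ := hU γ hγ hγΓ
      exact ⟨ζ, shrink h1 (lt_min hδ hδ') (min_le_left _ _), h2⟩
    · obtain ⟨ζ, h1, h2⟩ := hV γ hγ hγΓ
      exact ⟨ζ, shrink h1 (lt_min hδ hδ') (min_le_right _ _), h2⟩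
  · intro γ₀ hγ₀
    obtain ⟨ζ₀, δ₀, hζ₀, hend₀⟩ := h γ₀ hγ₀
    have hδ₀ := hζ₀.pos
    have hT0 : 0 ≤ T := (hΓ0 γ₀ hγ₀).trans (hT γ₀ hγ₀)
    set C := Real.exp (L * T) + L with hC
    have hCpos : 0 < C := by positivity
    refine ⟨Metric.ball γ₀ (δ₀ / (2 * C)), mem_nhdsWithin_of_mem_nhds
      (Metric.ball_mem_nhds _ (by positivity)), δ₀ / 2, by positivity, fun γ hγ hγΓ => ?_⟩
    obtain ⟨ζ, δ, hζ, hend⟩ := h γ hγΓ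
    refine ⟨ζ, ⟨hζ.deriv, fun s hs => ?_, by positivity⟩, hend⟩
    have hdist : ‖γ - γ₀‖ * C < δ₀ / 2 := by
      rw [Metric.mem_ball, dist_eq_norm, lt_div_iff₀ (by positivity)] at hγ
      linarith
    have hd1 : |γ.1 - γ₀.1| ≤ ‖γ - γ₀‖ := norm_fst_le (γ - γ₀)
    have hd2 : ‖γ.2 - γ₀.2‖ ≤ ‖γ - γ₀‖ := norm_snd_le (γ - γ₀)
    set r := min (γ.1 - s) γ₀.1 with hr
    have hr0 : 0 ≤ r := le_min (by linarith [hs.2]) (hΓ0 γ₀ hγ₀)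
    have hrle : r ≤ γ₀.1 := min_le_right _ _
    have hrle' : r ≤ γ.1 := (min_le_left _ _).trans (by linarith [hs.1])
    have h1 := IsInnerCurve.norm_reverse_sub_le hL hζ₀ hζ hr0 hrle hrle'
    have h2 : ‖ζ (γ.1 - r) - ζ s‖ ≤ L * (γ.1 - r - s) :=
      hζ.norm_sub_le hs.1 (by linarith) (by
        have := min_le_left (γ.1 - s) γ₀.1
        linarith) hL.norm_le
    have h3 : γ.1 - r - s ≤ ‖γ - γ₀‖ := by
      rcases min_choice (γ.1 - s) γ₀.1 with h4 | h4
      · rw [hr, h4]; linarith [norm_nonneg (γ - γ₀)]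
      · rw [hr, h4]; linarith [hs.1, le_abs_self (γ.1 - γ₀.1)]
    have h5 : ‖ζ s - ζ₀ (γ₀.1 - r)‖ < δ₀ / 2 := by
      have h6 := norm_sub_le_norm_sub_add_norm_sub (ζ s) (ζ (γ.1 - r)) (ζ₀ (γ₀.1 - r))
      rw [norm_sub_rev (ζ s) (ζ (γ.1 - r))] at h6
      rw [hend, hend₀] at h1
      have h7 : Real.exp (L * r) ≤ Real.exp (L * T) :=
        Real.exp_le_exp.2 (mul_le_mul_of_nonneg_left (hrle.trans (hT γ₀ hγ₀)) hL0)
      have h8 : ‖γ.2 - γ₀.2‖ * Real.exp (L * r) ≤ ‖γ - γ₀‖ * Real.exp (L * T) := by gcongr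
      have h9 : L * (γ.1 - r - s) ≤ L * ‖γ - γ₀‖ := by gcongr
      have h10 : ‖γ - γ₀‖ * C = ‖γ - γ₀‖ * Real.exp (L * T) + L * ‖γ - γ₀‖ := by rw [hC]; ring
      linarith
    intro y hy
    refine hζ₀.margin (γ₀.1 - r) ⟨by linarith, by linarith⟩ ?_
    rw [Metric.mem_ball, dist_eq_norm] at hy ⊢
    linarith [norm_sub_le_norm_sub_add_norm_sub y (ζ s) (ζ₀ (γ₀.1 - r))]

lemma IsBicharacteristic.exists_isInnerCurve {X P : ℝ → Fin d → ℝ}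
    (hb : IsBicharacteristic H t X P)
    (hin : ∀ s ∈ Icc (0 : ℝ) t, ∀ i, X s i ∈ Ioo (0 : ℝ) 1 ∧ P s i ∈ Ioo (0 : ℝ) 1) :
    ∃ δ, IsInnerCurve H t δ (fun s => (X s, P s)) := by
  have hd : ∀ s ∈ Icc 0 t, HasDerivWithinAt (fun s => (X s, P s)) (drift H (X s, P s))
      (Icc 0 t) s := fun s hs => (hb s hs).1.prodMk (hb s hs).2
  have hc : IsCompact ((fun s => (X s, P s)) '' Icc 0 t) :=
    isCompact_Icc.image_of_continuousOn fun s hs => (hd s hs).continuousWithinAt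
  obtain ⟨δ, hδ, hsub⟩ := hc.exists_thickening_subset_open isOpen_openBox (by
    rintro _ ⟨s, hs, rfl⟩
    exact hin s hs)
  exact ⟨δ, hd, fun s hs =>
    (Metric.ball_subset_thickening (mem_image_of_mem _ hs) δ).trans hsub, hδ⟩

end Bichar

/-! ### The branches of the multi-valued solution -/

section Geometry

variable {d : ℕ} {H : (Fin d → ℝ) × (Fin d → ℝ) → ℝ} {u₀ : (Fin d → ℝ) → Fin d → ℝ}
  {φ : ℝ → (Fin d → ℝ) → (Fin d → ℝ) → Fin d → ℝ}

/-- The derivative of `φ` in `p`. -/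
noncomputable def momentumDeriv (φ : ℝ → (Fin d → ℝ) → (Fin d → ℝ) → Fin d → ℝ)
    (q : ℝ × (Fin d → ℝ) × (Fin d → ℝ)) : (Fin d → ℝ) →L[ℝ] Fin d → ℝ :=
  (levelDeriv φ q).comp ((ContinuousLinearMap.inr ℝ ℝ ((Fin d → ℝ) × (Fin d → ℝ))).comp
    (ContinuousLinearMap.inr ℝ (Fin d → ℝ) (Fin d → ℝ)))

lemma momentumDeriv_apply (q : ℝ × (Fin d → ℝ) × (Fin d → ℝ)) (v : Fin d → ℝ) :
    momentumDeriv φ q v = levelDeriv φ q (0, 0, v) := rfl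

lemma IsLevelSetFunction.levelJacobian_eq (hφ : IsLevelSetFunction H u₀ φ) {t : ℝ} (ht : 0 ≤ t)
    (x p : Fin d → ℝ) : levelJacobian φ t x p = |(momentumDeriv φ (t, x, p)).det| := by
  rw [levelJacobian, (hφ.hasFDerivAt_right ht x p).fderiv]; rfl

lemma IsLevelSetFunction.continuousOn_momentumDeriv (hφ : IsLevelSetFunction H u₀ φ) :
    ContinuousOn (momentumDeriv φ) (halfSpace d) :=
  hφ.continuousOn_levelDeriv.clm_comp continuousOn_const

lemma norm_zero_zero_mk (v : Fin d → ℝ) :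
    ‖((0 : ℝ), (0 : Fin d → ℝ), v)‖ = ‖v‖ := by
  simp [Prod.norm_def]

section Bounds

variable {T L : ℝ} {t : ℝ} {x p p' p₀ : Fin d → ℝ}

lemma norm_momentumDeriv_sub_le
    (b : SmoothBounds (levelMap φ) (levelDeriv φ) (slab d T) L)
    (hp : (t, x, p) ∈ slab d T) (hp' : (t, x, p') ∈ slab d T) (v : Fin d → ℝ) :
    ‖momentumDeriv φ (t, x, p) v - momentumDeriv φ (t, x, p') v‖ ≤ L * ‖p - p'‖ * ‖v‖ := by
  rw [momentumDeriv_apply, momentumDeriv_apply, ← _root_.sub_apply]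
  refine (ContinuousLinearMap.le_opNorm _ _).trans ?_
  rw [norm_zero_zero_mk]
  refine mul_le_mul_of_nonneg_right ((b.lip _ hp _ hp').trans_eq ?_) (norm_nonneg v)
  rw [Prod.mk_sub_mk, Prod.mk_sub_mk, sub_self, sub_self, norm_zero_zero_mk]

lemma norm_level_taylor_le
    (b : SmoothBounds (levelMap φ) (levelDeriv φ) (slab d T) L)
    (hp : (t, x, p) ∈ slab d T) (hp' : (t, x, p') ∈ slab d T) :
    ‖φ t x p' - φ t x p - momentumDeriv φ (t, x, p) (p' - p)‖ ≤ L * ‖p' - p‖ ^ 2 := by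
  have := b.taylor hp hp'
  rwa [Prod.mk_sub_mk, Prod.mk_sub_mk, sub_self, sub_self, norm_zero_zero_mk,
    ← momentumDeriv_apply] at this

/-- Near `p₀` the function `φ(t, x, ·)` is close to its linearisation at `p₀`. -/
lemma norm_level_sub_sub_le
    (b : SmoothBounds (levelMap φ) (levelDeriv φ) (slab d T) L)
    (h₀ : (t, x, p₀) ∈ slab d T) (hp : (t, x, p) ∈ slab d T) (hp' : (t, x, p') ∈ slab d T) {r : ℝ}
    (hr : ‖p - p₀‖ ≤ r) (hr' : ‖p' - p₀‖ ≤ r) :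
    ‖φ t x p - φ t x p' - momentumDeriv φ (t, x, p₀) (p - p')‖ ≤ 3 * L * r * ‖p - p'‖ := by
  have h1 := norm_level_taylor_le b hp' hp
  have h2 := norm_momentumDeriv_sub_le b hp' h₀ (p - p')
  have e : φ t x p - φ t x p' - momentumDeriv φ (t, x, p₀) (p - p')
      = (φ t x p - φ t x p' - momentumDeriv φ (t, x, p') (p - p'))
        + (momentumDeriv φ (t, x, p') (p - p') - momentumDeriv φ (t, x, p₀) (p - p')) := by abel
  rw [e]
  refine (norm_add_le _ _).trans ((add_le_add h1 h2).trans ?_)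
  have h3 : ‖p - p'‖ ≤ 2 * r := by
    have := norm_sub_le_norm_sub_add_norm_sub p p₀ p'
    rw [norm_sub_rev p₀ p'] at this
    linarith
  have hL := b.nonneg
  have h4 : L * ‖p - p'‖ ^ 2 ≤ L * (2 * r * ‖p - p'‖) := by
    rw [sq]; gcongr
  have h5 : L * ‖p' - p₀‖ * ‖p - p'‖ ≤ L * r * ‖p - p'‖ := by gcongr
  linarith

end Bounds

/-- Quantitative nondegeneracy of the branches over the points of `K`: `c` bounds the derivative of
`φ` in `p` from below at the branches, and `φ` is small only near a branch. -/
structure LevelGeometry (φ : ℝ → (Fin d → ℝ) → (Fin d → ℝ) → Fin d → ℝ)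
    (K : Set (ℝ × (Fin d → ℝ))) (c r c₀ : ℝ) : Prop where
  c_pos : 0 < c
  r_pos : 0 < r
  c₀_pos : 0 < c₀
  mem_Icc : ∀ q ∈ K, ∀ b ∈ branches φ q.1 q.2, b ∈ Icc (0 : Fin d → ℝ) 1
  jacobian : ∀ q ∈ K, ∀ b ∈ branches φ q.1 q.2, c ≤ |(momentumDeriv φ (q.1, q.2, b)).det|
  lower : ∀ q ∈ K, ∀ b ∈ branches φ q.1 q.2, ∀ v, c * ‖v‖ ≤ ‖momentumDeriv φ (q.1, q.2, b) v‖
  near : ∀ q ∈ K, ∀ b ∈ branches φ q.1 q.2, ∀ p ∈ Icc (0 : Fin d → ℝ) 1,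
    ∀ p' ∈ Icc (0 : Fin d → ℝ) 1, ‖p - b‖ ≤ r → ‖p' - b‖ ≤ r →
    c / 2 * ‖p - p'‖ ≤ ‖φ q.1 q.2 p - φ q.1 q.2 p'‖
  far : ∀ q ∈ K, ∀ p ∈ Icc (0 : Fin d → ℝ) 1, ‖φ q.1 q.2 p‖ < c₀ →
    ∃ b ∈ branches φ q.1 q.2, ‖p - b‖ ≤ r

lemma momentumDeriv_ne_zero {A : (Fin d → ℝ) →L[ℝ] Fin d → ℝ} (hA : A.det ≠ 0) {v : Fin d → ℝ}
    (hv : v ≠ 0) : A v ≠ 0 := by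
  intro h
  refine hv ?_
  have hker : LinearMap.ker A.toLinearMap = ⊥ := by
    by_contra hk
    exact hA (LinearMap.det_eq_zero_iff_ker_ne_bot.2 hk)
  have hinj := LinearMap.ker_eq_bot.1 hker
  exact hinj (by simpa using h)

lemma mul_norm_le_of_sphere {A : (Fin d → ℝ) →L[ℝ] Fin d → ℝ} {c : ℝ}
    (h : ∀ v ∈ Metric.sphere (0 : Fin d → ℝ) 1, c ≤ ‖A v‖) (v : Fin d → ℝ) :
    c * ‖v‖ ≤ ‖A v‖ := by
  by_cases hv : v = 0
  · simp [hv]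
  have hn : 0 < ‖v‖ := norm_pos_iff.2 hv
  have h1 := h (‖v‖⁻¹ • v) (by simp [norm_smul, hn.ne'])
  rw [map_smul, norm_smul, norm_inv, norm_norm] at h1
  rwa [inv_mul_eq_div, le_div_iff₀ hn] at h1

/-- A function that is close to an invertible linear map near `p`, and small at `p`, has a zero
near `p`. -/
lemma exists_zero_of_approximates {f : (Fin d → ℝ) → Fin d → ℝ}
    {A : (Fin d → ℝ) →L[ℝ] Fin d → ℝ} {c ρ : ℝ} (hc : 0 < c) (hρ : 0 < ρ) {p : Fin d → ℝ}
    (hA : ∀ v, c * ‖v‖ ≤ ‖A v‖)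
    (hf : ∀ p₁, ‖p₁ - p‖ ≤ ρ → ∀ p₂, ‖p₂ - p‖ ≤ ρ →
      ‖f p₁ - f p₂ - A (p₁ - p₂)‖ ≤ c / 2 * ‖p₁ - p₂‖)
    (hp : ‖f p‖ ≤ c / 2 * ρ) : ∃ b, f b = 0 ∧ ‖p - b‖ ≤ ρ := by
  have hinj : Function.Injective A.toLinearMap := by
    rw [← LinearMap.ker_eq_bot, LinearMap.ker_eq_bot']
    intro v hv
    have h1 := hA v
    have : A v = 0 := hv
    rw [this, norm_zero] at h1
    by_contra hne
    have := mul_pos hc (norm_pos_iff.2 hne)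
    linarith
  let e := LinearEquiv.ofInjectiveEndo A.toLinearMap hinj
  have he : ∀ y, A (e.symm y) = y := fun y => e.apply_symm_apply y
  let R : A.NonlinearRightInverse :=
    { toFun := e.symm
      nnnorm := Real.toNNReal c⁻¹
      bound' := fun y => by
        have h1 := hA (e.symm y)
        rw [he] at h1
        rw [Real.coe_toNNReal _ (by positivity), inv_mul_eq_div, le_div_iff₀ hc, mul_comm]
        exact h1
      right_inv' := he }
  have happ : ApproximatesLinearOn f A (Metric.closedBall p ρ) (Real.toNNReal (c / 2)) := by
    intro p₁ h₁ p₂ h₂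
    rw [Real.coe_toNNReal _ (by positivity)]
    rw [Metric.mem_closedBall, dist_eq_norm] at h₁ h₂
    exact hf p₁ h₁ p₂ h₂
  have hsurj := happ.surjOn_closedBall_of_nonlinearRightInverse R hρ.le subset_rfl
  obtain ⟨b, hb, hb0⟩ := hsurj (by
    rw [Metric.mem_closedBall, dist_comm, dist_zero_right]
    have e1 : (((R.nnnorm : NNReal) : ℝ)⁻¹ - ((Real.toNNReal (c / 2) : NNReal) : ℝ)) * ρ
        = c / 2 * ρ := by
      simp only [R]
      rw [Real.coe_toNNReal _ (by positivity), Real.coe_toNNReal _ (by positivity), inv_inv]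
      ring
    rw [e1]
    exact hp : (0 : Fin d → ℝ) ∈ _)
  refine ⟨b, hb0, ?_⟩
  rwa [Metric.mem_closedBall, dist_comm, dist_eq_norm] at hb

lemma mem_slab {T t : ℝ} {x p : Fin d → ℝ} (ht : t ∈ Icc 0 T)
    (hx : x ∈ Icc (-1 : Fin d → ℝ) 2) (hp : p ∈ Icc (-1 : Fin d → ℝ) 2) : (t, x, p) ∈ slab d T :=
  ⟨ht, hx, hp⟩

lemma Icc_zero_one_subset : Icc (0 : Fin d → ℝ) 1 ⊆ Icc (-1) 2 :=
  Icc_subset_Icc (fun i => by norm_num) (fun i => by norm_num)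

set_option maxHeartbeats 400000 in
/-- Nondegenerate branches over a compact set are uniformly nondegenerate. -/
lemma IsLevelSetFunction.exists_levelGeometry (hφ : IsLevelSetFunction H u₀ φ)
    {K : Set (ℝ × (Fin d → ℝ))} (hK : IsCompact K) (hK0 : ∀ q ∈ K, 0 ≤ q.1)
    (hK1 : ∀ q ∈ K, q.2 ∈ Icc (0 : Fin d → ℝ) 1)
    (hbr : ∀ q ∈ K, ∀ b ∈ branches φ q.1 q.2, b ∈ Icc (0 : Fin d → ℝ) 1)
    (hdet : ∀ q ∈ K, ∀ b ∈ branches φ q.1 q.2, levelJacobian φ q.1 q.2 b ≠ 0) {T L : ℝ}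
    (hT : ∀ q ∈ K, q.1 ≤ T) (b : SmoothBounds (levelMap φ) (levelDeriv φ) (slab d T) L) :
    ∃ c r c₀, LevelGeometry φ K c r c₀ := by
  let assoc : (ℝ × (Fin d → ℝ)) × (Fin d → ℝ) → ℝ × (Fin d → ℝ) × (Fin d → ℝ) :=
    fun y => (y.1.1, y.1.2, y.2)
  have hassoc : Continuous assoc := by fun_prop
  set S := K ×ˢ Icc (0 : Fin d → ℝ) 1 with hS
  have hSc : IsCompact S := hK.prod isCompact_Icc
  have hmaps : MapsTo assoc S (halfSpace d) := fun y hy => ⟨hK0 _ hy.1, mem_univ _⟩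
  have hFc : ContinuousOn (fun y => levelMap φ (assoc y)) S :=
    hφ.continuousOn_levelMap.comp hassoc.continuousOn hmaps
  have hAc : ContinuousOn (fun y => momentumDeriv φ (assoc y)) S :=
    hφ.continuousOn_momentumDeriv.comp hassoc.continuousOn hmaps
  set Γ := S ∩ (fun y => levelMap φ (assoc y)) ⁻¹' {0} with hΓ
  have hΓc : IsCompact Γ :=
    hSc.of_isClosed_subset (hFc.preimage_isClosed_of_isClosed hSc.isClosed isClosed_singleton)
      inter_subset_left
  have hdet' : ∀ y ∈ Γ, 0 < |(momentumDeriv φ (assoc y)).det| := by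
    intro y hy
    have h1 := hdet y.1 hy.1.1 y.2 hy.2
    rw [hφ.levelJacobian_eq (hK0 _ hy.1.1)] at h1
    exact lt_of_le_of_ne (abs_nonneg _) (Ne.symm h1)
  obtain ⟨c₁, hc₁, hc₁'⟩ := hΓc.exists_forall_le' (f := fun y => |(momentumDeriv φ (assoc y)).det|)
    (by
      have : Continuous fun A : (Fin d → ℝ) →L[ℝ] Fin d → ℝ => |A.det| :=
        ContinuousLinearMap.continuous_det.abs
      exact this.comp_continuousOn (hAc.mono inter_subset_left)) hdet'
  have hev : ∀ {V : Set ((ℝ × (Fin d → ℝ)) × (Fin d → ℝ))}, V ⊆ S →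
      ContinuousOn (fun w : ((ℝ × (Fin d → ℝ)) × (Fin d → ℝ)) × (Fin d → ℝ) =>
        ‖momentumDeriv φ (assoc w.1) w.2‖) (V ×ˢ Metric.sphere 0 1) := by
    intro V hV
    refine ContinuousOn.norm (ContinuousOn.clm_apply ?_ continuousOn_snd)
    exact hAc.comp continuousOn_fst fun w hw => hV hw.1
  have hpos : ∀ w ∈ Γ ×ˢ Metric.sphere (0 : Fin d → ℝ) 1,
      0 < ‖momentumDeriv φ (assoc w.1) w.2‖ := by
    intro w hw
    have hv : w.2 ≠ 0 := Metric.ne_of_mem_sphere hw.2 one_ne_zero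
    exact norm_pos_iff.2 (momentumDeriv_ne_zero (abs_pos.1 (hdet' w.1 hw.1)) hv)
  have hΓe := hev (V := Γ) inter_subset_left
  obtain ⟨c₂, hc₂, hc₂'⟩ :=
    (hΓc.prod (isCompact_sphere (0 : Fin d → ℝ) 1)).exists_forall_le' hΓe hpos
  set c := min c₁ c₂ with hc
  have hc0 : 0 < c := lt_min hc₁ hc₂
  -- where the derivative is not uniformly invertible, `φ` is bounded away from zero
  set S' := (S ×ˢ Metric.sphere (0 : Fin d → ℝ) 1) ∩
    (fun w : ((ℝ × (Fin d → ℝ)) × (Fin d → ℝ)) × (Fin d → ℝ) =>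
      ‖momentumDeriv φ (assoc w.1) w.2‖) ⁻¹' Iic (c / 2) with hS'
  have hS'c : IsCompact S' :=
    (hSc.prod (isCompact_sphere _ _)).of_isClosed_subset
      ((hev subset_rfl).preimage_isClosed_of_isClosed
        (hSc.prod (isCompact_sphere _ _)).isClosed isClosed_Iic) inter_subset_left
  have hpos' : ∀ w ∈ S', 0 < ‖levelMap φ (assoc w.1)‖ := by
    intro w hw
    refine norm_pos_iff.2 fun h0 => ?_
    have h1 : c₂ ≤ ‖momentumDeriv φ (assoc w.1) w.2‖ := hc₂' w ⟨⟨hw.1.1, h0⟩, hw.1.2⟩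
    have h2 : ‖momentumDeriv φ (assoc w.1) w.2‖ ≤ c / 2 := hw.2
    have h3 : c ≤ c₂ := min_le_right _ _
    linarith
  have hS'e : ContinuousOn (fun w : ((ℝ × (Fin d → ℝ)) × (Fin d → ℝ)) × (Fin d → ℝ) =>
      ‖levelMap φ (assoc w.1)‖) S' :=
    (hFc.comp continuousOn_fst fun w hw => hw.1.1).norm
  obtain ⟨c₃, hc₃, hc₃'⟩ := hS'c.exists_forall_le' hS'e hpos'
  set L' := L + 1 with hL'
  have hL0 := b.nonneg
  have hL'0 : 0 < L' := by linarith
  set ρ := min 1 (c / (12 * L')) with hρ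
  have hρ0 : 0 < ρ := lt_min one_pos (by positivity)
  have hρc : 12 * L' * ρ ≤ c := by
    have : ρ ≤ c / (12 * L') := min_le_right _ _
    rw [le_div_iff₀ (by positivity)] at this
    linarith
  have hLρ : 12 * L * ρ ≤ c := by
    have : 12 * L * ρ ≤ 12 * L' * ρ := by gcongr; linarith
    linarith
  have hρ1 : ρ ≤ 1 := min_le_left _ _
  have hin : ∀ q ∈ K, ∀ p ∈ Icc (-1 : Fin d → ℝ) 2, (q.1, q.2, p) ∈ slab d T := fun q hq p hp =>
    mem_slab ⟨hK0 q hq, hT q hq⟩ (Icc_zero_one_subset (hK1 q hq)) hp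
  have hΓmem : ∀ q ∈ K, ∀ p ∈ branches φ q.1 q.2, (q, p) ∈ Γ := fun q hq p hp =>
    ⟨Set.mk_mem_prod hq (hbr q hq p hp), hp⟩
  have hlow : ∀ q ∈ K, ∀ p ∈ branches φ q.1 q.2, ∀ v,
      c * ‖v‖ ≤ ‖momentumDeriv φ (q.1, q.2, p) v‖ := fun q hq p hp =>
    mul_norm_le_of_sphere fun v hv => (min_le_right c₁ c₂).trans
      (hc₂' ((q, p), v) (Set.mk_mem_prod (hΓmem q hq p hp) hv))
  refine ⟨c, ρ, min c₃ (c / 4 * ρ), hc0, hρ0, lt_min hc₃ (by positivity), hbr, fun q hq p hp => ?_,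
    hlow, fun q hq p₀ hp₀ p hp p' hp' hpr hpr' => ?_, fun q hq p hp hlt => ?_⟩
  · exact (min_le_left _ _).trans (hc₁' (q, p) (hΓmem q hq p hp))
  · have h1 := norm_level_sub_sub_le b (hin q hq p₀ (Icc_zero_one_subset (hbr q hq p₀ hp₀)))
      (hin q hq p (Icc_zero_one_subset hp)) (hin q hq p' (Icc_zero_one_subset hp')) hpr hpr'
    have h2 : c * ‖p - p'‖ ≤ ‖momentumDeriv φ (q.1, q.2, p₀) (p - p')‖ :=
      hlow q hq p₀ hp₀ _
    have h3 := norm_sub_norm_le (momentumDeriv φ (q.1, q.2, p₀) (p - p'))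
      (φ q.1 q.2 p - φ q.1 q.2 p')
    rw [norm_sub_rev (momentumDeriv φ (q.1, q.2, p₀) (p - p'))] at h3
    have h4 : 3 * L * ρ * ‖p - p'‖ ≤ c / 2 * ‖p - p'‖ := by
      have : 3 * L * ρ ≤ c / 2 := by linarith
      gcongr
    linarith
  · have hA : ∀ v, c / 2 * ‖v‖ ≤ ‖momentumDeriv φ (q.1, q.2, p) v‖ := by
      refine mul_norm_le_of_sphere fun v hv => ?_
      by_contra hcon
      have hmem : ((q, p), v) ∈ S' :=
        ⟨Set.mk_mem_prod (Set.mk_mem_prod hq hp) hv, (not_le.1 hcon).le⟩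
      have h1 := hc₃' ((q, p), v) hmem
      have h2 : ‖φ q.1 q.2 p‖ < c₃ := hlt.trans_le (min_le_left _ _)
      exact absurd h1 (not_le.2 h2)
    have hball : ∀ p₁, ‖p₁ - p‖ ≤ ρ → (q.1, q.2, p₁) ∈ slab d T := by
      intro p₁ h₁
      refine hin q hq p₁ ⟨fun i => ?_, fun i => ?_⟩
      · have h2 := abs_le.1 ((norm_le_pi_norm (p₁ - p) i).trans (h₁.trans hρ1))
        have h3 := hp.1 i
        simp only [Pi.sub_apply, Pi.zero_apply, Pi.neg_apply, Pi.one_apply] at h2 h3 ⊢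
        linarith [h2.1]
      · have h2 := abs_le.1 ((norm_le_pi_norm (p₁ - p) i).trans (h₁.trans hρ1))
        have h3 := hp.2 i
        simp only [Pi.sub_apply, Pi.ofNat_apply] at h2 h3 ⊢
        linarith [h2.2]
    obtain ⟨b', hb', hle⟩ := exists_zero_of_approximates (f := φ q.1 q.2) (c := c / 2) (ρ := ρ)
      (p := p) (by positivity) hρ0 hA (fun p₁ h₁ p₂ h₂ => by
        refine (norm_level_sub_sub_le b (hin q hq p (Icc_zero_one_subset hp)) (hball p₁ h₁)
          (hball p₂ h₂) h₁ h₂).trans ?_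
        have : 3 * L * ρ ≤ c / 2 / 2 := by linarith
        gcongr) (by
        refine (hlt.trans_le (min_le_right _ _)).le.trans_eq ?_
        ring)
    exact ⟨b', hb', hle⟩

variable {K : Set (ℝ × (Fin d → ℝ))} {c r c₀ : ℝ}

lemma LevelGeometry.separated (hg : LevelGeometry φ K c r c₀) {q : ℝ × (Fin d → ℝ)} (hq : q ∈ K)
    {b b' : Fin d → ℝ} (hb : b ∈ branches φ q.1 q.2) (hb' : b' ∈ branches φ q.1 q.2)
    (h : ‖b' - b‖ ≤ r) : b' = b := by
  have h1 := hg.near q hq b hb b' (hg.mem_Icc q hq b' hb') b (hg.mem_Icc q hq b hb) h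
    (by simpa using hg.r_pos.le)
  have e1 : φ q.1 q.2 b' = 0 := hb'
  have e2 : φ q.1 q.2 b = 0 := hb
  rw [e1, e2, sub_zero, norm_zero] at h1
  have h2 : ‖b' - b‖ ≤ 0 := by
    have := hg.c_pos
    by_contra hcon
    have := mul_pos (half_pos this) (not_le.1 hcon)
    linarith
  exact sub_eq_zero.1 (norm_le_zero_iff.1 h2)

/-- The branches are separated, so their number is bounded on `K`. -/
lemma LevelGeometry.exists_card_bound (hg : LevelGeometry φ K c r c₀) :
    ∃ Q : ℕ, ∀ q ∈ K, (branches φ q.1 q.2).Finite ∧ (branches φ q.1 q.2).ncard ≤ Q := by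
  obtain ⟨m, hm⟩ := exists_nat_gt (1 / r)
  have hr := hg.r_pos
  have hm0 : (0 : ℝ) < m := lt_trans (by positivity) hm
  let B : Finset (Fin d → ℕ) := Fintype.piFinset fun _ => Finset.range (m + 1)
  refine ⟨B.card, fun q hq => ?_⟩
  let f : (Fin d → ℝ) → Fin d → ℕ := fun b i => ⌊b i * m⌋₊
  have hmaps : ∀ b ∈ branches φ q.1 q.2, f b ∈ (B : Set (Fin d → ℕ)) := by
    intro b hb
    rw [Finset.mem_coe, Fintype.mem_piFinset]
    intro i
    rw [Finset.mem_range, Nat.lt_succ_iff]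
    refine Nat.floor_le_of_le ?_
    have h1 : b i ≤ 1 := (hg.mem_Icc q hq b hb).2 i
    nlinarith
  have hinj : InjOn f (branches φ q.1 q.2) := by
    intro b hb b' hb' heq
    refine hg.separated hq hb' hb ((pi_norm_le_iff_of_nonneg hr.le).2 fun i => ?_)
    have h1 : ⌊b i * m⌋₊ = ⌊b' i * m⌋₊ := congrFun heq i
    have hn : 0 ≤ b i * m := mul_nonneg ((hg.mem_Icc q hq b hb).1 i) hm0.le
    have hn' : 0 ≤ b' i * m := mul_nonneg ((hg.mem_Icc q hq b' hb').1 i) hm0.le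
    have a1 := Nat.floor_le hn
    have a2 := Nat.lt_floor_add_one (b i * m)
    have a3 := Nat.floor_le hn'
    have a4 := Nat.lt_floor_add_one (b' i * m)
    rw [h1] at a1 a2
    have h2 : |(b i - b' i) * m| < 1 := by
      rw [abs_lt]; constructor <;> linarith
    rw [abs_mul, abs_of_pos hm0, ← lt_div_iff₀ hm0] at h2
    rw [Real.norm_eq_abs, Pi.sub_apply]
    refine h2.le.trans ?_
    rw [div_le_iff₀ hm0, ← div_le_iff₀' hr]
    exact hm.le
  refine ⟨Set.Finite.of_injOn hmaps hinj B.finite_toSet, ?_⟩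
  rw [← Set.ncard_coe_finset B]
  exact Set.ncard_le_ncard_of_injOn f hmaps hinj B.finite_toSet

end Geometry

/-! ### Smoothed delta functions -/

section Mollifier

variable {d : ℕ}

/-- A family `δ ω` of approximate delta functions on `ℝ^d`, `δ ω` being supported in the sup norm
ball of radius `ω`; the constant `V` bounds size and Lipschitz constant. -/
structure IsMollifier (V : ℝ) (δ : ℝ → (Fin d → ℝ) → ℝ) : Prop where
  nonneg : 0 ≤ V
  bound : ∀ ω, 0 < ω → ∀ y, |δ ω y| ≤ V / ω ^ d
  lip : ∀ ω, 0 < ω → ∀ y y', |δ ω y - δ ω y'| ≤ V / ω ^ (d + 1) * ‖y - y'‖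
  support : ∀ ω, 0 < ω → ∀ y, ω < ‖y‖ → δ ω y = 0
  integral : ∀ ω, 0 < ω → ∫ y, δ ω y = 1

/-- The product of one-dimensional smoothed delta functions. -/
noncomputable def deltaProd (β : ℝ → ℝ) (ω : ℝ) (y : Fin d → ℝ) : ℝ :=
  ∏ i, deltaReg β ω (y i)

lemma IsDeltaProfile.deltaReg_eq {β : ℝ → ℝ} (hβ : IsDeltaProfile β) {ω : ℝ} (hω : 0 < ω) (x : ℝ) :
    deltaReg β ω x = 1 / ω * β (x / ω) := by
  unfold deltaReg
  split_ifs with h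
  · rfl
  · rw [hβ.support, mul_zero]
    rw [abs_div, abs_of_pos hω, lt_div_iff₀ hω, one_mul]
    exact not_le.1 h

/-- A product of `n` factors of size at most `B` changes by at most `n B^(n-1) ε` when each factor
changes by at most `ε`; the bound is written with `B ^ n * (ε / B)`. -/
lemma abs_prod_sub_prod_le {ι : Type*} (s : Finset ι) (f g : ι → ℝ) {B ε : ℝ} (hB : 0 < B)
    (hf : ∀ i ∈ s, |f i| ≤ B) (hg : ∀ i ∈ s, |g i| ≤ B) (hfg : ∀ i ∈ s, |f i - g i| ≤ ε) :
    |∏ i ∈ s, f i - ∏ i ∈ s, g i| ≤ s.card * (B ^ s.card * (ε / B)) := by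
  classical
  induction s using Finset.induction_on with
  | empty => simp
  | insert a s ha ih =>
    have ih' := ih (fun i hi => hf i (Finset.mem_insert_of_mem hi))
      (fun i hi => hg i (Finset.mem_insert_of_mem hi))
      (fun i hi => hfg i (Finset.mem_insert_of_mem hi))
    rw [Finset.prod_insert ha, Finset.prod_insert ha, Finset.card_insert_of_notMem ha]
    have h1 : |∏ i ∈ s, g i| ≤ B ^ s.card := by
      rw [Finset.abs_prod, ← Finset.prod_const]
      exact Finset.prod_le_prod (fun i _ => abs_nonneg _)
        fun i hi => hg i (Finset.mem_insert_of_mem hi)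
    have hfa := hf a (Finset.mem_insert_self a s)
    have hfga := hfg a (Finset.mem_insert_self a s)
    have e : f a * ∏ i ∈ s, f i - g a * ∏ i ∈ s, g i
        = f a * (∏ i ∈ s, f i - ∏ i ∈ s, g i) + (f a - g a) * ∏ i ∈ s, g i := by ring
    rw [e]
    refine (abs_add_le _ _).trans ?_
    rw [abs_mul, abs_mul]
    have hε : 0 ≤ ε := (abs_nonneg _).trans hfga
    calc |f a| * |∏ i ∈ s, f i - ∏ i ∈ s, g i| + |f a - g a| * |∏ i ∈ s, g i|
        ≤ B * (s.card * (B ^ s.card * (ε / B))) + ε * B ^ s.card := by gcongr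
      _ = ((s.card + 1 : ℕ) : ℝ) * (B ^ (s.card + 1) * (ε / B)) := by
        push_cast; field_simp; ring

lemma IsDeltaProfile.exists_isMollifier {β : ℝ → ℝ} (hβ : IsDeltaProfile β) (d : ℕ) :
    ∃ V, IsMollifier V (deltaProd β : ℝ → (Fin d → ℝ) → ℝ) := by
  obtain ⟨L, hL⟩ := hβ.lipschitz
  set B : ℝ := 3 * L + 1 with hB
  have hL0 : (0 : ℝ) ≤ L := L.2
  have hB0 : 0 < B := by positivity
  have hbd : ∀ x, |β x| ≤ B := by
    intro x
    by_cases hx : 1 < |x|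
    · rw [hβ.support x hx, abs_zero]; exact hB0.le
    · have h1 := hL.dist_le_mul x 2
      rw [Real.dist_eq, Real.dist_eq, hβ.support 2 (by norm_num), sub_zero] at h1
      have h2 : |x - 2| ≤ 3 := by
        have := abs_le.1 (not_lt.1 hx)
        rw [abs_le]; constructor <;> linarith
      have : (L : ℝ) * |x - 2| ≤ L * 3 := by gcongr
      linarith
  have hregb : ∀ ω, 0 < ω → ∀ x, |deltaReg β ω x| ≤ B / ω := by
    intro ω hω x
    rw [hβ.deltaReg_eq hω, abs_mul, abs_of_pos (by positivity : 0 < 1 / ω), one_div_mul_eq_div]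
    gcongr
    exact hbd _
  have hregl : ∀ ω, 0 < ω → ∀ x x', |deltaReg β ω x - deltaReg β ω x'| ≤ B / ω ^ 2 * |x - x'| := by
    intro ω hω x x'
    rw [hβ.deltaReg_eq hω, hβ.deltaReg_eq hω, ← mul_sub, abs_mul,
      abs_of_pos (by positivity : 0 < 1 / ω)]
    have h1 := hL.dist_le_mul (x / ω) (x' / ω)
    rw [Real.dist_eq, Real.dist_eq, ← sub_div, abs_div, abs_of_pos hω] at h1
    calc 1 / ω * |β (x / ω) - β (x' / ω)| ≤ 1 / ω * (L * (|x - x'| / ω)) := by gcongr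
      _ = L / ω ^ 2 * |x - x'| := by field_simp
      _ ≤ B / ω ^ 2 * |x - x'| := by gcongr; linarith
  have hd1 : (d : ℝ) ≤ d + 1 := by linarith
  refine ⟨(d + 1) * B ^ d, by positivity, fun ω hω y => ?_, fun ω hω y y' => ?_,
    fun ω hω y hy => ?_, fun ω hω => ?_⟩
  · rw [deltaProd, Finset.abs_prod]
    refine (Finset.prod_le_prod (fun i _ => abs_nonneg _) fun i _ => hregb ω hω (y i)).trans ?_
    rw [Finset.prod_const, Finset.card_univ, Fintype.card_fin, div_pow]
    gcongr
    have : 0 ≤ B ^ d := by positivity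
    nlinarith
  · have h1 := abs_prod_sub_prod_le Finset.univ (fun i => deltaReg β ω (y i))
      (fun i => deltaReg β ω (y' i)) (B := B / ω) (ε := B / ω ^ 2 * ‖y - y'‖) (by positivity)
      (fun i _ => hregb ω hω _) (fun i _ => hregb ω hω _) (fun i _ => by
        refine (hregl ω hω _ _).trans ?_
        gcongr
        exact norm_le_pi_norm (y - y') i)
    rw [Finset.card_univ, Fintype.card_fin] at h1
    refine h1.trans ?_
    have e : (d : ℝ) * ((B / ω) ^ d * (B / ω ^ 2 * ‖y - y'‖ / (B / ω)))
        = d * B ^ d / ω ^ (d + 1) * ‖y - y'‖ := by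
      rw [div_pow]; field_simp; ring
    rw [e]
    gcongr
  · obtain ⟨i, hi⟩ : ∃ i, ω < |y i| := by
      by_contra! hcon
      exact absurd ((pi_norm_le_iff_of_nonneg hω.le).2 hcon) (not_le.2 hy)
    refine Finset.prod_eq_zero (Finset.mem_univ i) ?_
    rw [deltaReg, if_neg (not_le.2 hi)]
  · have h1 : ∫ x, deltaReg β ω x = 1 := by
      simp_rw [hβ.deltaReg_eq hω]
      rw [integral_const_mul, Measure.integral_comp_div (fun x => β x), hβ.integral, smul_eq_mul,
        abs_of_pos hω, mul_one, one_div, inv_mul_cancel₀ hω.ne']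
    unfold deltaProd
    rw [integral_fintype_prod_volume_eq_prod (fun _ => deltaReg β ω)]
    simp [h1]

end Mollifier

/-! ### Lattice sums -/

section Lattice

variable {d : ℕ}

/-- The integral of a Lipschitz function of compact support is approximated by its Riemann sum. -/
lemma abs_riemannSum_sub_integral_le {F : (Fin d → ℝ) → ℝ} {N : ℕ} (hN : 1 ≤ N)
    (R : Finset (Fin d → ℤ)) {κ ρ : ℝ} (hκ : 0 ≤ κ) (hρ : 0 ≤ ρ) (b : Fin d → ℝ)
    (hF : ∀ p p', |F p - F p'| ≤ κ * ‖p - p'‖) (hsupp : ∀ p, ρ < ‖p - b‖ → F p = 0)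
    (hR : ∀ l, ‖gridPoint N l - b‖ ≤ ρ + 1 / (N : ℝ) → l ∈ R) :
    |(1 / (N : ℝ)) ^ d * ∑ l ∈ R, F (gridPoint N l) - ∫ p, F p|
      ≤ κ * (1 / (N : ℝ)) * (2 * (ρ + 1 / (N : ℝ))) ^ d := by
  have hN0 : (0 : ℝ) < N := by exact_mod_cast hN
  set h : ℝ := 1 / N with hh
  have hh0 : 0 < h := by positivity
  -- the cube with upper corner `l / N`
  let cube : (Fin d → ℤ) → Set (Fin d → ℝ) := fun l =>
    Set.pi univ fun i => Ioc (((l i : ℝ) - 1) / N) ((l i : ℝ) / N)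
  let idx : (Fin d → ℝ) → Fin d → ℤ := fun p i => ⌈p i * N⌉
  have hcube : ∀ p l, p ∈ cube l ↔ l = idx p := by
    intro p l
    simp only [cube, idx, Set.mem_pi, mem_univ, true_imp_iff, mem_Ioc, funext_iff]
    refine forall_congr' fun i => ?_
    rw [eq_comm, Int.ceil_eq_iff, div_lt_iff₀ hN0, le_div_iff₀ hN0]
  have hmeas : ∀ l, MeasurableSet (cube l) := fun l =>
    MeasurableSet.univ_pi fun i => measurableSet_Ioc
  have hvol : ∀ l, volume (cube l) = ENNReal.ofReal (h ^ d) := by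
    intro l
    rw [Real.volume_pi_Ioc]
    have e : ∀ i, (l i : ℝ) / N - ((l i : ℝ) - 1) / N = h := fun i => by rw [hh]; ring
    simp only [e]
    rw [Finset.prod_const, Finset.card_univ, Fintype.card_fin, ENNReal.ofReal_pow hh0.le]
  have hidx : ∀ p, ‖gridPoint N (idx p) - p‖ ≤ h := by
    intro p
    refine (pi_norm_le_iff_of_nonneg hh0.le).2 fun i => ?_
    have h1 := Int.le_ceil (p i * N)
    have h2 := Int.ceil_lt_add_one (p i * N)
    rw [Pi.sub_apply, Real.norm_eq_abs, gridPoint, abs_le]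
    constructor
    · rw [neg_le_sub_iff_le_add]
      have : p i ≤ (⌈p i * N⌉ : ℝ) / N := by rwa [le_div_iff₀ hN0]
      linarith
    · rw [sub_le_iff_le_add, div_le_iff₀ hN0, hh, add_mul, one_div_mul_cancel hN0.ne']
      linarith
  let S : (Fin d → ℝ) → ℝ := fun p => ∑ l ∈ R, (cube l).indicator (fun _ => F (gridPoint N l)) p
  have hSeq : ∀ p, S p = if idx p ∈ R then F (gridPoint N (idx p)) else 0 := by
    intro p
    have e : ∀ l, (cube l).indicator (fun _ => F (gridPoint N l)) p
        = if l = idx p then F (gridPoint N l) else 0 := by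
      intro l
      by_cases hl : l = idx p
      · rw [if_pos hl, Set.indicator_of_mem ((hcube p l).2 hl)]
      · rw [if_neg hl, Set.indicator_of_notMem fun hp => hl ((hcube p l).1 hp)]
    simp only [S, e]
    rw [Finset.sum_ite_eq' R (idx p) fun l => F (gridPoint N l)]
  have hcubei : ∀ l, Integrable ((cube l).indicator fun _ => F (gridPoint N l)) := by
    intro l
    refine (integrable_indicator_iff (hmeas l)).2 (integrableOn_const ?_)
    rw [hvol]; exact ENNReal.ofReal_ne_top
  have hSi : Integrable S := integrable_finsetSum _ fun l _ => hcubei l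
  have hSint : ∫ p, S p = h ^ d * ∑ l ∈ R, F (gridPoint N l) := by
    simp only [S]
    rw [integral_finsetSum _ fun l _ => hcubei l, Finset.mul_sum]
    refine Finset.sum_congr rfl fun l _ => ?_
    rw [integral_indicator_const _ (hmeas l), Measure.real, hvol,
      ENNReal.toReal_ofReal (by positivity), smul_eq_mul]
  have hFc : Continuous F := by
    refine (LipschitzWith.of_dist_le_mul (K := Real.toNNReal κ) fun p p' => ?_).continuous
    rw [Real.dist_eq, Real.coe_toNNReal _ hκ, dist_eq_norm]
    exact hF p p'
  have hFi : Integrable F := by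
    refine hFc.integrable_of_hasCompactSupport ?_
    refine HasCompactSupport.intro (isCompact_closedBall b ρ) fun p hp => hsupp p ?_
    rwa [Metric.mem_closedBall, dist_eq_norm, not_le] at hp
  rw [← hSint, ← integral_sub hSi hFi]
  set D := Metric.closedBall b (ρ + h) with hD
  have hvolD : volume D = ENNReal.ofReal ((2 * (ρ + h)) ^ d) := by
    rw [hD, Real.volume_pi_closedBall _ (by positivity), Fintype.card_fin]
  have hbound : ∀ p, ‖S p - F p‖ ≤ D.indicator (fun _ => κ * h) p := by
    intro p
    have h1 := hidx p
    have htri : ‖gridPoint N (idx p) - b‖ ≤ ‖gridPoint N (idx p) - p‖ + ‖p - b‖ :=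
      norm_sub_le_norm_sub_add_norm_sub _ _ _
    have htri' : ‖p - b‖ ≤ ‖p - gridPoint N (idx p)‖ + ‖gridPoint N (idx p) - b‖ :=
      norm_sub_le_norm_sub_add_norm_sub _ _ _
    rw [norm_sub_rev p (gridPoint N (idx p))] at htri'
    rw [hSeq, Real.norm_eq_abs]
    by_cases hp : p ∈ D
    · rw [Set.indicator_of_mem hp]
      split_ifs with hi
      · exact (hF _ _).trans (by gcongr)
      · have h2 : ρ + h < ‖gridPoint N (idx p) - b‖ := by
          by_contra hcon
          exact hi (hR _ (not_lt.1 hcon))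
        rw [hsupp p (by linarith), sub_zero, abs_zero]
        positivity
    · rw [Set.indicator_of_notMem hp]
      rw [hD, Metric.mem_closedBall, dist_eq_norm, not_le] at hp
      rw [hsupp p (by linarith), hsupp (gridPoint N (idx p)) (by linarith)]
      simp
  rw [← Real.norm_eq_abs]
  have hDi : Integrable (D.indicator fun _ => κ * h) := by
    refine (integrable_indicator_iff Metric.isClosed_closedBall.measurableSet).2
      (integrableOn_const ?_)
    rw [hvolD]; exact ENNReal.ofReal_ne_top
  refine (norm_integral_le_of_norm_le hDi (Filter.Eventually.of_forall hbound)).trans_eq ?_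
  rw [integral_indicator_const _ Metric.isClosed_closedBall.measurableSet, Measure.real, hvolD,
    ENNReal.toReal_ofReal (by positivity), smul_eq_mul, mul_comm]

lemma integral_comp_affine (g : (Fin d → ℝ) → ℝ) (A : (Fin d → ℝ) →L[ℝ] Fin d → ℝ)
    (hA : A.det ≠ 0) (y p₀ : Fin d → ℝ) :
    ∫ p, g (y + A (p - p₀)) = |A.det|⁻¹ * ∫ z, g z := by
  have h1 : ∫ p, g (y + A (p - p₀)) = ∫ p, g (y + A p) :=
    integral_sub_right_eq_self (fun p => g (y + A p)) p₀
  have h2 : ∫ p, g (y + A p) = |A.det|⁻¹ * ∫ z, g (y + z) := by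
    have hmap := Measure.map_linearMap_addHaar_eq_smul_addHaar (volume : Measure (Fin d → ℝ))
      (f := A.toLinearMap) hA
    have hemb : MeasurableEmbedding A := by
      have hker : LinearMap.ker A.toLinearMap = ⊥ := by
        by_contra hk
        exact hA (LinearMap.det_eq_zero_iff_ker_ne_bot.2 hk)
      exact A.continuous.measurableEmbedding (LinearMap.ker_eq_bot.1 hker)
    have h3 := hemb.integral_map (μ := volume) (fun z => g (y + z))
    have e : Measure.map A volume = Measure.map A.toLinearMap volume := rfl
    rw [← h3, e, hmap, integral_smul_measure, ENNReal.toReal_ofReal (abs_nonneg _), smul_eq_mul,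
      abs_inv]
  rw [h1, h2, integral_add_left_eq_self]

/-- The number of grid points in a cube. -/
lemma card_le_of_norm_sub_le {N : ℕ} (hN : 1 ≤ N) (S : Finset (Fin d → ℤ)) {ρ : ℝ} (hρ : 0 ≤ ρ)
    (b : Fin d → ℝ) (hS : ∀ l ∈ S, ‖gridPoint N l - b‖ ≤ ρ) :
    (S.card : ℝ) ≤ (2 * N * ρ + 1) ^ d := by
  have hN0 : (0 : ℝ) < N := by exact_mod_cast hN
  have hsub : S ⊆ Fintype.piFinset fun i => Finset.Icc ⌈(b i - ρ) * N⌉ ⌊(b i + ρ) * N⌋ := by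
    intro l hl
    rw [Fintype.mem_piFinset]
    intro i
    have h1 := abs_le.1 ((norm_le_pi_norm (gridPoint N l - b) i).trans (hS l hl))
    rw [Pi.sub_apply, gridPoint] at h1
    have h2 : b i - ρ ≤ (l i : ℝ) / N := by linarith [h1.1]
    have h3 : (l i : ℝ) / N ≤ b i + ρ := by linarith [h1.2]
    rw [le_div_iff₀ hN0] at h2
    rw [div_le_iff₀ hN0] at h3
    exact Finset.mem_Icc.2 ⟨Int.ceil_le.2 h2, Int.le_floor.2 h3⟩
  have h1 : (S.card : ℝ) ≤ ((Fintype.piFinset fun i =>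
      Finset.Icc ⌈(b i - ρ) * N⌉ ⌊(b i + ρ) * N⌋).card : ℝ) := by
    exact_mod_cast Finset.card_le_card hsub
  refine h1.trans ?_
  rw [Fintype.card_piFinset, Nat.cast_prod]
  refine (Finset.prod_le_prod (fun i _ => Nat.cast_nonneg _)
    (g := fun _ => 2 * N * ρ + 1) fun i _ => ?_).trans_eq (by simp)
  rw [Int.card_Icc]
  have h2 := Int.le_ceil ((b i - ρ) * N)
  have h3 := Int.floor_le ((b i + ρ) * N)
  have h4 : (((⌊(b i + ρ) * N⌋ + 1 - ⌈(b i - ρ) * N⌉).toNat : ℤ) : ℝ)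
      = max ((⌊(b i + ρ) * N⌋ : ℝ) + 1 - ⌈(b i - ρ) * N⌉) 0 := by
    rw [Int.toNat_eq_max]; push_cast; rfl
  have h5 : ((⌊(b i + ρ) * N⌋ + 1 - ⌈(b i - ρ) * N⌉).toNat : ℝ)
      = max ((⌊(b i + ρ) * N⌋ : ℝ) + 1 - ⌈(b i - ρ) * N⌉) 0 := by
    rw [← h4]; norm_cast
  rw [h5]
  refine max_le ?_ (by positivity)
  linarith

/-- A lattice sum for the Cauchy distribution, bounded by comparison with the arctangent. -/
lemma sum_div_one_add_sq_le {s : ℝ} (hs0 : 0 ≤ s) (hs1 : s ≤ 1) (a : ℝ) (N : ℕ) :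
    ∑ l ∈ Finset.Icc 1 (N : ℤ), s / (1 + (l * s - a) ^ 2) ≤ 3 * Real.pi := by
  have hstep : ∀ x : ℝ, s / (1 + x ^ 2) ≤ 3 * (Real.arctan (x + s) - Real.arctan x) := by
    intro x
    have h1 : 1 / (3 * (1 + x ^ 2)) * (x + s - x) ≤ Real.arctan (x + s) - Real.arctan x := by
      refine (convex_Icc x (x + s)).mul_sub_le_image_sub_of_le_deriv
        Real.continuous_arctan.continuousOn Real.differentiable_arctan.differentiableOn ?_
        x ⟨le_rfl, by linarith⟩ (x + s) ⟨by linarith, le_rfl⟩ (by linarith)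
      intro y hy
      rw [interior_Icc] at hy
      rw [Real.deriv_arctan]
      refine one_div_le_one_div_of_le (by positivity) ?_
      nlinarith [sq_nonneg (y - x), sq_nonneg (x - (y - x)), sq_nonneg (2 * x - y), hy.1, hy.2]
    have e : s / (1 + x ^ 2) = 3 * (1 / (3 * (1 + x ^ 2)) * (x + s - x)) := by field_simp; ring
    rw [e]
    gcongr
  have hsum : ∀ n : ℕ, ∑ l ∈ Finset.Icc 1 (n : ℤ), s / (1 + ((l : ℝ) * s - a) ^ 2)
      ≤ 3 * (Real.arctan (((n : ℝ) + 1) * s - a) - Real.arctan (s - a)) := by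
    intro n
    induction n with
    | zero => simp
    | succ n ih =>
      have e : Finset.Icc 1 ((n + 1 : ℕ) : ℤ) = insert ((n : ℤ) + 1) (Finset.Icc 1 (n : ℤ)) := by
        ext l; simp only [Finset.mem_Icc, Finset.mem_insert]; push_cast; omega
      rw [e, Finset.sum_insert (by simp)]
      have h1 := hstep (((n : ℝ) + 1) * s - a)
      have e1 : ((n : ℝ) + 1) * s - a + s = (((n + 1 : ℕ) : ℝ) + 1) * s - a := by push_cast; ring
      rw [e1] at h1
      push_cast at h1 ⊢
      linarith
  refine (hsum N).trans ?_
  have h1 := Real.arctan_lt_pi_div_two (((N : ℝ) + 1) * s - a)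
  have h2 := Real.neg_pi_div_two_lt_arctan (s - a)
  linarith

/-- The tail `(ω / |p - b|)^(2d)` of a kernel of width `ω` has bounded mass on the grid. -/
lemma sum_tail_le {N : ℕ} (hN : 1 ≤ N) {ω : ℝ} (hω : 1 / (N : ℝ) ≤ ω) (b : Fin d → ℝ)
    (S : Finset (Fin d → ℤ)) (hS : S ⊆ gridIndices d N)
    (hfar : ∀ l ∈ S, ω ≤ ‖gridPoint N l - b‖) :
    (1 / (N : ℝ)) ^ d * ∑ l ∈ S, (ω / ‖gridPoint N l - b‖) ^ (2 * d) / ω ^ d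
      ≤ (6 * Real.pi) ^ d := by
  have hN0 : (0 : ℝ) < N := by exact_mod_cast hN
  have hh0 : 0 < 1 / (N : ℝ) := by positivity
  have hω0 : 0 < ω := hh0.trans_le hω
  set s : ℝ := 1 / (N : ℝ) / ω with hs
  have hs0 : 0 ≤ s := by positivity
  have hs1 : s ≤ 1 := by rw [hs, div_le_one hω0]; exact hω
  have hterm : ∀ l ∈ S, (1 / (N : ℝ)) ^ d * ((ω / ‖gridPoint N l - b‖) ^ (2 * d) / ω ^ d)
      ≤ ∏ i, (2 * (s / (1 + ((l i : ℝ) * s - b i / ω) ^ 2))) := by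
    intro l hl
    set ν := ‖gridPoint N l - b‖ with hν
    have hν0 : 0 < ν := hω0.trans_le (hfar l hl)
    have e : (1 / (N : ℝ)) ^ d * ((ω / ν) ^ (2 * d) / ω ^ d) = ∏ _i : Fin d, s * (ω / ν) ^ 2 := by
      rw [Finset.prod_const, Finset.card_univ, Fintype.card_fin, hs, mul_pow, pow_mul, div_pow _ ω]
      ring
    rw [e]
    refine Finset.prod_le_prod (fun i _ => by positivity) fun i _ => ?_
    have h1 : |(l i : ℝ) * s - b i / ω| ≤ ν / ω := by
      have h2 := norm_le_pi_norm (gridPoint N l - b) i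
      rw [Pi.sub_apply, gridPoint, Real.norm_eq_abs, ← hν] at h2
      have e2 : (l i : ℝ) * s - b i / ω = ((l i : ℝ) / N - b i) / ω := by rw [hs]; ring
      rw [e2, abs_div, abs_of_pos hω0]
      gcongr
    have h3 : ((l i : ℝ) * s - b i / ω) ^ 2 ≤ (ν / ω) ^ 2 := by
      rw [← sq_abs]; gcongr
    have h4 : 1 ≤ (ν / ω) ^ 2 := by
      have : 1 ≤ ν / ω := by rw [le_div_iff₀ hω0, one_mul]; exact hfar l hl
      exact one_le_pow₀ this
    have h5 : (ω / ν) ^ 2 = ((ν / ω) ^ 2)⁻¹ := by rw [← inv_pow, inv_div]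
    rw [h5, mul_div_assoc', ← div_eq_mul_inv, div_le_div_iff₀ (by positivity) (by positivity)]
    nlinarith
  rw [Finset.mul_sum]
  calc ∑ l ∈ S, (1 / (N : ℝ)) ^ d * ((ω / ‖gridPoint N l - b‖) ^ (2 * d) / ω ^ d)
      ≤ ∑ l ∈ S, ∏ i, (2 * (s / (1 + ((l i : ℝ) * s - b i / ω) ^ 2))) := Finset.sum_le_sum hterm
    _ ≤ ∑ l ∈ gridIndices d N, ∏ i, (2 * (s / (1 + ((l i : ℝ) * s - b i / ω) ^ 2))) :=
        Finset.sum_le_sum_of_subset_of_nonneg hS fun l _ _ =>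
          Finset.prod_nonneg fun i _ => by positivity
    _ = ∏ i, ∑ k ∈ Finset.Icc 1 (N : ℤ), 2 * (s / (1 + ((k : ℝ) * s - b i / ω) ^ 2)) := by
        rw [gridIndices, Finset.prod_univ_sum]
    _ ≤ ∏ _i : Fin d, 6 * Real.pi := by
        refine Finset.prod_le_prod (fun i _ => Finset.sum_nonneg fun k _ => by positivity)
          fun i _ => ?_
        rw [← Finset.mul_sum]
        have := sum_div_one_add_sq_le hs0 hs1 (b i / ω) N
        linarith
    _ = (6 * Real.pi) ^ d := by simp

end Lattice

/-! ### Averages over correlated samples -/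

section Mean

variable {Ω : Type*}

/-- A positive linear functional of total mass one on all real functions on `Ω`. -/
structure IsMean (E : (Ω → ℝ) →ₗ[ℝ] ℝ) : Prop where
  mono : ∀ f g, f ≤ g → E f ≤ E g
  const : ∀ r, E (fun _ => r) = r

variable {E : (Ω → ℝ) →ₗ[ℝ] ℝ}

lemma mean_mul (a : ℝ) (f : Ω → ℝ) : E (fun w => a * f w) = a * E f :=
  E.map_smul a f

lemma mean_add (f g : Ω → ℝ) : E (fun w => f w + g w) = E f + E g :=
  E.map_add f g

lemma mean_sum {ι : Type*} (s : Finset ι) (f : ι → Ω → ℝ) :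
    E (fun w => ∑ i ∈ s, f i w) = ∑ i ∈ s, E (f i) := by
  rw [← map_sum]; congr 1; ext w; simp

lemma IsMean.abs_le (hE : IsMean E) {f g : Ω → ℝ} (h : ∀ w, |f w| ≤ g w) : |E f| ≤ E g := by
  rw [_root_.abs_le, ← map_neg]
  exact ⟨hE.mono _ _ fun w => neg_le.1 (_root_.abs_le.1 (h w)).1 |> fun h' => by
    simpa using neg_le.1 h' , hE.mono _ _ fun w => (_root_.abs_le.1 (h w)).2⟩

lemma IsMean.nonneg (hE : IsMean E) {f : Ω → ℝ} (h : ∀ w, 0 ≤ f w) : 0 ≤ E f := by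
  have := hE.mono (fun _ => 0) f h
  rwa [hE.const] at this

lemma IsMean.abs_sub_le (hE : IsMean E) {f g : Ω → ℝ} {a : ℝ} (h : ∀ w, |f w - a| ≤ g w) :
    |E f - a| ≤ E g := by
  have e : E f - a = E (fun w => f w - a) := by
    have := E.map_sub f fun _ => a
    rw [hE.const] at this
    exact this.symm
  rw [e]
  exact hE.abs_le h

end Mean

/-- The constants that control the zeros of a function and the samples of its values: `c`, `r`, `c₀`
quantify nondegeneracy of the zeros, `L` bounds derivatives, `δ` is the distance of the zeros from
the boundary, `κ` controls the loss of samples near a zero, `mom` the fluctuation of the samples,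
and `Q` the number of zeros. -/
structure SampleBounds where
  (c r c₀ L δ κ : ℝ)
  Q : ℕ
  mom : ℕ → ℝ
  c_pos : 0 < c
  r_pos : 0 < r
  c₀_pos : 0 < c₀
  L_nonneg : 0 ≤ L
  δ_pos : 0 < δ
  κ_nonneg : 0 ≤ κ
  mom_nonneg : ∀ m, 0 ≤ mom m

/-- The finite set `Z` consists of nondegenerate zeros `b` of `f` in the unit cube, with derivatives
`A b`, and `f` is small only near `Z`. -/
structure ZeroGeometry {d : ℕ} (k : SampleBounds) (f : (Fin d → ℝ) → Fin d → ℝ)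
    (A : (Fin d → ℝ) → (Fin d → ℝ) →L[ℝ] Fin d → ℝ) (Z : Finset (Fin d → ℝ)) : Prop where
  zero : ∀ b ∈ Z, f b = 0
  card_le : Z.card ≤ k.Q
  inner : ∀ b ∈ Z, ∀ p, ‖p - b‖ < k.δ → ∀ i, p i ∈ Ioo (0 : ℝ) 1
  jacobian : ∀ b ∈ Z, k.c ≤ |(A b).det|
  lower : ∀ b ∈ Z, ∀ v, k.c * ‖v‖ ≤ ‖A b v‖
  upper : ∀ b ∈ Z, ∀ v, ‖A b v‖ ≤ k.L * ‖v‖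
  near : ∀ b ∈ Z, ∀ p ∈ Icc (0 : Fin d → ℝ) 1, ∀ p' ∈ Icc (0 : Fin d → ℝ) 1,
    ‖p - b‖ ≤ k.r → ‖p' - b‖ ≤ k.r → k.c / 2 * ‖p - p'‖ ≤ ‖f p - f p'‖
  far : ∀ p ∈ Icc (0 : Fin d → ℝ) 1, ‖f p‖ < k.c₀ → ∃ b ∈ Z, ‖p - b‖ ≤ k.r
  approx : ∀ b ∈ Z, ∀ p ∈ Icc (0 : Fin d → ℝ) 1, ∀ p' ∈ Icc (0 : Fin d → ℝ) 1, ∀ ρ,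
    ‖p - b‖ ≤ ρ → ‖p' - b‖ ≤ ρ → ‖f p - f p' - A b (p - p')‖ ≤ k.L * ρ * ‖p - p'‖
  separated : ∀ b ∈ Z, ∀ b' ∈ Z, ‖b' - b‖ ≤ k.r → b' = b

/-- The random vectors `Y l` are noisy samples of `f` at the grid points `l / N`; the sample at `l` is
available only on the event `alive l`. Samples at neighbouring points are strongly correlated. -/
structure IsSample {d : ℕ} {Ω : Type*} (k : SampleBounds) (N : ℕ) (E : (Ω → ℝ) →ₗ[ℝ] ℝ)
    (alive : (Fin d → ℤ) → Set Ω) (Y : (Fin d → ℤ) → Ω → Fin d → ℝ)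
    (f : (Fin d → ℝ) → Fin d → ℝ) (Z : Finset (Fin d → ℝ)) : Prop where
  isMean : IsMean E
  moment : ∀ m, ∀ l ∈ gridIndices d N, ∀ i a,
    E ((alive l).indicator fun w => (Y l w i - a) ^ (2 * m + 2))
      ≤ k.mom m * ((f (gridPoint N l) i - a) ^ (2 * m + 2) + (1 / (N : ℝ)) ^ (m + 1))
  pair : ∀ m, ∀ l ∈ gridIndices d N, ∀ l' ∈ gridIndices d N, ∀ i,
    E ((alive l ∩ alive l').indicator fun w =>
        (Y l w i - Y l' w i - (f (gridPoint N l) i - f (gridPoint N l') i)) ^ (2 * m + 2))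
      ≤ k.mom m * (1 / (N : ℝ) * (‖gridPoint N l - gridPoint N l'‖ + 1 / (N : ℝ))) ^ (m + 1)
  exit : ∀ b ∈ Z, ∀ l ∈ gridIndices d N,
    E ((alive l)ᶜ.indicator fun _ => 1) ≤ k.κ * (‖gridPoint N l - b‖ ^ 2 + 1 / (N : ℝ))

section Samples

variable {d : ℕ} {Ω : Type*} {k : SampleBounds} {N : ℕ} {E : (Ω → ℝ) →ₗ[ℝ] ℝ}
  {alive : (Fin d → ℤ) → Set Ω} {Y : (Fin d → ℤ) → Ω → Fin d → ℝ}
  {f : (Fin d → ℝ) → Fin d → ℝ} {A : (Fin d → ℝ) → (Fin d → ℝ) →L[ℝ] Fin d → ℝ}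
  {Z : Finset (Fin d → ℝ)} {V : ℝ} {δ : ℝ → (Fin d → ℝ) → ℝ} {ω : ℝ} {l : Fin d → ℤ}

lemma exists_le_abs_apply {y : Fin d → ℝ} {a : ℝ} (ha : 0 < a) (h : a ≤ ‖y‖) : ∃ i, a ≤ |y i| := by
  by_contra! hcon
  exact absurd ((pi_norm_lt_iff ha).2 hcon) (not_lt.2 h)

/-- Where `f` is large compared to `ω`, samples of size `ω` are rare. -/
lemma IsSample.tail_le (s : IsSample k N E alive Y f Z) (hδ : IsMollifier V δ) (hω : 0 < ω)
    (hl : l ∈ gridIndices d N) (hf : 2 * ω ≤ ‖f (gridPoint N l)‖) (m : ℕ) :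
    E ((alive l).indicator fun w => |δ ω (Y l w)|)
      ≤ V * d * k.mom m * (1 / (N : ℝ)) ^ (m + 1) / ω ^ d
        * (2 / ‖f (gridPoint N l)‖) ^ (2 * m + 2) := by
  set ν := ‖f (gridPoint N l)‖ with hν
  have hν0 : 0 < ν := by linarith
  have hV := hδ.nonneg
  have hpt : ∀ w, (alive l).indicator (fun w => |δ ω (Y l w)|) w
      ≤ V / ω ^ d * (2 / ν) ^ (2 * m + 2) * ∑ i, (alive l).indicator
        (fun w => (Y l w i - f (gridPoint N l) i) ^ (2 * m + 2)) w := by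
    intro w
    have hev : ∀ x : ℝ, 0 ≤ x ^ (2 * m + 2) := fun x =>
      Even.pow_nonneg ⟨m + 1, by ring⟩ x
    by_cases hw : w ∈ alive l
    · simp only [Set.indicator_of_mem hw]
      rcases lt_or_ge ω ‖Y l w‖ with hY | hY
      · rw [hδ.support ω hω _ hY, abs_zero]
        have := Finset.sum_nonneg fun i (_ : i ∈ Finset.univ) =>
          hev (Y l w i - f (gridPoint N l) i)
        positivity
      · have h1 : ν / 2 ≤ ‖Y l w - f (gridPoint N l)‖ := by
          have := norm_sub_norm_le (f (gridPoint N l)) (Y l w)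
          rw [norm_sub_rev] at this
          linarith
        obtain ⟨i, hi⟩ := exists_le_abs_apply (by linarith) h1
        have h2 : 1 ≤ (2 / ν) ^ (2 * m + 2) * (Y l w i - f (gridPoint N l) i) ^ (2 * m + 2) := by
          rw [← Even.pow_abs ⟨m + 1, by ring⟩ (Y l w i - f (gridPoint N l) i), ← mul_pow]
          refine one_le_pow₀ ?_
          rw [Pi.sub_apply] at hi
          calc (1 : ℝ) = 2 / ν * (ν / 2) := by field_simp
            _ ≤ _ := by gcongr
        calc |δ ω (Y l w)| ≤ V / ω ^ d * 1 := by rw [mul_one]; exact hδ.bound ω hω _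
          _ ≤ V / ω ^ d * ((2 / ν) ^ (2 * m + 2)
              * (Y l w i - f (gridPoint N l) i) ^ (2 * m + 2)) := by gcongr
          _ ≤ V / ω ^ d * ((2 / ν) ^ (2 * m + 2)
              * ∑ i, (Y l w i - f (gridPoint N l) i) ^ (2 * m + 2)) := by
            gcongr
            exact Finset.single_le_sum (fun i _ => hev (Y l w i - f (gridPoint N l) i))
              (Finset.mem_univ i)
          _ = _ := by ring
    · simp [Set.indicator_of_notMem hw]
  refine (s.isMean.mono _ _ hpt).trans ?_
  rw [mean_mul, mean_sum]
  have h1 : ∑ i, E ((alive l).indicator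
      fun w => (Y l w i - f (gridPoint N l) i) ^ (2 * m + 2))
      ≤ ∑ _i : Fin d, k.mom m * (1 / (N : ℝ)) ^ (m + 1) := by
    refine Finset.sum_le_sum fun i _ => ?_
    have := s.moment m l hl i (f (gridPoint N l) i)
    rwa [sub_self, zero_pow (by omega), zero_add] at this
  rw [Finset.sum_const, Finset.card_univ, Fintype.card_fin, nsmul_eq_mul] at h1
  calc _ ≤ V / ω ^ d * (2 / ν) ^ (2 * m + 2) * (d * (k.mom m * (1 / (N : ℝ)) ^ (m + 1))) := by
        gcongr
    _ = _ := by ring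

lemma mem_gridIndices_of_mem_Ioo (hN : 1 ≤ N) (h : ∀ i, gridPoint N l i ∈ Ioo (0 : ℝ) 1) :
    l ∈ gridIndices d N := by
  have hN0 : (0 : ℝ) < N := by exact_mod_cast hN
  rw [gridIndices, Fintype.mem_piFinset]
  intro i
  obtain ⟨h1, h2⟩ := h i
  rw [gridPoint] at h1 h2
  rw [div_pos_iff_of_pos_right hN0] at h1
  rw [div_lt_one hN0] at h2
  have h1' : 0 < l i := by exact_mod_cast h1
  have h2' : l i < N := by exact_mod_cast h2
  exact Finset.mem_Icc.2 ⟨by omega, by omega⟩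

lemma card_gridIndices (d N : ℕ) : (gridIndices d N).card = N ^ d := by
  simp [gridIndices, Fintype.card_piFinset]

lemma one_div_pow_mul_card (hN : 1 ≤ N) (d : ℕ) :
    (1 / (N : ℝ)) ^ d * ((gridIndices d N).card : ℝ) = 1 := by
  have hN0 : (0 : ℝ) < N := by exact_mod_cast hN
  rw [card_gridIndices]
  push_cast
  rw [← mul_pow, one_div_mul_cancel hN0.ne', one_pow]

lemma ZeroGeometry.mem_Icc (g : ZeroGeometry k f A Z) {b : Fin d → ℝ} (hb : b ∈ Z) :
    b ∈ Icc (0 : Fin d → ℝ) 1 := by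
  have := g.inner b hb b (by simpa using k.δ_pos)
  exact ⟨fun i => (this i).1.le, fun i => (this i).2.le⟩

/-- The samples taken at points where `f` is not small contribute little. -/
lemma IsSample.sum_tail_le (s : IsSample k N E alive Y f Z) (hN : 1 ≤ N) (hδ : IsMollifier V δ)
    (hω : 1 / (N : ℝ) ≤ ω) (hω1 : ω ≤ 1) (hω0 : 2 * ω ≤ k.c₀) (S : Finset (Fin d → ℤ))
    (hS : S ⊆ gridIndices d N) (hf : ∀ l ∈ S, k.c₀ ≤ ‖f (gridPoint N l)‖) :
    (1 / (N : ℝ)) ^ d * ∑ l ∈ S, E ((alive l).indicator fun w => |δ ω (Y l w)|)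
      ≤ V * d * k.mom d * (2 / k.c₀) ^ (2 * d + 2) * (1 / (N : ℝ) / ω ^ 2) := by
  have hN0 : (0 : ℝ) < N := by exact_mod_cast hN
  have hh0 : 0 < 1 / (N : ℝ) := by positivity
  have hω' : 0 < ω := hh0.trans_le hω
  have hV := hδ.nonneg
  have hc := k.c₀_pos
  have hm := k.mom_nonneg d
  have h1 : ∀ l ∈ S, E ((alive l).indicator fun w => |δ ω (Y l w)|)
      ≤ V * d * k.mom d * (2 / k.c₀) ^ (2 * d + 2) * (1 / (N : ℝ) / ω ^ 2) := by
    intro l hl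
    refine (s.tail_le hδ hω' (hS hl) (hω0.trans (hf l hl)) d).trans ?_
    have h2 : (2 / ‖f (gridPoint N l)‖) ^ (2 * d + 2) ≤ (2 / k.c₀) ^ (2 * d + 2) := by
      have := hf l hl
      gcongr
    have h3 : (1 / (N : ℝ)) ^ (d + 1) / ω ^ d ≤ 1 / (N : ℝ) / ω ^ 2 := by
      calc (1 / (N : ℝ)) ^ (d + 1) / ω ^ d = (1 / (N : ℝ) / ω) ^ d * (1 / (N : ℝ)) := by
            rw [div_pow, pow_succ]; ring
        _ ≤ 1 * (1 / (N : ℝ) / ω ^ 2) := by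
            have h4 : (1 / (N : ℝ) / ω) ^ d ≤ 1 :=
              pow_le_one₀ (by positivity) (by rwa [div_le_one hω'])
            have h5 : 1 / (N : ℝ) ≤ 1 / (N : ℝ) / ω ^ 2 := by
              rw [le_div_iff₀ (by positivity)]
              have : ω ^ 2 ≤ 1 := pow_le_one₀ hω'.le hω1
              nlinarith
            exact mul_le_mul h4 h5 hh0.le zero_le_one
        _ = _ := one_mul _
    calc _ = V * d * k.mom d * ((1 / (N : ℝ)) ^ (d + 1) / ω ^ d)
          * (2 / ‖f (gridPoint N l)‖) ^ (2 * d + 2) := by ring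
      _ ≤ V * d * k.mom d * (1 / (N : ℝ) / ω ^ 2) * (2 / k.c₀) ^ (2 * d + 2) := by gcongr
      _ = _ := by ring
  have h4 := Finset.sum_le_sum h1
  rw [Finset.sum_const, nsmul_eq_mul] at h4
  have h5 : (1 / (N : ℝ)) ^ d * (S.card : ℝ) ≤ 1 := by
    refine le_of_le_of_eq ?_ (one_div_pow_mul_card hN d)
    gcongr
  calc _ ≤ (1 / (N : ℝ)) ^ d * (S.card * (V * d * k.mom d * (2 / k.c₀) ^ (2 * d + 2)
        * (1 / (N : ℝ) / ω ^ 2))) := by gcongr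
    _ = (1 / (N : ℝ)) ^ d * (S.card : ℝ) * (V * d * k.mom d * (2 / k.c₀) ^ (2 * d + 2)
        * (1 / (N : ℝ) / ω ^ 2)) := by ring
    _ ≤ 1 * (V * d * k.mom d * (2 / k.c₀) ^ (2 * d + 2) * (1 / (N : ℝ) / ω ^ 2)) := by gcongr
    _ = _ := one_mul _

/-- The samples taken at points near a zero of `f`, but not within a multiple of `ω`, contribute
little. -/
lemma IsSample.sum_annulus_le (s : IsSample k N E alive Y f Z) (g : ZeroGeometry k f A Z)
    (hN : 1 ≤ N) (hδ : IsMollifier V δ) (hω : 1 / (N : ℝ) ≤ ω) (hh : 1 / (N : ℝ) ≤ ω ^ 2)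
    {b : Fin d → ℝ} (hb : b ∈ Z) {R : ℝ} (hR1 : 1 ≤ R) (hR : 4 ≤ k.c * R) (S : Finset (Fin d → ℤ))
    (hS : S ⊆ gridIndices d N) (hr : ∀ l ∈ S, ‖gridPoint N l - b‖ ≤ k.r)
    (hfar : ∀ l ∈ S, R * ω ≤ ‖gridPoint N l - b‖) :
    (1 / (N : ℝ)) ^ d * ∑ l ∈ S, E ((alive l).indicator fun w => |δ ω (Y l w)|)
      ≤ V * d * k.mom d * (4 / k.c) ^ (2 * d + 2) * (6 * Real.pi) ^ d * (1 / (N : ℝ) / ω ^ 2) := by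
  have hN0 : (0 : ℝ) < N := by exact_mod_cast hN
  have hh0 : 0 < 1 / (N : ℝ) := by positivity
  have hω' : 0 < ω := hh0.trans_le hω
  have hV := hδ.nonneg
  have hc := k.c_pos
  have hm := k.mom_nonneg d
  have hfar' : ∀ l ∈ S, ω ≤ ‖gridPoint N l - b‖ := fun l hl =>
    le_trans (by nlinarith) (hfar l hl)
  set q := 1 / (N : ℝ) / ω ^ 2 with hq
  have hq0 : 0 ≤ q := by positivity
  have hq1 : q ≤ 1 := by rw [hq, div_le_one (by positivity)]; exact hh
  have h1 : ∀ l ∈ S, E ((alive l).indicator fun w => |δ ω (Y l w)|)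
      ≤ V * d * k.mom d * (4 / k.c) ^ (2 * d + 2) * q
        * ((ω / ‖gridPoint N l - b‖) ^ (2 * d) / ω ^ d) := by
    intro l hl
    have hg := gridPoint_mem_Icc hN (hS hl)
    have hn := g.near b hb _ hg b (g.mem_Icc hb) (hr l hl) (by simpa using k.r_pos.le)
    rw [g.zero b hb, sub_zero] at hn
    set ν := ‖gridPoint N l - b‖ with hν
    have hν0 : 0 < ν := hω'.trans_le (hfar' l hl)
    have h2 : 2 * ω ≤ ‖f (gridPoint N l)‖ := by
      refine le_trans ?_ hn
      have h3 := hfar l hl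
      calc 2 * ω = 4 * ω / 2 := by ring
        _ ≤ k.c * R * ω / 2 := by gcongr
        _ = k.c / 2 * (R * ω) := by ring
        _ ≤ _ := by gcongr
    refine (s.tail_le hδ hω' (hS hl) h2 d).trans ?_
    have h4 : (2 / ‖f (gridPoint N l)‖) ^ (2 * d + 2)
        ≤ (4 / k.c) ^ (2 * d + 2) * (1 / ω ^ (2 * d + 2) * (ω / ν) ^ (2 * d)) := by
      calc (2 / ‖f (gridPoint N l)‖) ^ (2 * d + 2) ≤ (2 / (k.c / 2 * ν)) ^ (2 * d + 2) := by gcongr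
        _ = (4 / k.c) ^ (2 * d + 2) * (1 / ω ^ (2 * d + 2) * (ω / ν) ^ (2 * d + 2)) := by
            have e : 2 / (k.c / 2 * ν) = 4 / k.c * (1 / ω * (ω / ν)) := by
              field_simp; norm_num
            rw [e, mul_pow, mul_pow, one_div_pow]
        _ ≤ _ := by
            gcongr ?_ * (?_ * ?_)
            refine pow_le_pow_of_le_one (by positivity) ?_ (by omega)
            rw [div_le_one hν0]; exact hfar' l hl
    have h5 : (1 / (N : ℝ)) ^ (d + 1) / ω ^ (2 * d + 2) ≤ q := by
      calc (1 / (N : ℝ)) ^ (d + 1) / ω ^ (2 * d + 2) = q ^ (d + 1) := by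
            rw [hq, div_pow _ (ω ^ 2), ← pow_mul]; congr 2
        _ ≤ q ^ 1 := pow_le_pow_of_le_one hq0 hq1 (by omega)
        _ = q := pow_one q
    calc _ ≤ V * d * k.mom d * (1 / (N : ℝ)) ^ (d + 1) / ω ^ d
          * ((4 / k.c) ^ (2 * d + 2) * (1 / ω ^ (2 * d + 2) * (ω / ν) ^ (2 * d))) := by gcongr
      _ = V * d * k.mom d * (4 / k.c) ^ (2 * d + 2)
          * ((1 / (N : ℝ)) ^ (d + 1) / ω ^ (2 * d + 2)) * ((ω / ν) ^ (2 * d) / ω ^ d) := by ring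
      _ ≤ _ := by gcongr
  have h6 := Finset.sum_le_sum h1
  rw [← Finset.mul_sum] at h6
  have h7 := _root_.sum_tail_le hN hω b S hS hfar'
  calc _ ≤ (1 / (N : ℝ)) ^ d * (V * d * k.mom d * (4 / k.c) ^ (2 * d + 2) * q
        * ∑ l ∈ S, (ω / ‖gridPoint N l - b‖) ^ (2 * d) / ω ^ d) := by gcongr
    _ = V * d * k.mom d * (4 / k.c) ^ (2 * d + 2) * q * ((1 / (N : ℝ)) ^ d
        * ∑ l ∈ S, (ω / ‖gridPoint N l - b‖) ^ (2 * d) / ω ^ d) := by ring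
    _ ≤ V * d * k.mom d * (4 / k.c) ^ (2 * d + 2) * q * (6 * Real.pi) ^ d := by gcongr
    _ = _ := by ring

end Samples

/-! ### Samples near a zero -/

section NearZero

variable {d : ℕ} {Ω : Type*} {k : SampleBounds} {N : ℕ} {E : (Ω → ℝ) →ₗ[ℝ] ℝ}
  {alive : (Fin d → ℤ) → Set Ω} {Y : (Fin d → ℤ) → Ω → Fin d → ℝ}
  {f : (Fin d → ℝ) → Fin d → ℝ} {A : (Fin d → ℝ) → (Fin d → ℝ) →L[ℝ] Fin d → ℝ}
  {Z : Finset (Fin d → ℝ)} {V : ℝ} {δ : ℝ → (Fin d → ℝ) → ℝ} {ω R : ℝ} {l l₀ : Fin d → ℤ}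
  {b : Fin d → ℝ}

lemma norm_le_sum_abs (y : Fin d → ℝ) : ‖y‖ ≤ ∑ i, |y i| :=
  (pi_norm_le_iff_of_nonneg (Finset.sum_nonneg fun _ _ => abs_nonneg _)).2 fun i =>
    Finset.single_le_sum (f := fun i => |y i|) (fun _ _ => abs_nonneg _) (Finset.mem_univ i)

/-- Near a zero `b` of `f` the samples `Y l` may be replaced by the linearisation at a single sample
`Y l₀`: the fluctuations of the two samples are nearly the same. -/
lemma IsSample.linearise_le (s : IsSample k N E alive Y f Z) (g : ZeroGeometry k f A Z)
    (hN : 1 ≤ N) (hδ : IsMollifier V δ) (hω : 1 / (N : ℝ) ≤ ω) (hω1 : ω ≤ 1)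
    (hh : 1 / (N : ℝ) ≤ ω ^ 2) (hb : b ∈ Z) (hR1 : 1 ≤ R)
    (hl : l ∈ gridIndices d N) (hl₀ : l₀ ∈ gridIndices d N)
    (hlb : ‖gridPoint N l - b‖ ≤ R * ω) (hl₀b : ‖gridPoint N l₀ - b‖ ≤ R * ω) :
    E (fun w => |(alive l).indicator (fun w => δ ω (Y l w)) w
        - δ ω (Y l₀ w + A b (gridPoint N l - gridPoint N l₀))|)
      ≤ V / ω ^ d * ((d + 2 * k.L * R ^ 2 + d * k.mom 0 * (2 * R + 1) + 4 * k.κ * (R ^ 2 + 1))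
        * (ω + 1 / (N : ℝ) / ω ^ 2)) := by
  have hN0 : (0 : ℝ) < N := by exact_mod_cast hN
  set h : ℝ := 1 / (N : ℝ) with hhdef
  have hh0 : 0 < h := by positivity
  have hω' : 0 < ω := hh0.trans_le hω
  have hV := hδ.nonneg
  have hL := k.L_nonneg
  have hκ := k.κ_nonneg
  have hm := k.mom_nonneg 0
  set p := gridPoint N l with hp
  set p₀ := gridPoint N l₀ with hp₀
  have hpp : ‖p - p₀‖ ≤ 2 * R * ω := by
    have := norm_sub_le_norm_sub_add_norm_sub p b p₀
    rw [norm_sub_rev b p₀] at this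
    linarith
  set dev : Fin d → Ω → ℝ := fun i => (alive l ∩ alive l₀).indicator fun w =>
    (Y l w i - Y l₀ w i - (f p i - f p₀ i)) ^ (2 * 0 + 2) with hdev
  have hdev0 : ∀ i w, 0 ≤ dev i w := fun i w => Set.indicator_nonneg
    (fun w _ => Even.pow_nonneg (by decide) _) w
  set lost : (Fin d → ℤ) → Ω → ℝ := fun l => (alive l)ᶜ.indicator fun _ => 1 with hlost
  have hlost0 : ∀ l w, 0 ≤ lost l w := fun l w => Set.indicator_nonneg (fun w _ => zero_le_one) w
  have hpt : ∀ w, |(alive l).indicator (fun w => δ ω (Y l w)) w - δ ω (Y l₀ w + A b (p - p₀))|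
      ≤ V / ω ^ d * ((d + 2 * k.L * R ^ 2) * ω + (1 / ω ^ 3 * ∑ i, dev i w
        + 2 * (lost l w + lost l₀ w))) := by
    intro w
    by_cases hw : w ∈ alive l ∩ alive l₀
    · rw [Set.indicator_of_mem hw.1]
      refine (hδ.lip ω hω' _ _).trans ?_
      have h1 : ‖Y l w - (Y l₀ w + A b (p - p₀))‖
          ≤ ∑ i, |(Y l w - Y l₀ w - (f p - f p₀)) i| + k.L * (R * ω) * (2 * R * ω) := by
        have e : Y l w - (Y l₀ w + A b (p - p₀))
            = (Y l w - Y l₀ w - (f p - f p₀)) + (f p - f p₀ - A b (p - p₀)) := by abel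
        rw [e]
        refine (norm_add_le _ _).trans (add_le_add (norm_le_sum_abs _) ?_)
        refine (g.approx b hb p (gridPoint_mem_Icc hN hl) p₀
          (gridPoint_mem_Icc hN hl₀) (R * ω) hlb hl₀b).trans ?_
        gcongr
      have h2 : ∑ i, |(Y l w - Y l₀ w - (f p - f p₀)) i| ≤ ∑ i, (dev i w / ω ^ 2 + ω ^ 2) := by
        refine Finset.sum_le_sum fun i _ => ?_
        simp only [hdev, Set.indicator_of_mem hw, Pi.sub_apply]
        set a := Y l w i - Y l₀ w i - (f p i - f p₀ i)
        -- Young's inequality with weight `ω ^ 2`, the size of the linearisation error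
        have e : a ^ (2 * 0 + 2) / ω ^ 2 = (|a| / ω) ^ 2 := by rw [div_pow, sq_abs]
        have e2 : |a| = |a| / ω * ω := by field_simp
        rw [e]
        nlinarith [sq_nonneg (|a| / ω - ω), sq_nonneg (|a| / ω), sq_nonneg ω]
      rw [Finset.sum_add_distrib, Finset.sum_const, Finset.card_univ, Fintype.card_fin,
        nsmul_eq_mul, ← Finset.sum_div] at h2
      have h3 : 0 ≤ 2 * (lost l w + lost l₀ w) := by
        have := hlost0 l w; have := hlost0 l₀ w; positivity
      calc V / ω ^ (d + 1) * ‖Y l w - (Y l₀ w + A b (p - p₀))‖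
          ≤ V / ω ^ (d + 1) * ((∑ i, dev i w) / ω ^ 2 + d * ω ^ 2
            + k.L * (R * ω) * (2 * R * ω)) := by gcongr; linarith
        _ = V / ω ^ d * ((d + 2 * k.L * R ^ 2) * ω + (1 / ω ^ 3 * ∑ i, dev i w + 0)) := by
            field_simp; ring
        _ ≤ _ := by gcongr
    · have h1 : |(alive l).indicator (fun w => δ ω (Y l w)) w| ≤ V / ω ^ d := by
        by_cases h : w ∈ alive l
        · rw [Set.indicator_of_mem h]; exact hδ.bound ω hω' _
        · rw [Set.indicator_of_notMem h, abs_zero]; positivity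
      have h2 := hδ.bound ω hω' (Y l₀ w + A b (p - p₀))
      have h3 : 1 ≤ lost l w + lost l₀ w := by
        by_cases h : w ∈ alive l
        · have h' : w ∈ (alive l₀)ᶜ := fun h' => hw ⟨h, h'⟩
          have e : lost l₀ w = 1 := Set.indicator_of_mem h' _
          linarith [hlost0 l w]
        · have e : lost l w = 1 := Set.indicator_of_mem (s := (alive l)ᶜ) h _
          linarith [hlost0 l₀ w]
      have h4 := Finset.sum_nonneg fun i (_ : i ∈ Finset.univ) => hdev0 i w
      calc _ ≤ |(alive l).indicator (fun w => δ ω (Y l w)) w|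
            + |δ ω (Y l₀ w + A b (p - p₀))| := abs_sub _ _
        _ ≤ V / ω ^ d * (0 + (0 + 2 * 1)) := by linarith
        _ ≤ _ := by gcongr <;> positivity
  refine (s.isMean.mono _ _ hpt).trans ?_
  have hE : E (fun w => V / ω ^ d * ((d + 2 * k.L * R ^ 2) * ω + (1 / ω ^ 3 * ∑ i, dev i w
        + 2 * (lost l w + lost l₀ w))))
      = V / ω ^ d * ((d + 2 * k.L * R ^ 2) * ω + (1 / ω ^ 3 * ∑ i, E (dev i)
        + 2 * (E (lost l) + E (lost l₀)))) := by
    rw [mean_mul, mean_add, s.isMean.const, mean_add, mean_mul, mean_sum, mean_mul, mean_add]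
  rw [hE]
  have h1 : ∑ i, E (dev i) ≤ ∑ _i : Fin d, k.mom 0 * (h * ((2 * R + 1) * ω)) := by
    refine Finset.sum_le_sum fun i _ => ?_
    refine (s.pair 0 l hl l₀ hl₀ i).trans ?_
    rw [zero_add, pow_one]
    gcongr
    calc ‖p - p₀‖ + h ≤ 2 * R * ω + ω := by linarith
      _ = _ := by ring
  rw [Finset.sum_const, Finset.card_univ, Fintype.card_fin, nsmul_eq_mul] at h1
  have h2 : ∀ l', l' ∈ gridIndices d N → ‖gridPoint N l' - b‖ ≤ R * ω →
      E (lost l') ≤ k.κ * ((R ^ 2 + 1) * ω) := by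
    intro l' hl' hlb'
    refine (s.exit b hb l' hl').trans ?_
    gcongr
    have h3 : ‖gridPoint N l' - b‖ ^ 2 ≤ (R * ω) ^ 2 := by gcongr
    have h4 : ω ^ 2 ≤ ω := by nlinarith
    nlinarith [sq_nonneg R]
  have h3 := h2 l hl hlb
  have h4 := h2 l₀ hl₀ hl₀b
  have hq : 0 ≤ h / ω ^ 2 := by positivity
  calc _ ≤ V / ω ^ d * ((d + 2 * k.L * R ^ 2) * ω
        + (1 / ω ^ 3 * (d * (k.mom 0 * (h * ((2 * R + 1) * ω))))
        + 2 * (k.κ * ((R ^ 2 + 1) * ω) + k.κ * ((R ^ 2 + 1) * ω)))) := by gcongr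
    _ = V / ω ^ d * ((d + 2 * k.L * R ^ 2 + 4 * k.κ * (R ^ 2 + 1)) * ω
        + d * k.mom 0 * (2 * R + 1) * (h / ω ^ 2)) := by
        field_simp; ring
    _ ≤ V / ω ^ d * ((d + 2 * k.L * R ^ 2 + d * k.mom 0 * (2 * R + 1) + 4 * k.κ * (R ^ 2 + 1)) * ω
        + (d + 2 * k.L * R ^ 2 + d * k.mom 0 * (2 * R + 1) + 4 * k.κ * (R ^ 2 + 1))
          * (h / ω ^ 2)) := by
        have e1 : 0 ≤ d * k.mom 0 * (2 * R + 1) := by positivity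
        have e2 : 0 ≤ d + 2 * k.L * R ^ 2 + 4 * k.κ * (R ^ 2 + 1) := by positivity
        refine mul_le_mul_of_nonneg_left (add_le_add ?_ ?_) (by positivity)
        · exact mul_le_mul_of_nonneg_right (by linarith) hω'.le
        · exact mul_le_mul_of_nonneg_right (by linarith) hq
    _ = _ := by ring

/-- The total mass of kernels of size `V / ω ^ d` over the grid points within `R ω` of `b`. -/
lemma mass_le (hN : 1 ≤ N) (hV : 0 ≤ V) (hω : 1 / (N : ℝ) ≤ ω) (hR : 0 ≤ R)
    (S : Finset (Fin d → ℤ)) (hS : ∀ l ∈ S, ‖gridPoint N l - b‖ ≤ R * ω) :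
    (1 / (N : ℝ)) ^ d * (S.card * (V / ω ^ d)) ≤ V * (2 * R + 1) ^ d := by
  have hN0 : (0 : ℝ) < N := by exact_mod_cast hN
  have hh0 : 0 < 1 / (N : ℝ) := by positivity
  have hω' : 0 < ω := hh0.trans_le hω
  have h1 := card_le_of_norm_sub_le hN S (by positivity) b hS
  calc (1 / (N : ℝ)) ^ d * (S.card * (V / ω ^ d))
      ≤ (1 / (N : ℝ)) ^ d * ((2 * N * (R * ω) + 1) ^ d * (V / ω ^ d)) := by gcongr
    _ = ((2 * R * ω + 1 / N) ^ d) * (V / ω ^ d) := by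
        rw [← mul_assoc, ← mul_pow]; congr 2; field_simp
    _ ≤ ((2 * R + 1) * ω) ^ d * (V / ω ^ d) := by
        gcongr; linarith
    _ = V * (2 * R + 1) ^ d := by rw [mul_pow]; field_simp

/-- The Riemann sum of a smoothed delta function of an affine map. -/
lemma ZeroGeometry.riemann_le (g : ZeroGeometry k f A Z) (hN : 1 ≤ N) (hδ : IsMollifier V δ)
    (hω : 1 / (N : ℝ) ≤ ω) (hh : 1 / (N : ℝ) ≤ ω ^ 2) (hb : b ∈ Z)
    (hR : 2 / k.c + 2 ≤ R) (hl₀b : ‖gridPoint N l₀ - b‖ ≤ 1 / (N : ℝ)) (S : Finset (Fin d → ℤ))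
    (hSg : S ⊆ gridIndices d N) (hS : ∀ l, l ∈ S ↔ ‖gridPoint N l - b‖ ≤ R * ω)
    {G : (Fin d → ℝ) → ℝ} {a : ℝ} (hG : ∀ p ∈ Icc (0 : Fin d → ℝ) 1, |G p| ≤ a)
    (hG' : ∀ p ∈ Icc (0 : Fin d → ℝ) 1, ∀ p' ∈ Icc (0 : Fin d → ℝ) 1,
      |G p - G p'| ≤ a * ‖p - p'‖) {y : Fin d → ℝ} (hy : ‖y‖ ≤ ω) :
    |(1 / (N : ℝ)) ^ d * ∑ l ∈ S, G (gridPoint N l)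
        * δ ω (y + A b (gridPoint N l - gridPoint N l₀)) - (G b / |(A b).det|)|
      ≤ (a * R * (V * (2 * R + 1) ^ d) + a * (V * k.L * (2 * R) ^ d)) * ω := by
  have hN0 : (0 : ℝ) < N := by exact_mod_cast hN
  set h : ℝ := 1 / (N : ℝ) with hhdef
  have hh0 : 0 < h := by positivity
  have hω' : 0 < ω := hh0.trans_le hω
  have hV := hδ.nonneg
  have hL := k.L_nonneg
  have hc := k.c_pos
  have hR0 : 0 ≤ R := le_trans (by positivity) hR
  have hb01 := g.mem_Icc hb
  have ha : 0 ≤ a := (abs_nonneg _).trans (hG b hb01)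
  set p₀ := gridPoint N l₀ with hp₀
  set F : (Fin d → ℝ) → ℝ := fun p => δ ω (y + A b (p - p₀)) with hF
  have hdet : (A b).det ≠ 0 := by
    intro h0
    have := g.jacobian b hb
    rw [h0, abs_zero] at this
    linarith
  have hFint : ∫ p, F p = 1 / |(A b).det| := by
    rw [hF, integral_comp_affine (δ ω) (A b) hdet y p₀, hδ.integral ω hω', mul_one, one_div]
  have hFlip : ∀ p p', |F p - F p'| ≤ V * k.L / ω ^ (d + 1) * ‖p - p'‖ := by
    intro p p'
    refine (hδ.lip ω hω' _ _).trans ?_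
    have e : y + A b (p - p₀) - (y + A b (p' - p₀)) = A b (p - p') := by
      rw [add_sub_add_left_eq_sub, ← map_sub, sub_sub_sub_cancel_right]
    rw [e]
    calc V / ω ^ (d + 1) * ‖A b (p - p')‖ ≤ V / ω ^ (d + 1) * (k.L * ‖p - p'‖) := by
          gcongr; exact g.upper b hb _
      _ = _ := by ring
  have hFsupp : ∀ p, (2 / k.c + 1) * ω < ‖p - b‖ → F p = 0 := by
    intro p hp
    refine hδ.support ω hω' _ ?_
    have h1 : ‖p - b‖ ≤ ‖p - p₀‖ + ‖p₀ - b‖ := norm_sub_le_norm_sub_add_norm_sub _ _ _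
    have h2 : 2 / k.c * ω < ‖p - p₀‖ := by linarith
    have h3 := g.lower b hb (p - p₀)
    have h4 : 2 * ω < k.c * ‖p - p₀‖ := by
      rw [div_mul_eq_mul_div, div_lt_iff₀ hc] at h2; linarith
    have h5 := norm_sub_norm_le (A b (p - p₀)) (-y)
    rw [sub_neg_eq_add, norm_neg, add_comm (A b (p - p₀)) y] at h5
    linarith
  have hriem := abs_riemannSum_sub_integral_le hN S (F := F) (κ := V * k.L / ω ^ (d + 1))
    (ρ := (2 / k.c + 1) * ω) (by positivity) (by positivity) b hFlip hFsupp (fun l hl => by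
      rw [hS]
      refine hl.trans ?_
      calc (2 / k.c + 1) * ω + 1 / (N : ℝ) ≤ (2 / k.c + 1) * ω + ω := by gcongr
        _ = (2 / k.c + 2) * ω := by ring
        _ ≤ R * ω := by gcongr)
  rw [hFint] at hriem
  have hriem' : |h ^ d * ∑ l ∈ S, F (gridPoint N l) - (1 / |(A b).det|)|
      ≤ V * k.L * (2 * R) ^ d * ω := by
    refine hriem.trans ?_
    have h1 : 2 * ((2 / k.c + 1) * ω + h) ≤ 2 * R * ω := by
      calc 2 * ((2 / k.c + 1) * ω + h) ≤ 2 * ((2 / k.c + 1) * ω + ω) := by gcongr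
        _ = 2 * (2 / k.c + 2) * ω := by ring
        _ ≤ _ := by gcongr
    calc _ ≤ V * k.L / ω ^ (d + 1) * ω ^ 2 * (2 * R * ω) ^ d := by
          have : 0 ≤ 2 * ((2 / k.c + 1) * ω + h) := by positivity
          gcongr
      _ = _ := by rw [mul_pow]; field_simp; ring
  have hmass := mass_le (b := b) hN hV hω hR0 S fun l hl => (hS l).1 hl
  have hsum1 : |h ^ d * ∑ l ∈ S, (G (gridPoint N l) - G b) * F (gridPoint N l)|
      ≤ a * R * (V * (2 * R + 1) ^ d) * ω := by
    rw [abs_mul, abs_of_pos (by positivity : 0 < h ^ d)]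
    have h1 : |∑ l ∈ S, (G (gridPoint N l) - G b) * F (gridPoint N l)|
        ≤ ∑ _l ∈ S, a * (R * ω) * (V / ω ^ d) := by
      refine (Finset.abs_sum_le_sum_abs _ _).trans (Finset.sum_le_sum fun l hl => ?_)
      rw [abs_mul]
      have h2 := hG' _ (gridPoint_mem_Icc hN (hSg hl)) b hb01
      have h3 := (hS l).1 hl
      have h4 : |F (gridPoint N l)| ≤ V / ω ^ d := hδ.bound ω hω' _
      have h5 : |G (gridPoint N l) - G b| ≤ a * (R * ω) := h2.trans (by gcongr)
      gcongr
    rw [Finset.sum_const, nsmul_eq_mul] at h1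
    calc _ ≤ h ^ d * (S.card * (a * (R * ω) * (V / ω ^ d))) := by gcongr
      _ = a * (R * ω) * (h ^ d * (S.card * (V / ω ^ d))) := by ring
      _ ≤ a * (R * ω) * (V * (2 * R + 1) ^ d) := by gcongr
      _ = _ := by ring
  have e : h ^ d * ∑ l ∈ S, G (gridPoint N l) * F (gridPoint N l) - G b / |(A b).det|
      = h ^ d * ∑ l ∈ S, (G (gridPoint N l) - G b) * F (gridPoint N l)
        + G b * (h ^ d * ∑ l ∈ S, F (gridPoint N l) - (1 / |(A b).det|)) := by
    simp only [sub_mul, Finset.sum_sub_distrib, ← Finset.mul_sum]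
    ring
  calc |h ^ d * ∑ l ∈ S, G (gridPoint N l) * F (gridPoint N l) - (G b / |(A b).det|)|
      ≤ |h ^ d * ∑ l ∈ S, (G (gridPoint N l) - G b) * F (gridPoint N l)|
        + |G b| * |h ^ d * ∑ l ∈ S, F (gridPoint N l) - (1 / |(A b).det|)| := by
        rw [e, ← abs_mul]; exact abs_add_le _ _
    _ ≤ a * R * (V * (2 * R + 1) ^ d) * ω + a * (V * k.L * (2 * R) ^ d * ω) := by
        gcongr
        exact hG b hb01
    _ = _ := by ring

end NearZero

section SampleError

variable {d : ℕ} {Ω : Type*} {k : SampleBounds} {N : ℕ} {E : (Ω → ℝ) →ₗ[ℝ] ℝ}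
  {alive : (Fin d → ℤ) → Set Ω} {Y : (Fin d → ℤ) → Ω → Fin d → ℝ}
  {f : (Fin d → ℝ) → Fin d → ℝ} {A : (Fin d → ℝ) → (Fin d → ℝ) →L[ℝ] Fin d → ℝ}
  {Z : Finset (Fin d → ℝ)} {V : ℝ} {δ : ℝ → (Fin d → ℝ) → ℝ} {ω R : ℝ}
  {b : Fin d → ℝ} {G : (Fin d → ℝ) → ℝ} {a : ℝ}

/-- Every point `b` of the open unit cube is within `1 / N` of a grid point. -/
lemma exists_gridPoint_near (hN : 1 ≤ N) (hb : ∀ i, b i ∈ Ioo (0 : ℝ) 1) :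
    ∃ l ∈ gridIndices d N, ‖gridPoint N l - b‖ ≤ 1 / (N : ℝ) := by
  have hN0 : (0 : ℝ) < N := by exact_mod_cast hN
  refine ⟨fun i => ⌈b i * N⌉, ?_, ?_⟩
  · rw [gridIndices, Fintype.mem_piFinset]
    intro i
    have h1 : 0 < b i * N := mul_pos (hb i).1 hN0
    have h2 : b i * N ≤ ((N : ℤ) : ℝ) := by
      push_cast; nlinarith [(hb i).2]
    exact Finset.mem_Icc.2 ⟨by have := Int.ceil_pos.2 h1; omega, Int.ceil_le.2 h2⟩
  · refine (pi_norm_le_iff_of_nonneg (by positivity)).2 fun i => ?_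
    have h1 := Int.le_ceil (b i * N)
    have h2 := Int.ceil_lt_add_one (b i * N)
    rw [Pi.sub_apply, Real.norm_eq_abs, gridPoint]
    have e : (⌈b i * N⌉ : ℝ) / N - b i = (⌈b i * N⌉ - b i * N) / N := by field_simp
    rw [e, abs_of_nonneg (div_nonneg (by linarith) hN0.le)]
    gcongr
    linarith

set_option maxHeartbeats 1000000 in
/-- The contribution of the grid points within a multiple of `ω` of a zero `b`. -/
lemma IsSample.near_le (s : IsSample k N E alive Y f Z) (g : ZeroGeometry k f A Z)
    (hN : 1 ≤ N) (hδ : IsMollifier V δ) (hω : 1 / (N : ℝ) ≤ ω) (hω1 : ω ≤ 1)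
    (hh : 1 / (N : ℝ) ≤ ω ^ 2) (hb : b ∈ Z) (hR : 2 / k.c + 2 ≤ R) (hRδ : R * ω < k.δ)
    (S : Finset (Fin d → ℤ))
    (hS : ∀ l, l ∈ S ↔ l ∈ gridIndices d N ∧ ‖gridPoint N l - b‖ ≤ R * ω)
    (hG : ∀ p ∈ Icc (0 : Fin d → ℝ) 1, |G p| ≤ a)
    (hG' : ∀ p ∈ Icc (0 : Fin d → ℝ) 1, ∀ p' ∈ Icc (0 : Fin d → ℝ) 1,
      |G p - G p'| ≤ a * ‖p - p'‖) :
    |(1 / (N : ℝ)) ^ d * ∑ l ∈ S, G (gridPoint N l)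
        * E ((alive l).indicator fun w => δ ω (Y l w)) - (G b / |(A b).det|)|
      ≤ (a * (V * (2 * R + 1) ^ d) * (d + 2 * k.L * R ^ 2 + d * k.mom 0 * (2 * R + 1)
            + 4 * k.κ * (R ^ 2 + 1))
          + (a * R * (V * (2 * R + 1) ^ d) + a * (V * k.L * (2 * R) ^ d))
          + (a * (V * (2 * R + 1) ^ d) + a / k.c) * (2 * k.κ + d * k.mom 0 * (4 * k.L ^ 2 + 1)))
        * (ω + 1 / (N : ℝ) / ω ^ 2) := by
  have hN0 : (0 : ℝ) < N := by exact_mod_cast hN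
  have hSg : S ⊆ gridIndices d N := fun l hl => ((hS l).1 hl).1
  have hSb : ∀ l ∈ S, ‖gridPoint N l - b‖ ≤ R * ω := fun l hl => ((hS l).1 hl).2
  -- no lattice point near `b` is cut off by the boundary of the grid
  have hS' : ∀ l, l ∈ S ↔ ‖gridPoint N l - b‖ ≤ R * ω := fun l => by
    rw [hS]
    exact ⟨fun h => h.2, fun h =>
      ⟨mem_gridIndices_of_mem_Ioo hN (g.inner b hb _ (h.trans_lt hRδ)), h⟩⟩
  have hb01 := g.mem_Icc hb
  obtain ⟨l₀, hl₀, hl₀b⟩ := exists_gridPoint_near (b := b) hN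
    (g.inner b hb b (by simpa using k.δ_pos))
  set h : ℝ := 1 / (N : ℝ) with hhdef
  have hh0 : 0 < h := by positivity
  have hω' : 0 < ω := hh0.trans_le hω
  have hV := hδ.nonneg
  have hL := k.L_nonneg
  have hκ := k.κ_nonneg
  have hc := k.c_pos
  have hm := k.mom_nonneg 0
  have hc2 : 0 < 2 / k.c := by positivity
  have hR1 : 1 ≤ R := by linarith
  have hR0 : 0 ≤ R := by linarith
  have ha : 0 ≤ a := (abs_nonneg _).trans (hG b hb01)
  have hh1 : h ≤ 1 := hω.trans hω1
  have hhsq : h ^ 2 ≤ h := pow_le_of_le_one hh0.le hh1 two_ne_zero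
  have hl₀bR : ‖gridPoint N l₀ - b‖ ≤ R * ω := hl₀b.trans (by nlinarith)
  set p₀ := gridPoint N l₀ with hp₀
  set W := V * (2 * R + 1) ^ d with hW
  have hW0 : 0 ≤ W := by positivity
  set CD := d + 2 * k.L * R ^ 2 + d * k.mom 0 * (2 * R + 1) + 4 * k.κ * (R ^ 2 + 1) with hCD
  have hCD0 : 0 ≤ CD := by positivity
  set CR := a * R * W + a * (V * k.L * (2 * R) ^ d) with hCR
  have hCR0 : 0 ≤ CR := by positivity
  set q := h / ω ^ 2 with hq
  have hq0 : 0 ≤ q := by positivity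
  have hmass : h ^ d * (S.card * (V / ω ^ d)) ≤ W := mass_le hN hV hω hR0 S hSb
  set D : (Fin d → ℤ) → Ω → ℝ := fun l w => |(alive l).indicator (fun w => δ ω (Y l w)) w
        - δ ω (Y l₀ w + A b (gridPoint N l - p₀))| with hD
  have hDE : ∀ l ∈ S, E (D l) ≤ V / ω ^ d * (CD * (ω + q)) := fun l hl =>
    s.linearise_le g hN hδ hω hω1 hh hb hR1 (hSg hl) hl₀ (hSb l hl) hl₀bR
  set lost : Ω → ℝ := (alive l₀)ᶜ.indicator fun _ => 1 with hlost
  have hlost0 : ∀ w, 0 ≤ lost w := fun w => Set.indicator_nonneg (fun w _ => zero_le_one) w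
  set sq₀ : Fin d → Ω → ℝ := fun i => (alive l₀).indicator fun w => (Y l₀ w i - 0) ^ (2 * 0 + 2)
    with hsq₀
  have hsq0 : ∀ i w, 0 ≤ sq₀ i w := fun i w => Set.indicator_nonneg
    (fun w _ => Even.pow_nonneg (by decide) _) w
  -- if the sample at `l₀` exists and is of size `ω`, the linearised sum is a Riemann sum whose kernel
  -- is supported in the range of summation; otherwise the sum is only bounded, but this is rare
  have hrem : ∀ w, |h ^ d * ∑ l ∈ S, G (gridPoint N l)
        * δ ω (Y l₀ w + A b (gridPoint N l - p₀)) - (G b / |(A b).det|)|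
      ≤ CR * ω + (a * W + a / k.c) * (lost w + 1 / ω ^ 2 * ∑ i, sq₀ i w) := by
    intro w
    have hsum0 := Finset.sum_nonneg fun i (_ : i ∈ Finset.univ) => hsq0 i w
    by_cases hgood : w ∈ alive l₀ ∧ ‖Y l₀ w‖ ≤ ω
    · refine (g.riemann_le hN hδ hω hh hb hR hl₀b S hSg hS' hG hG' hgood.2).trans ?_
      have := hlost0 w
      have : 0 ≤ (a * W + a / k.c) * (lost w + 1 / ω ^ 2 * ∑ i, sq₀ i w) := by positivity
      linarith
    · have h1 : |h ^ d * ∑ l ∈ S, G (gridPoint N l)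
          * δ ω (Y l₀ w + A b (gridPoint N l - p₀))| ≤ a * W := by
        rw [abs_mul, abs_of_pos (by positivity : 0 < h ^ d)]
        have h2 : |∑ l ∈ S, G (gridPoint N l) * δ ω (Y l₀ w + A b (gridPoint N l - p₀))|
            ≤ ∑ _l ∈ S, a * (V / ω ^ d) := by
          refine (Finset.abs_sum_le_sum_abs _ _).trans (Finset.sum_le_sum fun l hl => ?_)
          rw [abs_mul]
          exact mul_le_mul (hG _ (gridPoint_mem_Icc hN (hSg hl))) (hδ.bound ω hω' _)
            (abs_nonneg _) ha
        rw [Finset.sum_const, nsmul_eq_mul] at h2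
        calc _ ≤ h ^ d * (S.card * (a * (V / ω ^ d))) := by gcongr
          _ = a * (h ^ d * (S.card * (V / ω ^ d))) := by ring
          _ ≤ a * W := by gcongr
      have h2 : |(G b / |(A b).det|)| ≤ a / k.c := by
        rw [abs_div, abs_abs]
        exact div_le_div₀ ha (hG b hb01) hc (g.jacobian b hb)
      have h3 : 1 ≤ lost w + 1 / ω ^ 2 * ∑ i, sq₀ i w := by
        by_cases hw : w ∈ alive l₀
        · have h4 : ω ≤ ‖Y l₀ w‖ := by
            by_contra hcon
            exact hgood ⟨hw, (not_le.1 hcon).le⟩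
          obtain ⟨i, hi⟩ := exists_le_abs_apply hω' h4
          have h5 : ω ^ 2 ≤ sq₀ i w := by
            simp only [hsq₀, Set.indicator_of_mem hw, sub_zero]
            rw [show 2 * 0 + 2 = 2 from rfl, ← sq_abs (Y l₀ w i)]
            gcongr
          have h6 : sq₀ i w ≤ ∑ i, sq₀ i w :=
            Finset.single_le_sum (f := fun i => sq₀ i w) (fun i _ => hsq0 i w) (Finset.mem_univ i)
          have h7 : 1 ≤ 1 / ω ^ 2 * ∑ i, sq₀ i w := by
            rw [one_div_mul_eq_div, le_div_iff₀ (by positivity), one_mul]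
            linarith
          linarith [hlost0 w]
        · have e : lost w = 1 := Set.indicator_of_mem (s := (alive l₀)ᶜ) hw _
          have : 0 ≤ 1 / ω ^ 2 * ∑ i, sq₀ i w := by positivity
          linarith
      calc _ ≤ |h ^ d * ∑ l ∈ S, G (gridPoint N l)
            * δ ω (Y l₀ w + A b (gridPoint N l - p₀))| + |(G b / |(A b).det|)| := abs_sub _ _
        _ ≤ 0 + (a * W + a / k.c) * 1 := by linarith
        _ ≤ _ := by gcongr; positivity
  have hpt : ∀ w, |h ^ d * ∑ l ∈ S, G (gridPoint N l)
        * (alive l).indicator (fun w => δ ω (Y l w)) w - (G b / |(A b).det|)|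
      ≤ a * (h ^ d * ∑ l ∈ S, D l w)
        + (CR * ω + (a * W + a / k.c) * (lost w + 1 / ω ^ 2 * ∑ i, sq₀ i w)) := by
    intro w
    have e : h ^ d * ∑ l ∈ S, G (gridPoint N l)
          * (alive l).indicator (fun w => δ ω (Y l w)) w - (G b / |(A b).det|)
        = h ^ d * ∑ l ∈ S, G (gridPoint N l) * ((alive l).indicator (fun w => δ ω (Y l w)) w
            - δ ω (Y l₀ w + A b (gridPoint N l - p₀)))
          + (h ^ d * ∑ l ∈ S, G (gridPoint N l)
            * δ ω (Y l₀ w + A b (gridPoint N l - p₀)) - (G b / |(A b).det|)) := by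
      simp only [mul_sub, Finset.sum_sub_distrib]; ring
    rw [e]
    refine (abs_add_le _ _).trans (add_le_add ?_ (hrem w))
    rw [abs_mul, abs_of_pos (by positivity : 0 < h ^ d), mul_left_comm, Finset.mul_sum]
    gcongr
    refine (Finset.abs_sum_le_sum_abs _ _).trans (Finset.sum_le_sum fun l hl => ?_)
    rw [abs_mul]
    exact mul_le_mul_of_nonneg_right (hG _ (gridPoint_mem_Icc hN (hSg hl))) (abs_nonneg _)
  have hEl : E (fun w => h ^ d * ∑ l ∈ S, G (gridPoint N l)
        * (alive l).indicator (fun w => δ ω (Y l w)) w)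
      = h ^ d * ∑ l ∈ S, G (gridPoint N l) * E ((alive l).indicator fun w => δ ω (Y l w)) := by
    rw [mean_mul, mean_sum]
    congr 1
    exact Finset.sum_congr rfl fun l _ => mean_mul _ _
  rw [← hEl]
  refine (s.isMean.abs_sub_le hpt).trans ?_
  rw [mean_add, mean_mul, mean_mul, mean_sum, mean_add, s.isMean.const, mean_mul, mean_add,
    mean_mul, mean_sum]
  have h1 : h ^ d * ∑ l ∈ S, E (D l) ≤ W * CD * (ω + q) := by
    have h2 := Finset.sum_le_sum hDE
    rw [Finset.sum_const, nsmul_eq_mul] at h2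
    calc _ ≤ h ^ d * (S.card * (V / ω ^ d * (CD * (ω + q)))) := by gcongr
      _ = h ^ d * (S.card * (V / ω ^ d)) * (CD * (ω + q)) := by ring
      _ ≤ W * (CD * (ω + q)) := by gcongr
      _ = _ := by ring
  have h2 : E lost ≤ 2 * k.κ * ω := by
    refine (s.exit b hb l₀ hl₀).trans ?_
    have h3 : ‖p₀ - b‖ ^ 2 ≤ ω := by
      calc ‖p₀ - b‖ ^ 2 ≤ h ^ 2 := by gcongr
        _ ≤ ω := hhsq.trans hω
    calc k.κ * (‖p₀ - b‖ ^ 2 + h) ≤ k.κ * (ω + ω) := by gcongr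
      _ = _ := by ring
  have h3 : ∑ i, E (sq₀ i) ≤ d * (k.mom 0 * ((4 * k.L ^ 2 + 1) * h)) := by
    have hf : ‖f p₀‖ ≤ 2 * k.L * h := by
      have h4 := g.approx b hb p₀ (gridPoint_mem_Icc hN hl₀) b hb01 h hl₀b
        (by simpa using hh0.le)
      rw [g.zero b hb, sub_zero] at h4
      have h5 := norm_sub_norm_le (f p₀) (A b (p₀ - b))
      have h6 := g.upper b hb (p₀ - b)
      calc ‖f p₀‖ ≤ k.L * ‖p₀ - b‖ + k.L * h * ‖p₀ - b‖ := by linarith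
        _ ≤ k.L * h + k.L * 1 * h := by gcongr
        _ = _ := by ring
    have h4 : ∑ i, E (sq₀ i) ≤ ∑ _i : Fin d, k.mom 0 * ((4 * k.L ^ 2 + 1) * h) := by
      refine Finset.sum_le_sum fun i _ => (s.moment 0 l₀ hl₀ i 0).trans ?_
      rw [sub_zero, zero_add, pow_one, show 2 * 0 + 2 = 2 from rfl]
      gcongr
      have h5 : f p₀ i ^ 2 ≤ (2 * k.L * h) ^ 2 := by
        rw [← sq_abs]
        have := (norm_le_pi_norm (f p₀) i).trans hf
        rw [Real.norm_eq_abs] at this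
        gcongr
      calc f p₀ i ^ 2 + h ≤ (2 * k.L * h) ^ 2 + h := by linarith
        _ = 4 * k.L ^ 2 * h ^ 2 + h := by ring
        _ ≤ 4 * k.L ^ 2 * h + h := by gcongr
        _ = _ := by ring
    rwa [Finset.sum_const, Finset.card_univ, Fintype.card_fin, nsmul_eq_mul] at h4
  calc _ ≤ a * (W * CD * (ω + q)) + (CR * ω + (a * W + a / k.c) * (2 * k.κ * ω
        + 1 / ω ^ 2 * (d * (k.mom 0 * ((4 * k.L ^ 2 + 1) * h))))) := by gcongr
    _ = a * (W * CD * (ω + q)) + (CR * ω + (a * W + a / k.c) * (2 * k.κ * ω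
        + d * k.mom 0 * (4 * k.L ^ 2 + 1) * q)) := by rw [hq]; ring
    _ ≤ a * (W * CD * (ω + q)) + (CR * (ω + q) + (a * W + a / k.c) * (2 * k.κ * (ω + q)
        + d * k.mom 0 * (4 * k.L ^ 2 + 1) * (ω + q))) := by
        gcongr <;> linarith
    _ = _ := by ring

lemma sum_le_sum_cover {α γ : Type*} (S : Finset α) (Z : Finset γ) (P : γ → α → Prop)
    [∀ b, DecidablePred (P b)] (e : α → ℝ) (he : ∀ l ∈ S, 0 ≤ e l)
    (h : ∀ l ∈ S, ∃ b ∈ Z, P b l) : ∑ l ∈ S, e l ≤ ∑ b ∈ Z, ∑ l ∈ S with P b l, e l := by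
  simp only [Finset.sum_filter]
  rw [Finset.sum_comm]
  refine Finset.sum_le_sum fun l hl => ?_
  obtain ⟨b, hb, hP⟩ := h l hl
  have h1 : (if P b l then e l else 0) ≤ ∑ b ∈ Z, if P b l then e l else 0 :=
    Finset.single_le_sum (f := fun b => if P b l then e l else 0)
      (fun b _ => by split_ifs; exacts [he l hl, le_rfl]) hb
  rwa [if_pos hP] at h1

lemma IsSample.nonneg_tail (s : IsSample k N E alive Y f Z) (l : Fin d → ℤ) :
    0 ≤ E ((alive l).indicator fun w => |δ ω (Y l w)|) :=
  s.isMean.nonneg fun w => Set.indicator_nonneg (fun _ _ => abs_nonneg _) w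

lemma IsSample.abs_mean_le (s : IsSample k N E alive Y f Z) (l : Fin d → ℤ) :
    |E ((alive l).indicator fun w => δ ω (Y l w))|
      ≤ E ((alive l).indicator fun w => |δ ω (Y l w)|) := by
  refine s.isMean.abs_le fun w => ?_
  by_cases hw : w ∈ alive l
  · simp [Set.indicator_of_mem hw]
  · simp [Set.indicator_of_notMem hw]

lemma IsSample.abs_sum_le (s : IsSample k N E alive Y f Z) (hN : 1 ≤ N) (S : Finset (Fin d → ℤ))
    (hS : S ⊆ gridIndices d N) (hG : ∀ p ∈ Icc (0 : Fin d → ℝ) 1, |G p| ≤ a) :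
    |(1 / (N : ℝ)) ^ d * ∑ l ∈ S, G (gridPoint N l)
        * E ((alive l).indicator fun w => δ ω (Y l w))|
      ≤ a * ((1 / (N : ℝ)) ^ d * ∑ l ∈ S, E ((alive l).indicator fun w => |δ ω (Y l w)|)) := by
  rw [abs_mul, abs_of_nonneg (by positivity : (0 : ℝ) ≤ (1 / (N : ℝ)) ^ d), mul_left_comm,
    Finset.mul_sum]
  gcongr
  refine (Finset.abs_sum_le_sum_abs _ _).trans (Finset.sum_le_sum fun l hl => ?_)
  rw [abs_mul]
  have hp := hG _ (gridPoint_mem_Icc hN (hS hl))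
  exact mul_le_mul hp (s.abs_mean_le l) (abs_nonneg _) ((abs_nonneg _).trans hp)

end SampleError

/-! ### The sampling error -/

section SampleTotal

variable {d : ℕ} {Ω : Type*} {k : SampleBounds} {N : ℕ} {E : (Ω → ℝ) →ₗ[ℝ] ℝ}
  {alive : (Fin d → ℤ) → Set Ω} {Y : (Fin d → ℤ) → Ω → Fin d → ℝ}
  {f : (Fin d → ℝ) → Fin d → ℝ} {A : (Fin d → ℝ) → (Fin d → ℝ) →L[ℝ] Fin d → ℝ}
  {Z : Finset (Fin d → ℝ)} {V : ℝ} {δ : ℝ → (Fin d → ℝ) → ℝ} {ω R : ℝ}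
  {b : Fin d → ℝ} {G : (Fin d → ℝ) → ℝ} {a : ℝ}

/-- The radius `R ω` around the zeros that contains the relevant samples, and the largest smoothing
length `ω₀` for which these neighbourhoods are disjoint and inside the cube. -/
lemma SampleBounds.exists_radius (k : SampleBounds) :
    ∃ R ω₀ : ℝ, 1 ≤ R ∧ 4 ≤ k.c * R ∧ 2 / k.c + 2 ≤ R ∧ 0 < ω₀ ∧ ω₀ ≤ 1 ∧ 2 * ω₀ ≤ k.c₀ ∧
      R * ω₀ < k.δ ∧ 2 * R * ω₀ ≤ k.r := by
  have hc := k.c_pos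
  have hc₀ := k.c₀_pos
  have hδ := k.δ_pos
  have hr := k.r_pos
  set R := 4 / k.c + 2 with hR
  have hR0 : 0 < R := by positivity
  have h4 : 2 / k.c ≤ 4 / k.c := by gcongr; norm_num
  have h5 : 0 < 4 / k.c := by positivity
  refine ⟨R, min (min 1 (k.c₀ / 2)) (min (k.δ / (2 * R)) (k.r / (2 * R))), by linarith, ?_,
    by linarith, by positivity, ?_, ?_, ?_, ?_⟩
  · rw [hR, mul_add, mul_div_cancel₀ _ hc.ne']; linarith
  · exact (min_le_left _ _).trans (min_le_left _ _)
  · have : min (min 1 (k.c₀ / 2)) (min (k.δ / (2 * R)) (k.r / (2 * R))) ≤ k.c₀ / 2 :=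
      (min_le_left _ _).trans (min_le_right _ _)
    linarith
  · have : min (min 1 (k.c₀ / 2)) (min (k.δ / (2 * R)) (k.r / (2 * R))) ≤ k.δ / (2 * R) :=
      (min_le_right _ _).trans (min_le_left _ _)
    rw [le_div_iff₀ (by positivity)] at this
    linarith
  · have : min (min 1 (k.c₀ / 2)) (min (k.δ / (2 * R)) (k.r / (2 * R))) ≤ k.r / (2 * R) :=
      (min_le_right _ _).trans (min_le_right _ _)
    rw [le_div_iff₀ (by positivity)] at this
    linarith

open Classical in
/-- The sampling error when the smoothing length `ω` exceeds the standard deviation `√h` of the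
samples. -/
lemma exists_error_of_le_sq (d : ℕ) (k : SampleBounds) (V a R ω₀ : ℝ) (hR1 : 1 ≤ R)
    (hR4 : 4 ≤ k.c * R) (hR2 : 2 / k.c + 2 ≤ R) (hω₁ : ω₀ ≤ 1)
    (hω₀c : 2 * ω₀ ≤ k.c₀) (hω₀δ : R * ω₀ < k.δ) (hω₀r : 2 * R * ω₀ ≤ k.r) :
    ∃ C, 0 ≤ C ∧ ∀ {Ω : Type} {N : ℕ} {E : (Ω → ℝ) →ₗ[ℝ] ℝ} {alive : (Fin d → ℤ) → Set Ω}
      {Y : (Fin d → ℤ) → Ω → Fin d → ℝ} {f : (Fin d → ℝ) → Fin d → ℝ}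
      {A : (Fin d → ℝ) → (Fin d → ℝ) →L[ℝ] Fin d → ℝ} {Z : Finset (Fin d → ℝ)}
      {δ : ℝ → (Fin d → ℝ) → ℝ} {ω : ℝ} {G : (Fin d → ℝ) → ℝ},
      IsSample k N E alive Y f Z → ZeroGeometry k f A Z → 1 ≤ N → IsMollifier V δ →
      1 / (N : ℝ) ≤ ω → ω ≤ ω₀ → 1 / (N : ℝ) ≤ ω ^ 2 →
      (∀ p ∈ Icc (0 : Fin d → ℝ) 1, |G p| ≤ a) →
      (∀ p ∈ Icc (0 : Fin d → ℝ) 1, ∀ p' ∈ Icc (0 : Fin d → ℝ) 1, |G p - G p'| ≤ a * ‖p - p'‖) →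
      |(1 / (N : ℝ)) ^ d * ∑ l ∈ gridIndices d N, G (gridPoint N l)
        * E ((alive l).indicator fun w => δ ω (Y l w)) - (∑ b ∈ Z, G b / |(A b).det|)|
        ≤ C * (ω + 1 / (N : ℝ) / ω ^ 2) := by
  set C₁ := V * d * k.mom d * (2 / k.c₀) ^ (2 * d + 2) with hC₁
  set C₂ := V * d * k.mom d * (4 / k.c) ^ (2 * d + 2) * (6 * Real.pi) ^ d with hC₂
  set C₃ := a * (V * (2 * R + 1) ^ d) * (d + 2 * k.L * R ^ 2 + d * k.mom 0 * (2 * R + 1)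
            + 4 * k.κ * (R ^ 2 + 1))
          + (a * R * (V * (2 * R + 1) ^ d) + a * (V * k.L * (2 * R) ^ d))
          + (a * (V * (2 * R + 1) ^ d) + a / k.c) * (2 * k.κ + d * k.mom 0 * (4 * k.L ^ 2 + 1))
    with hC₃
  refine ⟨|a * (C₁ + k.Q * C₂)| + |k.Q * C₃|, by positivity, ?_⟩
  intro Ω N E alive Y f A Z δ ω G s g hN hδ hω hωω₀ hh hG hG'
  have hN0 : (0 : ℝ) < N := by exact_mod_cast hN
  set h : ℝ := 1 / (N : ℝ) with hhdef
  have hh0 : 0 < h := by positivity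
  have hω' : 0 < ω := hh0.trans_le hω
  have hω1 : ω ≤ 1 := hωω₀.trans hω₁
  have hV := hδ.nonneg
  have hR0 : 0 ≤ R := by linarith
  have ha : 0 ≤ a := (abs_nonneg _).trans (hG 0 ⟨le_rfl, zero_le_one⟩)
  have hL := k.L_nonneg
  have hκ := k.κ_nonneg
  have hc := k.c_pos
  have hc₀ := k.c₀_pos
  have hm := k.mom_nonneg
  set q := h / ω ^ 2 with hq
  have hq0 : 0 ≤ q := by positivity
  set v : (Fin d → ℤ) → ℝ := fun l => G (gridPoint N l)
    * E ((alive l).indicator fun w => δ ω (Y l w)) with hv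
  set e : (Fin d → ℤ) → ℝ := fun l => E ((alive l).indicator fun w => |δ ω (Y l w)|) with he
  have he0 : ∀ l, 0 ≤ e l := fun l => s.nonneg_tail l
  set S : (Fin d → ℝ) → Finset (Fin d → ℤ) := fun b =>
    (gridIndices d N).filter fun l => ‖gridPoint N l - b‖ ≤ R * ω with hS
  set F : Finset (Fin d → ℤ) :=
    (gridIndices d N).filter fun l => ¬ ∃ b ∈ Z, ‖gridPoint N l - b‖ ≤ R * ω with hF
  have hFg : F ⊆ gridIndices d N := Finset.filter_subset _ _
  have hFfar : ∀ l ∈ F, ∀ b ∈ Z, R * ω ≤ ‖gridPoint N l - b‖ := by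
    intro l hl b hb
    by_contra hcon
    exact (Finset.mem_filter.1 hl).2 ⟨b, hb, (not_le.1 hcon).le⟩
  have hsplit : ∑ l ∈ gridIndices d N, v l = ∑ b ∈ Z, ∑ l ∈ S b, v l + ∑ l ∈ F, v l := by
    rw [← Finset.sum_filter_add_sum_filter_not (gridIndices d N)
      (fun l => ∃ b ∈ Z, ‖gridPoint N l - b‖ ≤ R * ω)]
    congr 1
    have e1 : ((gridIndices d N).filter fun l => ∃ b ∈ Z, ‖gridPoint N l - b‖ ≤ R * ω)
        = Z.biUnion S := by
      ext l; simp only [hS, Finset.mem_filter, Finset.mem_biUnion]; tauto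
    rw [e1, Finset.sum_biUnion]
    intro b hb b' hb' hne
    refine Finset.disjoint_left.2 fun l hl hl' => hne ?_
    have h1 := (Finset.mem_filter.1 hl).2
    have h2 := (Finset.mem_filter.1 hl').2
    refine g.separated b' hb' b hb ?_
    have h3 := norm_sub_le_norm_sub_add_norm_sub b (gridPoint N l) b'
    rw [norm_sub_rev b (gridPoint N l)] at h3
    calc ‖b - b'‖ ≤ 2 * R * ω := by linarith
      _ ≤ 2 * R * ω₀ := by gcongr
      _ ≤ k.r := hω₀r
  have hfar : h ^ d * ∑ l ∈ F, e l ≤ (C₁ + k.Q * C₂) * q := by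
    have h1 : h ^ d * ∑ l ∈ F with k.c₀ ≤ ‖f (gridPoint N l)‖, e l ≤ C₁ * q :=
      s.sum_tail_le hN hδ hω hω1 (by linarith) _ ((Finset.filter_subset _ _).trans hFg)
        fun l hl => (Finset.mem_filter.1 hl).2
    have h2 : ∑ l ∈ F with ¬ k.c₀ ≤ ‖f (gridPoint N l)‖, e l
        ≤ ∑ b ∈ Z, ∑ l ∈ F.filter (fun l => ¬ k.c₀ ≤ ‖f (gridPoint N l)‖)
          with ‖gridPoint N l - b‖ ≤ k.r, e l :=
      sum_le_sum_cover _ Z (fun b l => ‖gridPoint N l - b‖ ≤ k.r) e (fun l _ => he0 l)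
        fun l hl => by
          have h3 := Finset.mem_filter.1 hl
          exact g.far _ (gridPoint_mem_Icc hN (hFg h3.1)) (not_le.1 h3.2)
    have h3 : ∀ b ∈ Z, h ^ d * ∑ l ∈ F.filter (fun l => ¬ k.c₀ ≤ ‖f (gridPoint N l)‖)
          with ‖gridPoint N l - b‖ ≤ k.r, e l ≤ C₂ * q := by
      intro b hb
      refine s.sum_annulus_le g hN hδ hω hh hb hR1 hR4 _
        (((Finset.filter_subset _ _).trans (Finset.filter_subset _ _)).trans hFg)
        (fun l hl => (Finset.mem_filter.1 hl).2) fun l hl => ?_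
      exact hFfar l (Finset.mem_filter.1 (Finset.mem_filter.1 hl).1).1 b hb
    have h4 := Finset.sum_le_sum h3
    rw [← Finset.mul_sum, Finset.sum_const, nsmul_eq_mul] at h4
    have h5 : (Z.card : ℝ) ≤ k.Q := by exact_mod_cast g.card_le
    have hC₂0 : 0 ≤ C₂ := by have := hm d; have := Real.pi_pos; positivity
    have h6 : (Z.card : ℝ) * (C₂ * q) ≤ k.Q * (C₂ * q) := by gcongr
    have h7 := mul_le_mul_of_nonneg_left h2 (by positivity : 0 ≤ h ^ d)
    rw [← Finset.sum_filter_add_sum_filter_not F (fun l => k.c₀ ≤ ‖f (gridPoint N l)‖), mul_add]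
    calc _ ≤ C₁ * q + k.Q * (C₂ * q) := add_le_add h1 (h7.trans (h4.trans h6))
      _ = _ := by ring
  have hnear : ∀ b ∈ Z, |h ^ d * ∑ l ∈ S b, v l - (G b / |(A b).det|)| ≤ C₃ * (ω + q) :=
    fun b hb => s.near_le g hN hδ hω hω1 hh hb hR2 (lt_of_le_of_lt (by gcongr) hω₀δ) (S b)
      (fun l => Finset.mem_filter) hG hG'
  have hnear' : |∑ b ∈ Z, (h ^ d * ∑ l ∈ S b, v l - (G b / |(A b).det|))|
      ≤ k.Q * C₃ * (ω + q) := by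
    refine (Finset.abs_sum_le_sum_abs _ _).trans ((Finset.sum_le_sum hnear).trans ?_)
    rw [Finset.sum_const, nsmul_eq_mul, mul_assoc]
    have h5 : (Z.card : ℝ) ≤ k.Q := by exact_mod_cast g.card_le
    have hC₃0 : 0 ≤ C₃ := by have := hm 0; positivity
    gcongr
  have hfar' : |h ^ d * ∑ l ∈ F, v l| ≤ a * (C₁ + k.Q * C₂) * q := by
    refine (s.abs_sum_le hN F hFg hG).trans ?_
    rw [mul_assoc]
    gcongr
  have e2 : h ^ d * ∑ l ∈ gridIndices d N, v l - ∑ b ∈ Z, G b / |(A b).det|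
      = ∑ b ∈ Z, (h ^ d * ∑ l ∈ S b, v l - (G b / |(A b).det|)) + h ^ d * ∑ l ∈ F, v l := by
    rw [hsplit, Finset.sum_sub_distrib, ← Finset.mul_sum]; ring
  rw [e2]
  refine (abs_add_le _ _).trans ((add_le_add hnear' hfar').trans ?_)
  have i1 := le_abs_self (a * (C₁ + k.Q * C₂))
  have i2 := le_abs_self (k.Q * C₃)
  calc k.Q * C₃ * (ω + q) + a * (C₁ + k.Q * C₂) * q
      ≤ |k.Q * C₃| * (ω + q) + |a * (C₁ + k.Q * C₂)| * (ω + q) := by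
        gcongr; linarith
    _ = _ := by ring

/-- A clustering length of `h / η` with `η = h ^ (1 / (d + 2))` is short enough. -/
lemma pow_ratio_le {h η ω : ℝ} (hd : 1 ≤ d) (hη : 0 < η) (hη1 : η ≤ 1) (hηh : η ^ (d + 2) = h)
    (hω : h ≤ ω) (hωh : ω ^ 2 ≤ h) : (h / (η * ω)) ^ d ≤ h / ω ^ 2 := by
  have hh0 : 0 < h := by rw [← hηh]; positivity
  have hω' : 0 < ω := hh0.trans_le hω
  obtain ⟨m, rfl⟩ : ∃ m, d = m + 1 := ⟨d - 1, by omega⟩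
  rcases m with _ | m
  · have h1 : ω ≤ η := by
      refine le_of_sq_le_sq ?_ hη.le
      calc ω ^ 2 ≤ h := hωh
        _ = η ^ 3 := hηh.symm
        _ ≤ η ^ 2 := pow_le_pow_of_le_one hη.le hη1 (by norm_num)
    rw [zero_add, pow_one, sq]
    gcongr
  · have h1 : (h / ω) ^ m ≤ 1 := pow_le_one₀ (by positivity) (by rwa [div_le_one hω'])
    have h2 : h ≤ η ^ (m + 2) := by
      rw [← hηh]; exact pow_le_pow_of_le_one hη.le hη1 (by omega)
    calc (h / (η * ω)) ^ (m + 1 + 1) = (h / ω) ^ m * (h / η ^ (m + 2)) * (h / ω ^ 2) := by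
          rw [show m + 1 + 1 = m + 2 from rfl, div_pow, div_pow, mul_pow]
          field_simp
          ring
      _ ≤ 1 * 1 * (h / ω ^ 2) := by
          gcongr
          rw [div_le_one (by positivity)]
          exact h2
      _ = _ := by ring

open Classical in
/-- The number of samples that fall in a box of size `ω` smaller than their standard deviation.
Two such samples taken at points at distance `ρ` would have to differ from their mean difference by
a multiple of `ρ`, which is very unlikely unless `ρ` is hardly larger than `h`. -/
lemma IsSample.clustered_le (s : IsSample k N E alive Y f Z) (g : ZeroGeometry k f A Z)
    (hd : 1 ≤ d) (hN : 1 ≤ N) (hδ : IsMollifier V δ) (hω : 1 / (N : ℝ) ≤ ω)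
    (hh : ω ^ 2 ≤ 1 / (N : ℝ)) (hb : b ∈ Z) (hR1 : 1 ≤ R) (hR : 8 ≤ k.c * R)
    (S : Finset (Fin d → ℤ)) (hS : S ⊆ gridIndices d N) (hr : ∀ l ∈ S, ‖gridPoint N l - b‖ ≤ k.r) :
    (1 / (N : ℝ)) ^ d * ∑ l ∈ S, E ((alive l).indicator fun w => |δ ω (Y l w)|)
      ≤ V * ((2 * R + 1) ^ d + d * k.mom (3 * d * (d + 2))
          * (32 / k.c ^ 2) ^ (3 * d * (d + 2) + 1)) * (1 / (N : ℝ) / ω ^ 2) := by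
  have hN0 : (0 : ℝ) < N := by exact_mod_cast hN
  set h : ℝ := 1 / (N : ℝ) with hhdef
  have hh0 : 0 < h := by positivity
  have hh1 : h ≤ 1 := by rw [hhdef, div_le_one hN0]; exact_mod_cast hN
  have hω' : 0 < ω := hh0.trans_le hω
  have hV := hδ.nonneg
  have hc := k.c_pos
  have hR0 : 0 ≤ R := by linarith
  set m := 3 * d * (d + 2) with hmdef
  have hm := k.mom_nonneg m
  -- `η` is the power `h ^ (1 / (d + 2))`
  obtain ⟨η, hη0, hη1, hηh⟩ : ∃ η : ℝ, 0 < η ∧ η ≤ 1 ∧ η ^ (d + 2) = h := by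
    refine ⟨h ^ ((1 : ℝ) / ((d + 2 : ℕ) : ℝ)), Real.rpow_pos_of_pos hh0 _,
      Real.rpow_le_one hh0.le hh1 (by positivity), ?_⟩
    rw [← Real.rpow_natCast, ← Real.rpow_mul hh0.le, one_div_mul_cancel (by positivity),
      Real.rpow_one]
  set ω' := max ω (h / η) with hω'def
  have hωω' : ω ≤ ω' := le_max_left _ _
  have hω'0 : 0 < ω' := hω'.trans_le hωω'
  set ρ := R * ω' with hρ
  have hρ0 : 0 < ρ := by positivity
  have hωρ : ω' ≤ ρ := by rw [hρ]; nlinarith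
  have hev : ∀ x : ℝ, 0 ≤ x ^ (2 * m + 2) := fun x => Even.pow_nonneg ⟨m + 1, by ring⟩ x
  set dev : (Fin d → ℤ) × (Fin d → ℤ) → Fin d → Ω → ℝ := fun u i =>
    (alive u.1 ∩ alive u.2).indicator fun w => (Y u.1 w i - Y u.2 w i
      - (f (gridPoint N u.1) i - f (gridPoint N u.2) i)) ^ (2 * m + 2) with hdev
  have hdev0 : ∀ u i w, 0 ≤ dev u i w := fun u i w =>
    Set.indicator_nonneg (fun w _ => hev _) w
  set P : Finset ((Fin d → ℤ) × (Fin d → ℤ)) :=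
    (S ×ˢ S).filter fun u => ρ < ‖gridPoint N u.1 - gridPoint N u.2‖ with hP
  set wt : (Fin d → ℤ) × (Fin d → ℤ) → ℝ := fun u =>
    (4 / (k.c * ‖gridPoint N u.1 - gridPoint N u.2‖)) ^ (2 * m + 2) with hwt
  have hwt0 : ∀ u, 0 ≤ wt u := fun u => hev _
  have hcardS : (S.card : ℝ) ≤ (N : ℝ) ^ d := by
    have := Finset.card_le_card hS
    rw [card_gridIndices] at this
    exact_mod_cast this
  -- unless there is a bad pair in `P`, the samples of size `ω` lie in a cube of side `ρ`; the moments
  -- of the bad pairs are so small that the trivial bound `N ^ d` suffices for their contribution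
  have hpt : ∀ w, ∑ l ∈ S, (alive l).indicator (fun w => |δ ω (Y l w)|) w
      ≤ V / ω ^ d * ((2 * N * ρ + 1) ^ d + (N : ℝ) ^ d * ∑ u ∈ P, wt u * ∑ i, dev u i w) := by
    intro w
    have hsum0 : ∀ u, 0 ≤ wt u * ∑ i, dev u i w := fun u =>
      mul_nonneg (hwt0 u) (Finset.sum_nonneg fun i _ => hdev0 u i w)
    set T := S.filter fun l => w ∈ alive l ∧ ‖Y l w‖ ≤ ω with hT
    have h1 : ∑ l ∈ S, (alive l).indicator (fun w => |δ ω (Y l w)|) w ≤ T.card * (V / ω ^ d) := by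
      rw [← nsmul_eq_mul, ← Finset.sum_const, hT, Finset.sum_filter]
      refine Finset.sum_le_sum fun l _ => ?_
      split_ifs with hl
      · rw [Set.indicator_of_mem hl.1]; exact hδ.bound ω hω' _
      · by_cases hw : w ∈ alive l
        · rw [Set.indicator_of_mem hw, hδ.support ω hω' _ (not_le.1 fun hY => hl ⟨hw, hY⟩),
            abs_zero]
        · rw [Set.indicator_of_notMem hw]
    have h2 : (T.card : ℝ)
        ≤ (2 * N * ρ + 1) ^ d + (N : ℝ) ^ d * ∑ u ∈ P, wt u * ∑ i, dev u i w := by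
      by_cases hclose : ∀ l ∈ T, ∀ l' ∈ T, ‖gridPoint N l - gridPoint N l'‖ ≤ ρ
      · have h3 : (T.card : ℝ) ≤ (2 * N * ρ + 1) ^ d := by
          rcases T.eq_empty_or_nonempty with hem | ⟨l', hl'⟩
          · rw [hem, Finset.card_empty, Nat.cast_zero]; positivity
          · exact card_le_of_norm_sub_le hN T hρ0.le _ fun l hl => hclose l hl l' hl'
        have := Finset.sum_nonneg fun u (_ : u ∈ P) => hsum0 u
        have : 0 ≤ (N : ℝ) ^ d * ∑ u ∈ P, wt u * ∑ i, dev u i w := by positivity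
        linarith
      · push Not at hclose
        obtain ⟨l, hl, l', hl', hfar⟩ := hclose
        obtain ⟨hlS, hla, hlY⟩ := Finset.mem_filter.1 hl
        obtain ⟨hlS', hla', hlY'⟩ := Finset.mem_filter.1 hl'
        have hu : (l, l') ∈ P := Finset.mem_filter.2 ⟨Finset.mk_mem_product hlS hlS', hfar⟩
        set ν := ‖gridPoint N l - gridPoint N l'‖ with hν
        have hν0 : 0 < ν := hρ0.trans hfar
        have h4 := g.near b hb _ (gridPoint_mem_Icc hN (hS hlS)) _
          (gridPoint_mem_Icc hN (hS hlS')) (hr l hlS) (hr l' hlS')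
        rw [← hν] at h4
        have h5 : k.c * ν / 4 ≤ ‖Y l w - Y l' w - (f (gridPoint N l) - f (gridPoint N l'))‖ := by
          have h6 := norm_sub_norm_le (f (gridPoint N l) - f (gridPoint N l')) (Y l w - Y l' w)
          rw [norm_sub_rev _ (Y l w - Y l' w)] at h6
          have h7 := norm_sub_le (Y l w) (Y l' w)
          have h8 : 8 * ω ≤ k.c * ν := by
            calc 8 * ω ≤ k.c * R * ω' := by gcongr
              _ = k.c * ρ := by rw [hρ]; ring
              _ ≤ k.c * ν := by gcongr
          linarith
        obtain ⟨i, hi⟩ := exists_le_abs_apply (by positivity) h5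
        have h6 : 1 ≤ wt (l, l') * dev (l, l') i w := by
          simp only [hwt, hdev, Set.indicator_of_mem (Set.mem_inter hla hla'), ← hν]
          rw [← Even.pow_abs ⟨m + 1, by ring⟩ (Y l w i - Y l' w i - _), ← mul_pow]
          refine one_le_pow₀ ?_
          simp only [Pi.sub_apply] at hi
          calc (1 : ℝ) = 4 / (k.c * ν) * (k.c * ν / 4) := by field_simp
            _ ≤ _ := by gcongr
        have h7 : 1 ≤ ∑ u ∈ P, wt u * ∑ i, dev u i w := by
          calc (1 : ℝ) ≤ wt (l, l') * dev (l, l') i w := h6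
            _ ≤ wt (l, l') * ∑ i, dev (l, l') i w := by
                refine mul_le_mul_of_nonneg_left ?_ (hwt0 _)
                exact Finset.single_le_sum (f := fun i => dev (l, l') i w)
                  (fun i _ => hdev0 _ i w) (Finset.mem_univ i)
            _ ≤ _ := Finset.single_le_sum (f := fun u => wt u * ∑ i, dev u i w)
                  (fun u _ => hsum0 u) hu
        have h8 : (T.card : ℝ) ≤ S.card := by
          exact_mod_cast Finset.card_le_card (Finset.filter_subset _ _)
        have h9 : (N : ℝ) ^ d * 1 ≤ (N : ℝ) ^ d * ∑ u ∈ P, wt u * ∑ i, dev u i w := by gcongr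
        have h10 : 0 ≤ (2 * N * ρ + 1) ^ d := by positivity
        linarith
    calc _ ≤ T.card * (V / ω ^ d) := h1
      _ = V / ω ^ d * T.card := mul_comm _ _
      _ ≤ _ := by gcongr
  have hE := s.isMean.mono _ _ hpt
  rw [mean_sum, mean_mul, mean_add, s.isMean.const, mean_mul, mean_sum] at hE
  have hpair : ∀ u ∈ P, E (fun w => wt u * ∑ i, dev u i w)
      ≤ d * k.mom m * (32 / k.c ^ 2) ^ (m + 1) * η ^ (m + 1) := by
    intro u hu
    obtain ⟨huS, hfar⟩ := Finset.mem_filter.1 hu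
    obtain ⟨hu1, hu2⟩ := Finset.mem_product.1 huS
    set ν := ‖gridPoint N u.1 - gridPoint N u.2‖ with hν
    have hν0 : 0 < ν := hρ0.trans hfar
    have hhν : h ≤ ν := hω.trans (hωω'.trans (hωρ.trans hfar.le))
    rw [mean_mul, mean_sum]
    have h1 : ∑ i, E (dev u i) ≤ ∑ _i : Fin d, k.mom m * (h * (2 * ν)) ^ (m + 1) := by
      refine Finset.sum_le_sum fun i _ => (s.pair m u.1 (hS hu1) u.2 (hS hu2) i).trans ?_
      gcongr
      linarith
    rw [Finset.sum_const, Finset.card_univ, Fintype.card_fin, nsmul_eq_mul] at h1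
    have h2 : h / ν ≤ η := by
      have h3 : h / η ≤ ν := (le_max_right _ _).trans (hωρ.trans hfar.le)
      rw [div_le_iff₀ hη0] at h3
      rw [div_le_iff₀ hν0]; linarith
    calc wt u * ∑ i, E (dev u i) ≤ wt u * (d * (k.mom m * (h * (2 * ν)) ^ (m + 1))) :=
          mul_le_mul_of_nonneg_left h1 (hwt0 u)
      _ = d * k.mom m * (32 / k.c ^ 2) ^ (m + 1) * (h / ν) ^ (m + 1) := by
          have e1 : wt u = ((4 / (k.c * ν)) ^ 2) ^ (m + 1) := by
            simp only [hwt]; rw [← pow_mul]; congr 1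
          have e2 : (4 / (k.c * ν)) ^ 2 * (h * (2 * ν)) = 32 / k.c ^ 2 * (h / ν) := by
            field_simp; norm_num
          calc wt u * (d * (k.mom m * (h * (2 * ν)) ^ (m + 1)))
              = d * k.mom m * ((4 / (k.c * ν)) ^ 2 * (h * (2 * ν))) ^ (m + 1) := by
                rw [e1, mul_pow _ (h * (2 * ν))]; ring
            _ = _ := by rw [e2, mul_pow]; ring
      _ ≤ _ := by gcongr
  set B := d * k.mom m * (32 / k.c ^ 2) ^ (m + 1) with hB
  have hB0 : 0 ≤ B := by positivity
  have hpairs : (N : ℝ) ^ d * ∑ u ∈ P, E (fun w => wt u * ∑ i, dev u i w) ≤ B := by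
    have h1 := Finset.sum_le_sum hpair
    rw [Finset.sum_const, nsmul_eq_mul] at h1
    have h2 : (P.card : ℝ) ≤ (N : ℝ) ^ d * (N : ℝ) ^ d := by
      have h3 : (P.card : ℝ) ≤ S.card * S.card := by
        have := Finset.card_le_card (Finset.filter_subset
          (fun u => ρ < ‖gridPoint N u.1 - gridPoint N u.2‖) (S ×ˢ S))
        rw [Finset.card_product] at this
        exact_mod_cast this
      exact h3.trans (by gcongr)
    have h3 : η ^ (m + 1) ≤ (h ^ d) ^ 3 := by
      calc η ^ (m + 1) ≤ η ^ m := pow_le_pow_of_le_one hη0.le hη1 (by omega)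
        _ = (h ^ d) ^ 3 := by
            rw [← hηh, ← pow_mul, ← pow_mul, hmdef]; congr 1; ring
    have h4 : (N : ℝ) ^ d * h ^ d = 1 := by
      rw [← mul_pow, hhdef, mul_one_div_cancel hN0.ne', one_pow]
    calc _ ≤ (N : ℝ) ^ d * (P.card * (B * η ^ (m + 1))) := by gcongr
      _ ≤ (N : ℝ) ^ d * ((N : ℝ) ^ d * (N : ℝ) ^ d * (B * (h ^ d) ^ 3)) := by gcongr
      _ = ((N : ℝ) ^ d * h ^ d) ^ 3 * B := by ring
      _ = B := by rw [h4]; ring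
  have hq1 : 1 ≤ h / ω ^ 2 := by rw [one_le_div (by positivity)]; exact hh
  have hratio : (ω' / ω) ^ d ≤ h / ω ^ 2 := by
    rcases max_cases ω (h / η) with ⟨e, _⟩ | ⟨e, _⟩
    · rw [hω'def, e, div_self hω'.ne', one_pow]; exact hq1
    · rw [hω'def, e, div_div]
      exact pow_ratio_le hd hη0 hη1 hηh hω hh
  calc h ^ d * ∑ l ∈ S, E ((alive l).indicator fun w => |δ ω (Y l w)|)
      ≤ h ^ d * (V / ω ^ d * ((2 * N * ρ + 1) ^ d + B)) := by
        gcongr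
        refine hE.trans ?_
        gcongr
    _ = V * (((2 * R * ω' + h) / ω) ^ d + (h / ω) ^ d * B) := by
        have e : (2 * R * ω' + h) = h * (2 * N * ρ + 1) := by
          rw [hρ, hhdef]; field_simp
        rw [e, div_pow, div_pow, mul_pow]; ring
    _ ≤ V * (((2 * R + 1) * (ω' / ω)) ^ d + 1 * B) := by
        have e : (2 * R * ω' + h) / ω ≤ (2 * R + 1) * (ω' / ω) := by
          rw [mul_div_assoc']
          gcongr
          linarith
        have e' : (h / ω) ^ d ≤ 1 := pow_le_one₀ (by positivity) (by rwa [div_le_one hω'])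
        gcongr
    _ ≤ V * ((2 * R + 1) ^ d * (h / ω ^ 2) + B * (h / ω ^ 2)) := by
        rw [mul_pow, one_mul]
        have : B ≤ B * (h / ω ^ 2) := le_mul_of_one_le_right hB0 hq1
        gcongr
    _ = _ := by ring

end SampleTotal

section SampleConclusion

lemma ZeroGeometry.abs_sum_le {d : ℕ} {k : SampleBounds} {f : (Fin d → ℝ) → Fin d → ℝ}
    {A : (Fin d → ℝ) → (Fin d → ℝ) →L[ℝ] Fin d → ℝ} {Z : Finset (Fin d → ℝ)}
    (g : ZeroGeometry k f A Z) {G : (Fin d → ℝ) → ℝ} {a : ℝ}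
    (hG : ∀ p ∈ Icc (0 : Fin d → ℝ) 1, |G p| ≤ a) :
    |(∑ b ∈ Z, G b / |(A b).det|)| ≤ k.Q * (a / k.c) := by
  have ha : 0 ≤ a := (abs_nonneg _).trans (hG 0 ⟨le_rfl, zero_le_one⟩)
  have hc := k.c_pos
  have h1 : ∀ b ∈ Z, |(G b / |(A b).det|)| ≤ a / k.c := by
    intro b hb
    rw [abs_div, abs_abs]
    exact div_le_div₀ ha (hG b (g.mem_Icc hb)) hc (g.jacobian b hb)
  refine (Finset.abs_sum_le_sum_abs _ _).trans ((Finset.sum_le_sum h1).trans ?_)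
  rw [Finset.sum_const, nsmul_eq_mul]
  have h2 : (Z.card : ℝ) ≤ k.Q := by exact_mod_cast g.card_le
  gcongr

open Classical in
/-- The sampling error when the smoothing length `ω` is smaller than the standard deviation of the
samples: it suffices that both averages are bounded by a multiple of `h / ω ^ 2 ≥ 1`. -/
lemma exists_error_of_sq_le (d : ℕ) (hd : 1 ≤ d) (k : SampleBounds) (V a ω₀ : ℝ) (hω₁ : ω₀ ≤ 1)
    (hω₀c : 2 * ω₀ ≤ k.c₀) :
    ∃ C, 0 ≤ C ∧ ∀ {Ω : Type} {N : ℕ} {E : (Ω → ℝ) →ₗ[ℝ] ℝ} {alive : (Fin d → ℤ) → Set Ω}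
      {Y : (Fin d → ℤ) → Ω → Fin d → ℝ} {f : (Fin d → ℝ) → Fin d → ℝ}
      {A : (Fin d → ℝ) → (Fin d → ℝ) →L[ℝ] Fin d → ℝ} {Z : Finset (Fin d → ℝ)}
      {δ : ℝ → (Fin d → ℝ) → ℝ} {ω : ℝ} {G : (Fin d → ℝ) → ℝ},
      IsSample k N E alive Y f Z → ZeroGeometry k f A Z → 1 ≤ N → IsMollifier V δ →
      1 / (N : ℝ) ≤ ω → ω ≤ ω₀ → ω ^ 2 ≤ 1 / (N : ℝ) →
      (∀ p ∈ Icc (0 : Fin d → ℝ) 1, |G p| ≤ a) →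
      |(1 / (N : ℝ)) ^ d * ∑ l ∈ gridIndices d N, G (gridPoint N l)
        * E ((alive l).indicator fun w => δ ω (Y l w)) - (∑ b ∈ Z, G b / |(A b).det|)|
        ≤ C * (1 / (N : ℝ) / ω ^ 2) := by
  have hc := k.c_pos
  have hc₀ := k.c₀_pos
  set R := 8 / k.c + 1 with hR
  have hR1 : 1 ≤ R := by
    have : 0 < 8 / k.c := by positivity
    linarith
  have hR8 : 8 ≤ k.c * R := by rw [hR, mul_add, mul_div_cancel₀ _ hc.ne']; linarith
  set C₁ := V * d * k.mom d * (2 / k.c₀) ^ (2 * d + 2) with hC₁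
  set C₂ := V * ((2 * R + 1) ^ d + d * k.mom (3 * d * (d + 2))
          * (32 / k.c ^ 2) ^ (3 * d * (d + 2) + 1)) with hC₂
  refine ⟨|a * (C₁ + k.Q * C₂)| + |k.Q * (a / k.c)|, by positivity, ?_⟩
  intro Ω N E alive Y f A Z δ ω G s g hN hδ hω hωω₀ hh hG
  have hN0 : (0 : ℝ) < N := by exact_mod_cast hN
  set h : ℝ := 1 / (N : ℝ) with hhdef
  have hh0 : 0 < h := by positivity
  have hω' : 0 < ω := hh0.trans_le hω
  have hω1 : ω ≤ 1 := hωω₀.trans hω₁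
  have hV := hδ.nonneg
  have ha : 0 ≤ a := (abs_nonneg _).trans (hG 0 ⟨le_rfl, zero_le_one⟩)
  have hm := k.mom_nonneg
  set q := h / ω ^ 2 with hq
  have hq1 : 1 ≤ q := by rw [hq, one_le_div (by positivity)]; exact hh
  have hq0 : 0 ≤ q := by linarith
  set e : (Fin d → ℤ) → ℝ := fun l => E ((alive l).indicator fun w => |δ ω (Y l w)|) with he
  have he0 : ∀ l, 0 ≤ e l := fun l => s.nonneg_tail l
  have hcard : (Z.card : ℝ) ≤ k.Q := by exact_mod_cast g.card_le
  have hall : h ^ d * ∑ l ∈ gridIndices d N, e l ≤ (C₁ + k.Q * C₂) * q := by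
    have h1 : h ^ d * ∑ l ∈ gridIndices d N with k.c₀ ≤ ‖f (gridPoint N l)‖, e l ≤ C₁ * q :=
      s.sum_tail_le hN hδ hω hω1 (by linarith) _ (Finset.filter_subset _ _)
        fun l hl => (Finset.mem_filter.1 hl).2
    have h2 : ∑ l ∈ gridIndices d N with ¬ k.c₀ ≤ ‖f (gridPoint N l)‖, e l
        ≤ ∑ b ∈ Z, ∑ l ∈ (gridIndices d N).filter (fun l => ¬ k.c₀ ≤ ‖f (gridPoint N l)‖)
          with ‖gridPoint N l - b‖ ≤ k.r, e l :=
      sum_le_sum_cover _ Z (fun b l => ‖gridPoint N l - b‖ ≤ k.r) e (fun l _ => he0 l)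
        fun l hl => by
          have h3 := Finset.mem_filter.1 hl
          exact g.far _ (gridPoint_mem_Icc hN h3.1) (not_le.1 h3.2)
    have h3 : ∀ b ∈ Z, h ^ d * ∑ l ∈ (gridIndices d N).filter
          (fun l => ¬ k.c₀ ≤ ‖f (gridPoint N l)‖) with ‖gridPoint N l - b‖ ≤ k.r, e l
            ≤ C₂ * q := by
      intro b hb
      exact s.clustered_le g hd hN hδ hω hh hb hR1 hR8 _
        ((Finset.filter_subset _ _).trans (Finset.filter_subset _ _))
        fun l hl => (Finset.mem_filter.1 hl).2
    have h4 := Finset.sum_le_sum h3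
    rw [← Finset.mul_sum, Finset.sum_const, nsmul_eq_mul] at h4
    have hC₂0 : 0 ≤ C₂ := by have := hm (3 * d * (d + 2)); positivity
    have h6 : (Z.card : ℝ) * (C₂ * q) ≤ k.Q * (C₂ * q) := by gcongr
    have h7 := mul_le_mul_of_nonneg_left h2 (by positivity : 0 ≤ h ^ d)
    rw [← Finset.sum_filter_add_sum_filter_not (gridIndices d N)
      (fun l => k.c₀ ≤ ‖f (gridPoint N l)‖), mul_add]
    calc _ ≤ C₁ * q + k.Q * (C₂ * q) := add_le_add h1 (h7.trans (h4.trans h6))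
      _ = _ := by ring
  have h1 := (s.abs_sum_le hN _ subset_rfl hG (δ := δ) (ω := ω)).trans
    (mul_le_mul_of_nonneg_left hall ha)
  have h2 := g.abs_sum_le hG
  refine (abs_sub _ _).trans ((add_le_add h1 h2).trans ?_)
  have i1 := le_abs_self (a * (C₁ + k.Q * C₂))
  have i2 := le_abs_self (k.Q * (a / k.c))
  calc a * ((C₁ + k.Q * C₂) * q) + k.Q * (a / k.c)
      ≤ |a * (C₁ + k.Q * C₂)| * q + |k.Q * (a / k.c)| * q := by
        rw [← mul_assoc]
        have : |k.Q * (a / k.c)| ≤ |k.Q * (a / k.c)| * q :=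
          le_mul_of_one_le_right (abs_nonneg _) hq1
        have : a * (C₁ + k.Q * C₂) * q ≤ |a * (C₁ + k.Q * C₂)| * q := by gcongr
        linarith
    _ = _ := by ring

/-- The error of the average of smoothed delta functions over samples, in terms of the smoothing
length `ω` and the variance `h = 1 / N` of the samples. -/
lemma exists_sample_error (d : ℕ) (hd : 1 ≤ d) (k : SampleBounds) (V a : ℝ) :
    ∃ C, 0 ≤ C ∧ ∀ {Ω : Type} {N : ℕ} {E : (Ω → ℝ) →ₗ[ℝ] ℝ} {alive : (Fin d → ℤ) → Set Ω}
      {Y : (Fin d → ℤ) → Ω → Fin d → ℝ} {f : (Fin d → ℝ) → Fin d → ℝ}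
      {A : (Fin d → ℝ) → (Fin d → ℝ) →L[ℝ] Fin d → ℝ} {Z : Finset (Fin d → ℝ)}
      {δ : ℝ → (Fin d → ℝ) → ℝ} {ω : ℝ} {G : (Fin d → ℝ) → ℝ},
      IsSample k N E alive Y f Z → ZeroGeometry k f A Z → 1 ≤ N → IsMollifier V δ →
      1 / (N : ℝ) ≤ ω →
      (∀ p ∈ Icc (0 : Fin d → ℝ) 1, |G p| ≤ a) →
      (∀ p ∈ Icc (0 : Fin d → ℝ) 1, ∀ p' ∈ Icc (0 : Fin d → ℝ) 1, |G p - G p'| ≤ a * ‖p - p'‖) →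
      |(1 / (N : ℝ)) ^ d * ∑ l ∈ gridIndices d N, G (gridPoint N l)
        * E ((alive l).indicator fun w => δ ω (Y l w)) - (∑ b ∈ Z, G b / |(A b).det|)|
        ≤ C * (ω + 1 / (N : ℝ) / ω ^ 2) := by
  obtain ⟨R, ω₀, hR1, hR4, hR2, hω₀, hω₁, hω₀c, hω₀δ, hω₀r⟩ := k.exists_radius
  obtain ⟨C₁, hC₁, h₁⟩ := exists_error_of_le_sq d k V a R ω₀ hR1 hR4 hR2 hω₁ hω₀c hω₀δ hω₀r
  obtain ⟨C₂, hC₂, h₂⟩ := exists_error_of_sq_le d hd k V a ω₀ hω₁ hω₀c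
  refine ⟨C₁ + C₂ + |a * (V / ω₀ ^ d) + k.Q * (a / k.c)| / ω₀, by positivity, ?_⟩
  intro Ω N E alive Y f A Z δ ω G s g hN hδ hω hG hG'
  have hN0 : (0 : ℝ) < N := by exact_mod_cast hN
  have hω' : 0 < ω := lt_of_lt_of_le (by positivity) hω
  have hV := hδ.nonneg
  have ha : 0 ≤ a := (abs_nonneg _).trans (hG 0 ⟨le_rfl, zero_le_one⟩)
  set q := 1 / (N : ℝ) / ω ^ 2 with hq
  have hq0 : 0 ≤ q := by positivity
  set C₃ := |a * (V / ω₀ ^ d) + k.Q * (a / k.c)| / ω₀ with hC₃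
  have hC₃0 : 0 ≤ C₃ := by positivity
  have hx : 0 ≤ ω + q := by positivity
  rcases le_or_gt ω ω₀ with hle | hlt
  · rcases le_total (1 / (N : ℝ)) (ω ^ 2) with hh | hh
    · refine (h₁ s g hN hδ hω hle hh hG hG').trans ?_
      exact mul_le_mul_of_nonneg_right (by linarith) hx
    · refine (h₂ s g hN hδ hω hle hh hG).trans ?_
      exact mul_le_mul (by linarith) (by linarith) hq0 (by positivity)
  · have h1 : ∀ l ∈ gridIndices d N, E ((alive l).indicator fun w => |δ ω (Y l w)|)
        ≤ V / ω₀ ^ d := by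
      intro l _
      rw [← s.isMean.const (V / ω₀ ^ d)]
      refine s.isMean.mono _ _ fun w => ?_
      by_cases hw : w ∈ alive l
      · rw [Set.indicator_of_mem hw]
        refine (hδ.bound ω hω' _).trans ?_
        gcongr
      · rw [Set.indicator_of_notMem hw]; positivity
    have h2 := Finset.sum_le_sum h1
    rw [Finset.sum_const, nsmul_eq_mul] at h2
    have h3 : (1 / (N : ℝ)) ^ d * ∑ l ∈ gridIndices d N,
        E ((alive l).indicator fun w => |δ ω (Y l w)|) ≤ V / ω₀ ^ d := by
      calc _ ≤ (1 / (N : ℝ)) ^ d * ((gridIndices d N).card * (V / ω₀ ^ d)) :=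
            mul_le_mul_of_nonneg_left h2 (by positivity)
        _ = V / ω₀ ^ d := by rw [← mul_assoc, one_div_pow_mul_card hN, one_mul]
    have h4 := (s.abs_sum_le hN _ subset_rfl hG (δ := δ) (ω := ω)).trans
      (mul_le_mul_of_nonneg_left h3 ha)
    have h5 := g.abs_sum_le hG
    refine (abs_sub _ _).trans ((add_le_add h4 h5).trans ?_)
    calc a * (V / ω₀ ^ d) + k.Q * (a / k.c) ≤ C₃ * ω₀ := by
          rw [hC₃, div_mul_cancel₀ _ hω₀.ne']; exact le_abs_self _
      _ ≤ (C₁ + C₂ + C₃) * (ω + q) := by gcongr <;> linarith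

end SampleConclusion

/-! ### The scheme as an average over samples -/

section Instance

variable {d : ℕ} {H : (Fin d → ℝ) × (Fin d → ℝ) → ℝ} {u₀ : (Fin d → ℝ) → Fin d → ℝ}
  {φ : ℝ → (Fin d → ℝ) → (Fin d → ℝ) → Fin d → ℝ}

/-- The site of a configuration that carries the index `l`; the value off the grid is arbitrary. -/
noncomputable def sampleSite (N : ℕ) (l : Fin d → ℤ) (w : ↥(gridIndices d N) → Site d) : Site d :=
  if h : l ∈ gridIndices d N then w ⟨l, h⟩ else 0

/-- The average over `n` steps of the random flow started from all grid points over `j / N`. -/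
noncomputable def sampleMean (H : (Fin d → ℝ) × (Fin d → ℝ) → ℝ) (N : ℕ) (Δt : ℝ) (n : ℕ)
    (j : Fin d → ℤ) : ((↥(gridIndices d N) → Site d) → ℝ) →ₗ[ℝ] ℝ :=
  (LinearMap.proj fun l : ↥(gridIndices d N) => (j, (l : Fin d → ℤ))).comp
    (flowAvg (gridRate H N Δt) dirVec ^ n)

variable {N n : ℕ} {Δt : ℝ} {j l l' : Fin d → ℤ}

lemma sampleMean_apply (Φ : (↥(gridIndices d N) → Site d) → ℝ) :
    sampleMean H N Δt n j Φ = (flowAvg (gridRate H N Δt) dirVec ^ n) Φ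
      fun l : ↥(gridIndices d N) => (j, (l : Fin d → ℤ)) := rfl

lemma isMean_sampleMean : IsMean (sampleMean H N Δt n j) where
  mono _ _ h := flowAvg_pow_mono h n _
  const r := by rw [sampleMean_apply, flowAvg_pow_const]

lemma sampleSite_of_mem (hl : l ∈ gridIndices d N) (w : ↥(gridIndices d N) → Site d) :
    sampleSite N l w = w ⟨l, hl⟩ := dif_pos hl

lemma sampleMean_eval (hq : IsRate (gridRate H N Δt)) (f : Site d → ℝ) (hl : l ∈ gridIndices d N) :
    sampleMean H N Δt n j (fun w => f (sampleSite N l w))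
      = (walkStep (gridRate H N Δt) dirVec)^[n] f (j, l) := by
  simp only [sampleSite_of_mem hl]
  exact hq.flowAvg_pow_eval f (⟨l, hl⟩ : ↥(gridIndices d N)) n _

/-- The event that the walk started at `l` stays on the grid. -/
def aliveSet (d N : ℕ) (l : Fin d → ℤ) : Set (↥(gridIndices d N) → Site d) :=
  {w | sampleSite N l w ∈ gridSites d N}

lemma aliveSet_indicator (F : Site d → ℝ) :
    (aliveSet d N l).indicator (fun w => F (sampleSite N l w))
      = fun w => (gridSites d N).indicator F (sampleSite N l w) := rfl

/-- The value of the initial level set function at the endpoint of the walk started at `l`. -/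
noncomputable def sampleValue (φ : ℝ → (Fin d → ℝ) → (Fin d → ℝ) → Fin d → ℝ) (N : ℕ) (l : Fin d → ℤ)
    (w : ↥(gridIndices d N) → Site d) : Fin d → ℝ :=
  φ 0 (gridPoint N (sampleSite N l w).1) (gridPoint N (sampleSite N l w).2)

/-- The endpoints of the random flow sample the level set function. -/
lemma IsLevelSetFunction.isSample (hφ : IsLevelSetFunction H u₀ φ) {L T δ : ℝ}
    (hL : DriftBounds H L)
    (b : SmoothBounds (levelMap φ) (levelDeriv φ) (slab d T) L) (hN : 1 ≤ N) (hΔt : 0 < Δt)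
    (hC : CFL H N Δt) (hn : n * Δt ≤ T) {k : SampleBounds}
    (hmom : ∀ m, Real.exp (singleRate (Dir d) (obsConst d L) m * T)
      + Real.exp (pairRate (Dir d) (obsConst d L) m * T) ≤ k.mom m)
    (hκ : Real.exp (exitRate (Dir d) (Fin d ⊕ Fin d) L * T) * ((d + 1) / δ ^ 2) ≤ k.κ)
    {Z : Finset (Fin d → ℝ)}
    (hZ : ∀ p ∈ Z, ∃ ζ, IsInnerCurve H (n * Δt) δ ζ ∧ ζ (n * Δt) = (gridPoint N j, p)) :
    IsSample k N (sampleMean H N Δt n j) (aliveSet d N) (sampleValue φ N)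
      (φ (n * Δt) (gridPoint N j)) Z := by
  have hN0 : (0 : ℝ) < N := by exact_mod_cast hN
  have hL0 : 0 ≤ L := b.nonneg
  have hL0' : 0 ≤ obsConst d L := hL0.trans (le_obsConst (d := d) hL.one_le)
  have w := walkBounds_gridRate (hL.mono (le_obsConst (d := d) hL.one_le)) hN hΔt hC
  have hobs := fun i => hφ.observable hL b hN hΔt hC hn i
  have hnn : 0 ≤ n * Δt := by positivity
  have hsr : ∀ m, 0 ≤ singleRate (Dir d) (obsConst d L) m := fun m =>
    momentRate_nonneg _ (by positivity)
  have hpr : ∀ m, 0 ≤ pairRate (Dir d) (obsConst d L) m := fun m =>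
    have h0 : 0 ≤ pairConst (Dir d) (obsConst d L) := by unfold pairConst; positivity
    have h1 := momentRate_nonneg (2 * m) h0
    by unfold pairRate; positivity
  have her : 0 ≤ exitRate (Dir d) (Fin d ⊕ Fin d) L :=
    mul_nonneg (momentRate_nonneg _ (by positivity)) (by positivity)
  have hval : ∀ l w, sampleValue φ N l w
      = levelMap φ (((0 : ℕ) : ℝ) * Δt, sitePoint d N (sampleSite N l w)) := fun l w => by
    rw [Nat.cast_zero, zero_mul]; rfl
  refine ⟨isMean_sampleMean, fun m l hl i a => ?_, fun m l hl l' hl' i => ?_,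
    fun p hp l hl => ?_⟩
  · have h1 := (hobs i).moment_le w m a (⟨l, hl⟩ : ↥(gridIndices d N))
      (fun l : ↥(gridIndices d N) => (j, (l : Fin d → ℤ)))
    simp only [hval]
    rw [aliveSet_indicator fun z =>
      (levelMap φ (((0 : ℕ) : ℝ) * Δt, sitePoint d N z) i - a) ^ (2 * m + 2)]
    simp only [sampleSite_of_mem hl]
    refine h1.trans (mul_le_mul_of_nonneg_right ?_ ?_)
    · refine le_trans ?_ (hmom m)
      have h2 : Real.exp (singleRate (Dir d) (obsConst d L) m * (n * Δt))
          ≤ Real.exp (singleRate (Dir d) (obsConst d L) m * T) := by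
        have := hsr m
        gcongr
      have h3 := Real.exp_pos (pairRate (Dir d) (obsConst d L) m * T)
      linarith
    · exact add_nonneg (Even.pow_nonneg ⟨m + 1, by ring⟩ _) (by positivity)
  · have h1 := (hobs i).pair_moment_le w m (⟨l, hl⟩ : ↥(gridIndices d N)) ⟨l', hl'⟩
      (fun l : ↥(gridIndices d N) => (j, (l : Fin d → ℤ)))
    have e : ((aliveSet d N l ∩ aliveSet d N l').indicator fun w =>
        (sampleValue φ N l w i - sampleValue φ N l' w i
          - (φ (n * Δt) (gridPoint N j) (gridPoint N l) i
            - φ (n * Δt) (gridPoint N j) (gridPoint N l') i)) ^ (2 * m + 2))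
        = fun w => (gridSites d N ×ˢ gridSites d N).indicator (fun z : Site d × Site d =>
          (levelMap φ (((0 : ℕ) : ℝ) * Δt, sitePoint d N z.1) i
            - levelMap φ (((0 : ℕ) : ℝ) * Δt, sitePoint d N z.2) i
            - (levelMap φ (n * Δt, sitePoint d N (j, l)) i
            - levelMap φ (n * Δt, sitePoint d N (j, l')) i)) ^ (2 * m + 2))
          (w ⟨l, hl⟩, w ⟨l', hl'⟩) := by
      funext w
      simp only [hval, ← sampleSite_of_mem hl w, ← sampleSite_of_mem hl' w]
      rfl
    rw [e]
    have e2 : ‖sitePoint d N (j, l) - sitePoint d N (j, l')‖ = ‖gridPoint N l - gridPoint N l'‖ := by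
      rw [sitePoint_apply, sitePoint_apply, Prod.mk_sub_mk, Prod.norm_def, sub_self, norm_zero]
      exact max_eq_right (norm_nonneg _)
    rw [e2] at h1
    refine h1.trans (mul_le_mul_of_nonneg_right ?_ (by positivity))
    refine le_trans ?_ (hmom m)
    have h2 : Real.exp (pairRate (Dir d) (obsConst d L) m * (n * Δt))
        ≤ Real.exp (pairRate (Dir d) (obsConst d L) m * T) := by
      have := hpr m
      gcongr
    have h3 := Real.exp_pos (singleRate (Dir d) (obsConst d L) m * T)
    linarith
  · obtain ⟨ζ, hζ, hζt⟩ := hZ p hp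
    have h1 := hζ.exit_le hL hN hΔt hC (⟨l, hl⟩ : ↥(gridIndices d N))
      (fun l : ↥(gridIndices d N) => (j, (l : Fin d → ℤ))) (by rw [hζt])
    rw [hζt] at h1
    have e : ((aliveSet d N l)ᶜ.indicator fun _ => (1 : ℝ))
        = fun w => (gridSites d N)ᶜ.indicator (fun _ => 1) (w ⟨l, hl⟩) := by
      funext w
      simp only [← sampleSite_of_mem hl w]
      rfl
    rw [e]
    refine h1.trans ?_
    have hδ := hζ.pos
    calc Real.exp (exitRate (Dir d) (Fin d ⊕ Fin d) L * (n * Δt))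
          * ((d * ‖gridPoint N l - p‖ ^ 2 + 1 / (N : ℝ)) / δ ^ 2)
        ≤ Real.exp (exitRate (Dir d) (Fin d ⊕ Fin d) L * T)
          * (((d + 1) * (‖gridPoint N l - p‖ ^ 2 + 1 / (N : ℝ))) / δ ^ 2) := by
          have h2 : 0 ≤ 1 / (N : ℝ) := by positivity
          have h3 : (0 : ℝ) ≤ d := Nat.cast_nonneg d
          gcongr
          nlinarith [sq_nonneg ‖gridPoint N l - p‖]
      _ = Real.exp (exitRate (Dir d) (Fin d ⊕ Fin d) L * T) * ((d + 1) / δ ^ 2)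
          * (‖gridPoint N l - p‖ ^ 2 + 1 / (N : ℝ)) := by ring
      _ ≤ _ := by gcongr

lemma IsAdmissiblePoint.mem_Ioo {t : ℝ} {x p : Fin d → ℝ} (ht : 0 ≤ t)
    (h : IsAdmissiblePoint H φ t x) (hp : p ∈ branches φ t x) (i : Fin d) :
    x i ∈ Ioo (0 : ℝ) 1 ∧ p i ∈ Ioo (0 : ℝ) 1 := by
  obtain ⟨-, X, P, -, hX, hP, hin⟩ := h p hp
  have := hin t ⟨ht, le_rfl⟩ i
  rwa [hX, hP] at this

/-- The branches over admissible points are uniformly nondegenerate, and their bicharacteristics keep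
a uniform distance from the boundary. -/
lemma IsLevelSetFunction.exists_zeroGeometry (hφ : IsLevelSetFunction H u₀ φ)
    (hH : ContDiff ℝ 3 H) {K : Set (ℝ × (Fin d → ℝ))} (hK : IsCompact K)
    (hK0 : ∀ q ∈ K, 0 ≤ q.1) (hK1 : ∀ q ∈ K, q.2 ∈ Icc (0 : Fin d → ℝ) 1)
    (hadm : ∀ q ∈ K, IsAdmissiblePoint H φ q.1 q.2) :
    ∃ k : SampleBounds, ∀ q ∈ K, ∃ hfin : (branches φ q.1 q.2).Finite,
      ZeroGeometry k (φ q.1 q.2) (fun p => momentumDeriv φ (q.1, q.2, p)) hfin.toFinset ∧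
      ∀ (N n : ℕ) (Δt : ℝ) (j : Fin d → ℤ), 1 ≤ N → 0 < Δt → CFL H N Δt →
        q = (n * Δt, gridPoint N j) →
        IsSample k N (sampleMean H N Δt n j) (aliveSet d N) (sampleValue φ N) (φ q.1 q.2)
          hfin.toFinset := by
  obtain ⟨T, hT⟩ : ∃ T, ∀ q ∈ K, q.1 ≤ T := by
    obtain ⟨T, hT⟩ := (hK.image continuous_fst).bddAbove
    exact ⟨T, fun q hq => hT ⟨q, hq, rfl⟩⟩
  obtain ⟨L₁, hL₁⟩ := exists_driftBounds hH
  obtain ⟨L₂, hL₂⟩ := hφ.exists_smoothBounds T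
  set L := max L₁ L₂ with hLdef
  have hL := hL₁.mono (le_max_left L₁ L₂)
  have b := hL₂.mono (le_max_right L₁ L₂)
  rw [← hLdef] at hL b
  have hbr : ∀ q ∈ K, ∀ p ∈ branches φ q.1 q.2, p ∈ Icc (0 : Fin d → ℝ) 1 := fun q hq p hp =>
    ⟨fun i => ((hadm q hq).mem_Ioo (hK0 q hq) hp i).2.1.le,
      fun i => ((hadm q hq).mem_Ioo (hK0 q hq) hp i).2.2.le⟩
  obtain ⟨c, r, c₀, hg⟩ := hφ.exists_levelGeometry hK hK0 hK1 hbr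
    (fun q hq p hp => (hadm q hq p hp).1) hT b
  obtain ⟨Q, hQ⟩ := hg.exists_card_bound
  -- the compact set of branches
  set S : Set (ℝ × (Fin d → ℝ) × (Fin d → ℝ)) :=
    (fun y : (ℝ × (Fin d → ℝ)) × (Fin d → ℝ) => (y.1.1, y.1.2, y.2)) ''
      (K ×ˢ Icc (0 : Fin d → ℝ) 1) with hS
  have hSc : IsCompact S := (hK.prod isCompact_Icc).image (by fun_prop)
  have hS0 : S ⊆ halfSpace d := by
    rintro _ ⟨y, hy, rfl⟩
    exact ⟨hK0 _ hy.1, mem_univ _⟩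
  set Γ := S ∩ levelMap φ ⁻¹' {0} with hΓ
  have hΓc : IsCompact Γ := hSc.of_isClosed_subset
    ((hφ.continuousOn_levelMap.mono hS0).preimage_isClosed_of_isClosed hSc.isClosed
      isClosed_singleton) inter_subset_left
  obtain ⟨δ, hδ, hmargin⟩ := exists_uniform_margin hL hΓc (fun γ hγ => (hS0 hγ.1).1) (by
    rintro _ ⟨⟨y, hy, rfl⟩, hzero⟩
    obtain ⟨-, X, P, hbi, hX, hP, hin⟩ := hadm y.1 hy.1 y.2 hzero
    obtain ⟨δ, hδ⟩ := hbi.exists_isInnerCurve hin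
    exact ⟨_, δ, hδ, by simp [hX, hP]⟩)
  have hcurve : ∀ q ∈ K, ∀ p ∈ branches φ q.1 q.2,
      ∃ ζ, IsInnerCurve H q.1 δ ζ ∧ ζ q.1 = (q.2, p) := fun q hq p hp =>
    hmargin (q.1, q.2, p) ⟨⟨(q, p), ⟨hq, hbr q hq p hp⟩, rfl⟩, hp⟩
  have hL0 := b.nonneg
  let k : SampleBounds :=
    { c := c, r := r, c₀ := c₀, L := 3 * L, δ := δ
      κ := Real.exp (exitRate (Dir d) (Fin d ⊕ Fin d) L * T) * ((d + 1) / δ ^ 2)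
      Q := Q
      mom := fun m => Real.exp (singleRate (Dir d) (obsConst d L) m * T)
        + Real.exp (pairRate (Dir d) (obsConst d L) m * T)
      c_pos := hg.c_pos
      r_pos := hg.r_pos
      c₀_pos := hg.c₀_pos
      L_nonneg := by positivity
      δ_pos := hδ
      κ_nonneg := by positivity
      mom_nonneg := fun m => by positivity }
  have hin : ∀ q ∈ K, ∀ p ∈ Icc (0 : Fin d → ℝ) 1, (q.1, q.2, p) ∈ slab d T := fun q hq p hp =>
    mem_slab ⟨hK0 q hq, hT q hq⟩ (Icc_zero_one_subset (hK1 q hq)) (Icc_zero_one_subset hp)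
  refine ⟨k, fun q hq => ⟨(hQ q hq).1, ?_, ?_⟩⟩
  · have hmem : ∀ p, p ∈ (hQ q hq).1.toFinset ↔ p ∈ branches φ q.1 q.2 := fun p =>
      Set.Finite.mem_toFinset _
    refine
      { zero := fun p hp => (hmem p).1 hp
        card_le := ?_
        inner := fun p hp p' hpp' i => ?_
        jacobian := fun p hp => hg.jacobian q hq p ((hmem p).1 hp)
        lower := fun p hp => hg.lower q hq p ((hmem p).1 hp)
        upper := fun p hp v => ?_
        near := fun p hp => hg.near q hq p ((hmem p).1 hp)
        far := fun p hp hlt => ?_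
        approx := fun p₀ hp₀ p hp p' hp' ρ hρ hρ' => ?_
        separated := fun p hp p' hp' hle =>
          hg.separated hq ((hmem p).1 hp) ((hmem p').1 hp') hle }
    · rw [← Set.ncard_eq_toFinset_card _ (hQ q hq).1]
      exact (hQ q hq).2
    · obtain ⟨ζ, hζ, hζt⟩ := hcurve q hq p ((hmem p).1 hp)
      have h1 : (q.2, p') ∈ Metric.ball (ζ q.1) δ := by
        rw [hζt, Metric.mem_ball, dist_eq_norm, Prod.mk_sub_mk, sub_self, Prod.norm_def, norm_zero]
        exact max_lt hδ hpp'
      exact (hζ.margin q.1 ⟨hK0 q hq, le_rfl⟩ h1 i).2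
    · have hp1 := hbr q hq p ((hmem p).1 hp)
      show ‖momentumDeriv φ (q.1, q.2, p) v‖ ≤ 3 * L * ‖v‖
      rw [momentumDeriv_apply]
      refine (ContinuousLinearMap.le_opNorm _ _).trans ?_
      rw [norm_zero_zero_mk]
      have := b.bound _ (hin q hq p hp1)
      gcongr
      linarith
    · obtain ⟨p', hp', hle⟩ := hg.far q hq p hp hlt
      exact ⟨p', (hmem p').2 hp', hle⟩
    · exact norm_level_sub_sub_le b (hin q hq p₀ (hbr q hq p₀ ((hmem p₀).1 hp₀)))
        (hin q hq p hp) (hin q hq p' hp') hρ hρ'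
  · rintro N n Δt j hN hΔt hC rfl
    exact hφ.isSample hL b hN hΔt hC (hT _ hq) (fun m => le_rfl) le_rfl fun p hp =>
      hcurve _ hq p ((Set.Finite.mem_toFinset _).1 hp)

/-- The error of the scheme for a single level set function. -/
lemma IsLevelSetFunction.exists_error (hφ : IsLevelSetFunction H u₀ φ) (hd : 1 ≤ d)
    (hH : ContDiff ℝ 3 H) {K : Set (ℝ × (Fin d → ℝ))} (hK : IsCompact K)
    (hK0 : ∀ q ∈ K, 0 ≤ q.1) (hadm : ∀ q ∈ K, IsAdmissiblePoint H φ q.1 q.2)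
    {G : (Fin d → ℝ) → ℝ} {a V : ℝ} (hG : ∀ p ∈ Icc (0 : Fin d → ℝ) 1, |G p| ≤ a)
    (hG' : ∀ p ∈ Icc (0 : Fin d → ℝ) 1, ∀ p' ∈ Icc (0 : Fin d → ℝ) 1,
      |G p - G p'| ≤ a * ‖p - p'‖)
    {δ : ℝ → (Fin d → ℝ) → ℝ} (hδ : IsMollifier V δ) :
    (∀ q ∈ K, (branches φ q.1 q.2).Finite) ∧
    ∃ C, 0 ≤ C ∧ ∀ (N n : ℕ) (Δt : ℝ) (j : Fin d → ℤ), 1 ≤ N → 0 < Δt → CFL H N Δt →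
      j ∈ gridIndices d N → ((n : ℝ) * Δt, gridPoint N j) ∈ K → ∀ ω, 1 / (N : ℝ) ≤ ω →
      |(1 / (N : ℝ)) ^ d * ∑ l ∈ gridIndices d N, G (gridPoint N l)
          * (walkStep (gridRate H N Δt) dirVec)^[n] ((gridSites d N).indicator fun z =>
            δ ω (gridPoint N z.2 - u₀ (gridPoint N z.1))) (j, l)
        - ∑ᶠ p ∈ branches φ (n * Δt) (gridPoint N j),
          G p / levelJacobian φ (n * Δt) (gridPoint N j) p|
        ≤ C * (ω + 1 / (N : ℝ) / ω ^ 2) := by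
  -- points of `K` outside of the unit cube have no branches
  set K' := K ∩ {q | q.2 ∈ Icc (0 : Fin d → ℝ) 1} with hK'
  have hK'c : IsCompact K' := hK.inter_right (isClosed_Icc.preimage continuous_snd)
  obtain ⟨k, hk⟩ := hφ.exists_zeroGeometry hH hK'c (fun q hq => hK0 q hq.1) (fun q hq => hq.2)
    fun q hq => hadm q hq.1
  constructor
  · intro q hq
    rcases (branches φ q.1 q.2).eq_empty_or_nonempty with h | ⟨p, hp⟩
    · rw [h]; exact Set.finite_empty
    · have h1 := (hadm q hq).mem_Ioo (hK0 q hq) hp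
      exact (hk q ⟨hq, fun i => (h1 i).1.1.le, fun i => (h1 i).1.2.le⟩).1
  obtain ⟨C, hC0, hC⟩ := exists_sample_error d hd k V a
  refine ⟨C, hC0, fun N n Δt j hN hΔt hCFL hj hq ω hω => ?_⟩
  obtain ⟨hfin, g, s⟩ := hk (n * Δt, gridPoint N j) ⟨hq, gridPoint_mem_Icc hN hj⟩
  have h1 := hC (s N n Δt j hN hΔt hCFL rfl) g hN hδ hω hG hG'
  have e1 : ∑ᶠ p ∈ branches φ (n * Δt) (gridPoint N j),
      G p / levelJacobian φ (n * Δt) (gridPoint N j) p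
      = ∑ p ∈ hfin.toFinset, G p / |(momentumDeriv φ (n * Δt, gridPoint N j, p)).det| := by
    rw [finsum_mem_eq_finite_toFinset_sum _ hfin]
    refine Finset.sum_congr rfl fun p _ => ?_
    rw [hφ.levelJacobian_eq (by positivity)]
  have e2 : ∀ l ∈ gridIndices d N,
      sampleMean H N Δt n j ((aliveSet d N l).indicator fun w => δ ω (sampleValue φ N l w))
      = (walkStep (gridRate H N Δt) dirVec)^[n] ((gridSites d N).indicator fun z =>
            δ ω (gridPoint N z.2 - u₀ (gridPoint N z.1))) (j, l) := by
    intro l hl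
    rw [← sampleMean_eval (hCFL.isRate hN hΔt) _ hl, ← aliveSet_indicator]
    congr 2
    funext w
    rw [sampleValue, hφ.initial]
  rw [e1]
  rw [Finset.sum_congr rfl fun l hl => by rw [e2 l hl]] at h1
  exact h1

lemma walkStep_iterate_sum {Z D ι : Type*} [Fintype D] [AddCommGroup Z]
    {q : D → Z → ℝ} {e : D → Z}
    (hq : IsRate q) (s : Finset ι) (c : ℝ) (f : ι → Z → ℝ) (n : ℕ) (z : Z) :
    (walkStep q e)^[n] (fun z => c * ∑ k ∈ s, f k z) z
      = c * ∑ k ∈ s, (walkStep q e)^[n] (f k) z := by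
  have h := fun F : Z → ℝ => hq.flowAvg_pow_eval (e := e) F () n fun _ => z
  rw [← h]
  simp only [← h]
  have e1 : (fun w : Unit → Z => c * ∑ k ∈ s, f k (w ())) = c • ∑ k ∈ s, fun w => f k (w ()) := by
    funext w; simp
  rw [e1, map_smul, map_sum]
  simp

end Instance

/-! ### The ensemble average -/

lemma discreteAverage_eq {d M : ℕ} (G : (Fin d → ℝ) → ℝ) {H : (Fin d → ℝ) × (Fin d → ℝ) → ℝ}
    (u₀ : Fin M → (Fin d → ℝ) → Fin d → ℝ) (β : ℝ → ℝ) (ω : ℝ) {N : ℕ} {Δt : ℝ} (hN : 1 ≤ N)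
    (hΔt : 0 < Δt) (hC : CFL H N Δt) (n : ℕ) (j : Fin d → ℤ) :
    discreteAverage G H u₀ β ω N Δt n j = (1 / (M : ℝ)) * ∑ k, (1 / (N : ℝ)) ^ d *
      ∑ l ∈ gridIndices d N, G (gridPoint N l)
        * (walkStep (gridRate H N Δt) dirVec)^[n] ((gridSites d N).indicator fun z =>
            deltaProd β ω (gridPoint N z.2 - u₀ k (gridPoint N z.1))) (j, l) := by
  have hinit : ((gridSites d N).indicator fun z => initialGrid u₀ β ω N z.1 z.2)
      = fun z => (1 / (M : ℝ)) * ∑ k, (gridSites d N).indicator (fun z =>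
          deltaProd β ω (gridPoint N z.2 - u₀ k (gridPoint N z.1))) z := by
    funext z
    by_cases hz : z ∈ gridSites d N
    · simp only [Set.indicator_of_mem hz]; rfl
    · simp [Set.indicator_of_notMem hz]
  have h1 : ∀ l, upwindSolution H u₀ β ω N Δt n j l = (1 / (M : ℝ)) * ∑ k,
      (walkStep (gridRate H N Δt) dirVec)^[n] ((gridSites d N).indicator fun z =>
            deltaProd β ω (gridPoint N z.2 - u₀ k (gridPoint N z.1))) (j, l) := by
    intro l
    have h2 := upwindSolution_eq_iterate H u₀ β ω N Δt n (j, l)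
    rw [hinit, walkStep_iterate_sum (hC.isRate hN hΔt)] at h2
    exact h2
  rw [discreteAverage, ← one_div_pow]
  simp only [h1, Finset.mul_sum]
  rw [Finset.sum_comm]
  refine Finset.sum_congr rfl fun k _ => Finset.sum_congr rfl fun l _ => ?_
  ring

lemma exists_bound_lipschitz_of_locallyLipschitz {d : ℕ} {G : (Fin d → ℝ) → ℝ}
    (hG : LocallyLipschitz G) : ∃ a : ℝ, (∀ p ∈ Icc (0 : Fin d → ℝ) 1, |G p| ≤ a) ∧
      ∀ p ∈ Icc (0 : Fin d → ℝ) 1, ∀ p' ∈ Icc (0 : Fin d → ℝ) 1, |G p - G p'| ≤ a * ‖p - p'‖ := by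
  obtain ⟨B, hB⟩ := (isCompact_Icc : IsCompact (Icc (0 : Fin d → ℝ) 1)).exists_bound_of_continuousOn
    hG.continuous.continuousOn
  obtain ⟨κ, hκ⟩ := LocallyLipschitzOn.exists_lipschitzOnWith_of_compact
    (isCompact_Icc : IsCompact (Icc (0 : Fin d → ℝ) 1)) hG.locallyLipschitzOn
  refine ⟨max B κ, fun p hp => (hB p hp).trans (le_max_left _ _), fun p hp p' hp' => ?_⟩
  have := hκ.dist_le_mul p hp p' hp'
  rw [Real.dist_eq, dist_eq_norm] at this
  exact this.trans (mul_le_mul_of_nonneg_right (le_max_right _ _) (norm_nonneg _))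

/-- The choice `ω = s ^ (1 / 3)` balances `ω` and `s / ω ^ 2`. -/
lemma rpow_third_add_div {s : ℝ} (hs : 0 < s) :
    s ^ (1 / 3 : ℝ) + s / (s ^ (1 / 3 : ℝ)) ^ 2 = 2 * s ^ (1 / 3 : ℝ) := by
  have h1 : 0 < s ^ (1 / 3 : ℝ) := Real.rpow_pos_of_pos hs _
  have h2 : (s ^ (1 / 3 : ℝ)) ^ 3 = s := by
    rw [← Real.rpow_natCast, ← Real.rpow_mul hs.le]; norm_num
  have h3 : s / (s ^ (1 / 3 : ℝ)) ^ 2 = s ^ (1 / 3 : ℝ) := by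
    rw [div_eq_iff (by positivity)]
    nth_rw 1 [← h2]
    ring
  rw [h3]; ring

lemma le_rpow_third {h s : ℝ} (h0 : 0 < h) (h1 : h ≤ 1) (hs : h ≤ s) : h ≤ s ^ (1 / 3 : ℝ) := by
  calc h = h ^ (1 : ℝ) := (Real.rpow_one h).symm
    _ ≤ h ^ (1 / 3 : ℝ) := Real.rpow_le_rpow_of_exponent_ge h0 h1 (by norm_num)
    _ ≤ s ^ (1 / 3 : ℝ) := Real.rpow_le_rpow h0.le hs (by norm_num)

theorem mainTheorem12 (d M : ℕ) (hd : 1 ≤ d) (hM : 1 ≤ M)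
    (H : (Fin d → ℝ) × (Fin d → ℝ) → ℝ) (hH : ContDiff ℝ 3 H)
    (u₀ : Fin M → (Fin d → ℝ) → Fin d → ℝ)
    (φ : Fin M → ℝ → (Fin d → ℝ) → (Fin d → ℝ) → Fin d → ℝ)
    (hφ : ∀ k, IsLevelSetFunction H (u₀ k) (φ k))
    (G : (Fin d → ℝ) → ℝ) (hG : LocallyLipschitz G)
    (β : ℝ → ℝ) (hβ : IsDeltaProfile β)
    (K : Set (ℝ × (Fin d → ℝ))) (hK : IsCompact K) (hK0 : ∀ q ∈ K, 0 ≤ q.1)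
    (hadm : ∀ q ∈ K, ∀ k, IsAdmissiblePoint H (φ k) q.1 q.2) :
    (∀ q ∈ K, ∀ k, (branches (φ k) q.1 q.2).Finite) ∧
    ∃ C : ℝ, 0 < C ∧
      ∀ (N : ℕ) (Δt : ℝ), 1 ≤ N → 0 < Δt → CFL H N Δt →
        ∀ (n : ℕ) (j : Fin d → ℤ), j ∈ gridIndices d N →
          ((n : ℝ) * Δt, gridPoint N j) ∈ K →
          (∀ ω : ℝ, 1 / (N : ℝ) ≤ ω →
            |ensembleAverage G φ ((n : ℝ) * Δt) (gridPoint N j)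
                - discreteAverage G H u₀ β ω N Δt n j|
              ≤ C * (ω + (d : ℝ) * (1 / (N : ℝ)) / ω ^ 2)) ∧
          |ensembleAverage G φ ((n : ℝ) * Δt) (gridPoint N j)
              - discreteAverage G H u₀ β (((d : ℝ) * (1 / (N : ℝ))) ^ (1 / 3 : ℝ)) N Δt n j|
            ≤ C * ((d : ℝ) * (1 / (N : ℝ))) ^ (1 / 3 : ℝ) := by
  obtain ⟨a, ha, ha'⟩ := exists_bound_lipschitz_of_locallyLipschitz hG
  obtain ⟨V, hV⟩ := hβ.exists_isMollifier d
  have herr := fun k => (hφ k).exists_error hd hH hK hK0 (fun q hq => hadm q hq k) ha ha' hV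
  refine ⟨fun q hq k => (herr k).1 q hq, ?_⟩
  choose hfin C hC0 hC using herr
  set B := ∑ k, C k with hB
  have hB0 : 0 ≤ B := Finset.sum_nonneg fun k _ => hC0 k
  have hM1 : (1 : ℝ) ≤ M := by exact_mod_cast hM
  have hd1 : (1 : ℝ) ≤ d := by exact_mod_cast hd
  have main : ∀ (N : ℕ) (Δt : ℝ), 1 ≤ N → 0 < Δt → CFL H N Δt →
      ∀ (n : ℕ) (j : Fin d → ℤ), j ∈ gridIndices d N → ((n : ℝ) * Δt, gridPoint N j) ∈ K →
        ∀ ω : ℝ, 1 / (N : ℝ) ≤ ω →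
          |ensembleAverage G φ ((n : ℝ) * Δt) (gridPoint N j)
            - discreteAverage G H u₀ β ω N Δt n j|
              ≤ B * (ω + (d : ℝ) * (1 / (N : ℝ)) / ω ^ 2) := by
    intro N Δt hN hΔt hCFL n j hj hq ω hω
    have hN0 : (0 : ℝ) < N := by exact_mod_cast hN
    have hω0 : 0 < ω := lt_of_lt_of_le (by positivity) hω
    have hle : 1 / (N : ℝ) / ω ^ 2 ≤ (d : ℝ) * (1 / (N : ℝ)) / ω ^ 2 := by
      have : 1 / (N : ℝ) ≤ (d : ℝ) * (1 / (N : ℝ)) := le_mul_of_one_le_left (by positivity) hd1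
      gcongr
    rw [discreteAverage_eq G u₀ β ω hN hΔt hCFL, ensembleAverage, abs_sub_comm, ← mul_sub,
      ← Finset.sum_sub_distrib, abs_mul, abs_of_pos (by positivity)]
    have h1 := (Finset.abs_sum_le_sum_abs _ _).trans (Finset.sum_le_sum
      fun k (_ : k ∈ Finset.univ) => hC k N n Δt j hN hΔt hCFL hj hq ω hω)
    rw [← Finset.sum_mul, ← hB] at h1
    have h2 : 1 / (M : ℝ) ≤ 1 := by rw [div_le_one (by linarith)]; exact hM1
    have h3 : 0 ≤ B * (ω + 1 / (N : ℝ) / ω ^ 2) := by positivity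
    calc _ ≤ 1 * (B * (ω + 1 / (N : ℝ) / ω ^ 2)) :=
          mul_le_mul h2 h1 (abs_nonneg _) zero_le_one
      _ ≤ _ := by rw [one_mul]; gcongr
  refine ⟨2 * B + 1, by positivity, fun N Δt hN hΔt hCFL n j hj hq => ⟨fun ω hω => ?_, ?_⟩⟩
  · have hN0 : (0 : ℝ) < N := by exact_mod_cast hN
    have hω0 : 0 < ω := lt_of_lt_of_le (by positivity) hω
    refine (main N Δt hN hΔt hCFL n j hj hq ω hω).trans ?_
    exact mul_le_mul_of_nonneg_right (by linarith) (by positivity)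
  · have hN0 : (0 : ℝ) < N := by exact_mod_cast hN
    have hh0 : 0 < 1 / (N : ℝ) := by positivity
    have hh1 : 1 / (N : ℝ) ≤ 1 := by rw [div_le_one hN0]; exact_mod_cast hN
    have hle : 1 / (N : ℝ) ≤ (d : ℝ) * (1 / (N : ℝ)) := le_mul_of_one_le_left hh0.le hd1
    have hs : 0 < (d : ℝ) * (1 / (N : ℝ)) := hh0.trans_le hle
    refine (main N Δt hN hΔt hCFL n j hj hq _ (le_rpow_third hh0 hh1 hle)).trans ?_
    rw [rpow_third_add_div hs]
    have h1 : 0 ≤ ((d : ℝ) * (1 / (N : ℝ))) ^ (1 / 3 : ℝ) := Real.rpow_nonneg hs.le _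
    nlinarith
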